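/- Setting. Let $A,A_r\in\mathbb R^{n\times n}$, $B\in\mathbb R^{n\times m}$, and consider the augmented tracking system $\dot X=FX+Gu$, $X=(\tilde x,x_r)\in\mathbb R^{2n}$, $F=\begin{bmatrix}A&A-A_r\\0&A_r\end{bmatrix}$, $G=\begin{bmatrix}B\\0\end{bmatrix}$, with input constraint $|u_j|\le\lambda$, $\lambda>0$, and the discounted cost $$J=\int_0^\infty e^{-\gamma\tau}r(X,u)\,d\tau,\quad r(X,u)=\tilde x^\top M\tilde x+U_R(u),\quad U_\Lambda(u)=2\int_0^u\big(\lambda\tanh^{-1}(v/\lambda)\big)^\top\Lambda\,dv ,$$ where the line integral runs along the segment from $0$ to $u$, $\gamma>0$, $M\succeq0$, and $R$ is diagonal and positive definite. Assume that $(A,\sqrt M)$ is observable and $(A,B)$ is stabilizable. Let $\Phi:\mathbb R^{2n}\to\mathbb R^L$ be $C^2$ and, for a gain $K\in\mathbb R^{m\times 2nL}$, let $u_K(x)=-\lambda\tanh\big(\tfrac1\lambda K\,\mathrm{vec}(\nabla\Phi^\top(x))\big)$ (componentwise). Assume that $u_{K_0}$ is admissible, i.e. continuous and within the bound, with a closed-loop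 trajectory on $[0,\infty)$ from every initial state and with finite cost along every closed-loop trajectory. Data. At iteration $i$, data are taken from a trajectory $(X,u)$ of the augmented system with $|u_j|<\lambda$ and with $\tanh^{-1}(u_j/\lambda)$ integrable, at sampling times $t_0<\dots<t_N$ (all of these may depend on $i$). On each $[t_k,t_{k+1}]$, with all integrals weighted by $e^{-\gamma(\tau-t_k)}$ and $u_i=u_{K_i}(X)$, let $\tilde\psi=e^{-\gamma(t_{k+1}-t_k)}\Phi^\top(X(t_{k+1}))-\Phi^\top(X(t_k))$, $\tilde\xi=\int r(X,u)$, $\tilde\mu=\int u\otimes\mathrm{vec}(\nabla\Phi^\top)$, $\tilde\phi_i=\int u_i\otimes\mathrm{vec}(\nabla\Phi^\top)$, $\tilde\eta=\int(u-u_i)\otimes\mathrm{vec}(\nabla\Phi^\top)$, $\tilde\nu=\int\sigma(u)$, $\tilde\nu_i=\int\sigma(u_i)$, where $\sigma(u)=u\otimes2\lambda\tanh^{-1}(u/\lambda)+\ln(\mathbf 1-(u/\lambda)^2)\otimes\lambda^2\mathbf 1$, and $\tilde\omega_i=\int U_{\Lambda_{uu(i-1)}}(u_i)$. Stack these quantities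 as rows over $k$. Algorithms. Put $\Theta_i=(W_i,\mathrm{vec}\,\Lambda_{xu(i)},\mathrm{vec}\,\Lambda_{uu(i)})=(\Delta_i^\top\Delta_i)^{-1}\Delta_i^\top\Xi_i$ and $K_{i+1}=\tfrac12\Lambda_{uu(i)}^{-1}\Lambda_{xu(i)}^\top$, where (a) off-policy algorithm: $\Delta_i=[-\tilde\psi,\ \tilde\mu-\tilde\phi_i,\ \tilde\nu]$, $\Xi_i=\tilde\xi+\tilde\omega_i$, with an arbitrary initial matrix $\Lambda_{uu(-1)}$; (b) time-iterative algorithm: $\Delta_i=[-\tilde\psi,\ \tilde\eta,\ \tilde\nu-\tilde\nu_i]$, $\Xi_i=\tilde\xi$. Theorem. For either algorithm, assume that $\Delta_i$ has full column rank for every $i$ and that for every $i$ the value function of the policy $u_i=u_{K_i}$ (its cost as a function of the initial state; in (a), with $R$ replaced by $\Lambda_{uu(i-1)}$) is of the form $W^\top\Phi$ for some $W\in\mathbb R^L$. Then, with $V_i=W_i^\top\Phi$, the algorithm performs policy iteration: for all $i$ and $X$, $$r(X,u_i)-\gamma V_i+\nabla V_i^\top(FX+Gu_i)=0,\qquad u_{i+1}=-\lambda\tanh\big(\tfrac12(\lambda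 R)^{-1}G^\top\nabla V_i\big),$$ (in (a) with $\Lambda_{uu(i-1)}$ in place of $R$ in $r$, and $\Lambda_{uu(i)}=R$ for all $i\ge0$). Moreover there is a unique $W^*\in\mathbb R^L$ such that $V^*=W^{*\top}\Phi$ is at every initial state the minimum of $J$ over all measurable controls with $|u_j|\le\lambda$ and solves the Hamilton–Jacobi–Bellman equation $r(X,u^*)-\gamma V^*+\nabla V^{*\top}(FX+Gu^*)=0$ with $u^*=-\lambda\tanh\big(\tfrac12(\lambda R)^{-1}G^\top\nabla V^*\big)$; and $W_i\to W^*$ as $i\to\infty$. -/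

import Mathlib

open MeasureTheory Set Filter Topology Matrix

noncomputable section

/-- `A` is Hurwitz: every complex eigenvalue has negative real part. -/
def IsHurwitz {n : ℕ} (A : Matrix (Fin n) (Fin n) ℝ) : Prop :=
  ∀ μ ∈ spectrum ℂ (A.map (algebraMap ℝ ℂ)), μ.re < 0

/-- Stabilizability of the pair `(A, B)`. -/
def IsStabilizable {n m : ℕ} (A : Matrix (Fin n) (Fin n) ℝ) (B : Matrix (Fin n) (Fin m) ℝ) :
    Prop :=
  ∃ K : Matrix (Fin m) (Fin n) ℝ, IsHurwitz (A - B * K)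

/-- Observability of the pair `(A, C)` (trivial kernel of the observability matrix). -/
def IsObservable {n : ℕ} (A C : Matrix (Fin n) (Fin n) ℝ) : Prop :=
  ∀ x : Fin n → ℝ, (∀ k : ℕ, C *ᵥ ((A ^ k) *ᵥ x) = 0) → x = 0

/-- Kronecker product of two column vectors. -/
def kronVec {ι κ : Type*} (u : ι → ℝ) (v : κ → ℝ) : ι × κ → ℝ := fun p => u p.1 * v p.2

/-- States `X = (x̃, x_r)` of the augmented system: tracking error and reference. -/
abbrev AugState (n : ℕ) : Type := Fin n ⊕ Fin n → ℝ

/-- Index set of `vec (∇Φᵀ)` for `L` basis functions. -/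
abbrev GradIdx (n L : ℕ) : Type := Fin L × (Fin n ⊕ Fin n)

/-- Index set of the unknown `Θ = (W, vec Λ_xu, vec Λ_uu)`. -/
abbrev ThetaIdx (n m L : ℕ) : Type := Fin L ⊕ ((Fin m × GradIdx n L) ⊕ (Fin m × Fin m))

/-- Gradient of a scalar function on the augmented state space. -/
def stateGrad {n : ℕ} (V : AugState n → ℝ) (x : AugState n) : AugState n :=
  fun k => fderiv ℝ V x (Pi.single k 1)

/-- The Jacobian `∇Φ`, an `L × 2n` matrix. -/
def jacobian {n L : ℕ} (Φ : AugState n → Fin L → ℝ) (x : AugState n) :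
    Matrix (Fin L) (Fin n ⊕ Fin n) ℝ :=
  Matrix.of fun l => stateGrad (fun y => Φ y l) x

/-- The vector `vec (∇Φᵀ(x))` (columns stacked). -/
def vecGrad {n L : ℕ} (Φ : AugState n → Fin L → ℝ) (x : AugState n) : GradIdx n L → ℝ :=
  ((jacobian Φ x)ᵀ).vec

/-- Data of the constrained-input tracking problem: plant `ẋ = A x + B u`, reference
`ẋ_r = A_r x_r`, weights `M`, `R`, input bound `lam`, discount factor `gam`. -/
structure TrackingProblem (n m : ℕ) where
  A : Matrix (Fin n) (Fin n) ℝ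
  B : Matrix (Fin n) (Fin m) ℝ
  Ar : Matrix (Fin n) (Fin n) ℝ
  M : Matrix (Fin n) (Fin n) ℝ
  R : Matrix (Fin m) (Fin m) ℝ
  lam : ℝ
  gam : ℝ

namespace TrackingProblem

variable {n m L : ℕ} (p : TrackingProblem n m)

/-- Drift matrix of the augmented system. -/
def F : Matrix (Fin n ⊕ Fin n) (Fin n ⊕ Fin n) ℝ := Matrix.fromBlocks p.A (p.A - p.Ar) 0 p.Ar

/-- Input matrix of the augmented system. -/
def G : Matrix (Fin n ⊕ Fin n) (Fin m) ℝ := Matrix.fromRows p.B 0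

/-- State penalty `x̃ᵀ M x̃`, written with the block matrix `diag(M, 0)`. -/
def stateCost (x : AugState n) : ℝ := x ⬝ᵥ (Matrix.fromBlocks p.M 0 0 0 *ᵥ x)

/-- The barrier `2 ∫₀ᵘ (lam tanh⁻¹(v / lam))ᵀ Λ dv`, integrated along the segment `v = s u`
(for diagonal `Λ` the line integral does not depend on the path). -/
def barrier (Λ : Matrix (Fin m) (Fin m) ℝ) (u : Fin m → ℝ) : ℝ :=
  2 * ∫ s in (0 : ℝ)..1, (fun a => p.lam * Real.artanh (s * u a / p.lam)) ⬝ᵥ (Λ *ᵥ u)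

/-- The reward `r(X, u)`, with input weight `Λ` (the true reward has `Λ = R`). -/
def reward (Λ : Matrix (Fin m) (Fin m) ℝ) (x : AugState n) (u : Fin m → ℝ) : ℝ :=
  p.stateCost x + p.barrier Λ u

/-- `X` solves `Ẋ = F X + G u` on the time set `S`, starting at time `t₀`, in the sense of
Carathéodory. -/
structure IsSolution (S : Set ℝ) (t₀ : ℝ) (X : ℝ → AugState n) (u : ℝ → Fin m → ℝ) : Prop where
  continuousOn : ContinuousOn X S
  aemeasurable : AEMeasurable u (volume.restrict S)
  eq : ∀ t ∈ S, X t = X t₀ + ∫ s in t₀..t, (p.F *ᵥ X s + p.G *ᵥ u s)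

/-- `(X, u)` is a trajectory on `[0, ∞)` from `x₀` whose input satisfies the constraint. -/
def IsControlled (x₀ : AugState n) (X : ℝ → AugState n) (u : ℝ → Fin m → ℝ) : Prop :=
  p.IsSolution (Ici 0) 0 X u ∧ X 0 = x₀ ∧ ∀ t, 0 ≤ t → ∀ a, |u t a| ≤ p.lam

/-- `X` is a closed-loop trajectory on `[0, ∞)` from `x₀` under the feedback policy `μ`. -/
def IsClosedLoop (μ : AugState n → Fin m → ℝ) (x₀ : AugState n) (X : ℝ → AugState n) : Prop :=
  p.IsSolution (Ici 0) 0 X (fun t => μ (X t)) ∧ X 0 = x₀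

/-- The infinite-horizon discounted cost of `(X, u)` with input weight `Λ` is finite and equals
`c`. -/
def HasCost (Λ : Matrix (Fin m) (Fin m) ℝ) (X : ℝ → AugState n) (u : ℝ → Fin m → ℝ) (c : ℝ) :
    Prop :=
  IntegrableOn (fun t => Real.exp (-p.gam * t) * p.reward Λ (X t) (u t)) (Ioi 0) ∧
    ∫ t in Ioi (0 : ℝ), Real.exp (-p.gam * t) * p.reward Λ (X t) (u t) = c

/-- `V` is the value function of the policy `μ` for the input weight `Λ`: from every initial state
there is a closed-loop trajectory, and every such trajectory has finite cost `V x₀`. -/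
def IsPolicyValue (Λ : Matrix (Fin m) (Fin m) ℝ) (μ : AugState n → Fin m → ℝ)
    (V : AugState n → ℝ) : Prop :=
  ∀ x₀, (∃ X, p.IsClosedLoop μ x₀ X) ∧
    ∀ X, p.IsClosedLoop μ x₀ X → p.HasCost Λ X (fun t => μ (X t)) (V x₀)

/-- Admissible policy: continuous, within the input bound, with well-posed closed loop and finite
cost from every initial state. -/
def IsAdmissible (μ : AugState n → Fin m → ℝ) : Prop :=
  Continuous μ ∧ (∀ x a, |μ x a| ≤ p.lam) ∧ ∃ V, p.IsPolicyValue p.R μ V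

/-- The policy `-lam tanh((1/lam) K vec(∇Φᵀ(x)))`. -/
def policy (Φ : AugState n → Fin L → ℝ) (K : Matrix (Fin m) (GradIdx n L) ℝ) (x : AugState n) :
    Fin m → ℝ :=
  fun a => -p.lam * Real.tanh ((1 / p.lam) * (K *ᵥ vecGrad Φ x) a)

/-- The policy improvement `-lam tanh(½ (lam R)⁻¹ Gᵀ ∇V)`. -/
def greedy (V : AugState n → ℝ) (x : AugState n) : Fin m → ℝ :=
  fun a => -p.lam * Real.tanh ((1 / 2) * ((p.lam • p.R)⁻¹ *ᵥ (p.Gᵀ *ᵥ stateGrad V x)) a)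

/-- The Hamiltonian `r(X, u) - gam V + (∇V)ᵀ (F X + G u)` with input weight `Λ`. -/
def hamiltonian (Λ : Matrix (Fin m) (Fin m) ℝ) (V : AugState n → ℝ) (x : AugState n)
    (u : Fin m → ℝ) : ℝ :=
  p.reward Λ x u - p.gam * V x + stateGrad V x ⬝ᵥ (p.F *ᵥ x + p.G *ᵥ u)

/-- `W` represents the optimal value function: `V* = Wᵀ Φ` is, at every state, the minimum of the
cost over all constrained controls, and it solves the Hamilton-Jacobi-Bellman equation. -/
def IsOptimalWeight (Φ : AugState n → Fin L → ℝ) (W : Fin L → ℝ) : Prop :=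
  (∀ x₀, IsLeast {c : ℝ | ∃ X u, p.IsControlled x₀ X u ∧ p.HasCost p.R X u c} (W ⬝ᵥ Φ x₀)) ∧
    ∀ x, p.hamiltonian p.R (fun y => W ⬝ᵥ Φ y) x (p.greedy (fun y => W ⬝ᵥ Φ y) x) = 0

/-- A recorded experiment: sampling times `time 0 < ⋯ < time N` and a trajectory of the augmented
system on `[time 0, time N]` under a behavior input strictly inside the bounds and for which the
barrier data are integrable. -/
structure Experiment where
  N : ℕ
  time : ℕ → ℝ
  X : ℝ → AugState n
  u : ℝ → Fin m → ℝ
  time_lt : ∀ k < N, time k < time (k + 1)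
  isSolution : p.IsSolution (Icc (time 0) (time N)) (time 0) X u
  abs_lt : ∀ t ∈ Icc (time 0) (time N), ∀ a, |u t a| < p.lam
  integrable : ∀ a, IntegrableOn (fun t => Real.artanh (u t a / p.lam)) (Icc (time 0) (time N))

/-- `u ⊗ 2 lam tanh⁻¹(u / lam) + ln(1 - (u / lam)²) ⊗ lam² 1`. -/
def nuIntegrand (u : Fin m → ℝ) : Fin m × Fin m → ℝ :=
  kronVec u (fun b => 2 * p.lam * Real.artanh (u b / p.lam)) +
    kronVec (fun a => Real.log (1 - (u a / p.lam) ^ 2)) (fun _ => p.lam ^ 2)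

namespace Experiment

variable {p} (E : p.Experiment)

/-- Discounted integral over the `k`-th sampling interval. -/
def discInt (k : Fin E.N) (f : ℝ → ℝ) : ℝ :=
  ∫ t in (E.time k)..(E.time (k + 1)), Real.exp (-p.gam * (t - E.time k)) * f t

/-- The data `ψ̃`. -/
def psi (Φ : AugState n → Fin L → ℝ) : Matrix (Fin E.N) (Fin L) ℝ :=
  Matrix.of fun k l => Real.exp (-p.gam * (E.time (k + 1) - E.time k)) *
    Φ (E.X (E.time (k + 1))) l - Φ (E.X (E.time k)) l

/-- The data `ξ̃` (measured rewards). -/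
def xi : Fin E.N → ℝ := fun k => E.discInt k fun t => p.reward p.R (E.X t) (E.u t)

/-- The data `μ̃`. -/
def mu (Φ : AugState n → Fin L → ℝ) : Matrix (Fin E.N) (Fin m × GradIdx n L) ℝ :=
  Matrix.of fun k j => E.discInt k fun t => kronVec (E.u t) (vecGrad Φ (E.X t)) j

/-- The data `φ̃_i` for the target policy `μᵢ`. -/
def phi (Φ : AugState n → Fin L → ℝ) (μᵢ : AugState n → Fin m → ℝ) :
    Matrix (Fin E.N) (Fin m × GradIdx n L) ℝ :=
  Matrix.of fun k j => E.discInt k fun t => kronVec (μᵢ (E.X t)) (vecGrad Φ (E.X t)) j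

/-- The data `η̃`, with exploration signal `w = u - uᵢ`. -/
def eta (Φ : AugState n → Fin L → ℝ) (μᵢ : AugState n → Fin m → ℝ) :
    Matrix (Fin E.N) (Fin m × GradIdx n L) ℝ :=
  Matrix.of fun k j =>
    E.discInt k fun t => kronVec (E.u t - μᵢ (E.X t)) (vecGrad Φ (E.X t)) j

/-- The data `ν̃`. -/
def nu : Matrix (Fin E.N) (Fin m × Fin m) ℝ :=
  Matrix.of fun k j => E.discInt k fun t => p.nuIntegrand (E.u t) j

/-- The data `ν̃_i` for the target policy `μᵢ`. -/
def nuTarget (μᵢ : AugState n → Fin m → ℝ) : Matrix (Fin E.N) (Fin m × Fin m) ℝ :=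
  Matrix.of fun k j => E.discInt k fun t => p.nuIntegrand (μᵢ (E.X t)) j

/-- The data `ω̃_i` for the target policy `μᵢ` and the previous estimate `Λ` of `Λ_uu`. -/
def omega (Λ : Matrix (Fin m) (Fin m) ℝ) (μᵢ : AugState n → Fin m → ℝ) : Fin E.N → ℝ :=
  fun k => E.discInt k fun t => p.barrier Λ (μᵢ (E.X t))

/-- Regressor `[-ψ̃, μ̃ - φ̃_i, ν̃]` of the off-policy algorithm. -/
def regressorOff (Φ : AugState n → Fin L → ℝ) (μᵢ : AugState n → Fin m → ℝ) :
    Matrix (Fin E.N) (ThetaIdx n m L) ℝ :=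
  Matrix.fromCols (-E.psi Φ) (Matrix.fromCols (E.mu Φ - E.phi Φ μᵢ) E.nu)

/-- Regressor `[-ψ̃, η̃, ν̃ - ν̃_i]` of the time-iterative algorithm. -/
def regressorTime (Φ : AugState n → Fin L → ℝ) (μᵢ : AugState n → Fin m → ℝ) :
    Matrix (Fin E.N) (ThetaIdx n m L) ℝ :=
  Matrix.fromCols (-E.psi Φ) (Matrix.fromCols (E.eta Φ μᵢ) (E.nu - E.nuTarget μᵢ))

end Experiment

/-- Full column rank. -/
def FullRank {N : ℕ} (Δ : Matrix (Fin N) (ThetaIdx n m L) ℝ) : Prop :=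
  Δ.rank = Fintype.card (ThetaIdx n m L)

/-- The least-squares formula `(Δᵀ Δ)⁻¹ Δᵀ Ξ`. -/
def leastSquares {N : ℕ} (Δ : Matrix (Fin N) (ThetaIdx n m L) ℝ) (Ξ : Fin N → ℝ) :
    ThetaIdx n m L → ℝ :=
  ((Δᵀ * Δ)⁻¹ * Δᵀ) *ᵥ Ξ

/-- The weights `W` in `Θ`. -/
def thetaW (Θ : ThetaIdx n m L → ℝ) : Fin L → ℝ := fun l => Θ (Sum.inl l)

/-- The matrix `Λ_xu` in `Θ`, stored as `vec Λ_xu`. -/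
def thetaXU (Θ : ThetaIdx n m L → ℝ) : Matrix (GradIdx n L) (Fin m) ℝ :=
  Matrix.of fun j a => Θ (Sum.inr (Sum.inl (a, j)))

/-- The matrix `Λ_uu` in `Θ`, stored as `vec Λ_uu`. -/
def thetaUU (Θ : ThetaIdx n m L → ℝ) : Matrix (Fin m) (Fin m) ℝ :=
  Matrix.of fun b a => Θ (Sum.inr (Sum.inr (a, b)))

/-- The gain update `½ Λ_uu⁻¹ Λ_xuᵀ`. -/
def nextGain (Θ : ThetaIdx n m L → ℝ) : Matrix (Fin m) (GradIdx n L) ℝ :=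
  (1 / 2 : ℝ) • ((thetaUU Θ)⁻¹ * (thetaXU Θ)ᵀ)

section Algorithms

variable (Φ : AugState n → Fin L → ℝ) (E : ℕ → p.Experiment)
  (K₀ : Matrix (Fin m) (GradIdx n L) ℝ) (Λ₀ : Matrix (Fin m) (Fin m) ℝ)

/-- `Θ` computed by one step of the off-policy algorithm from the experiment `D`, the gain `K` and
the previous estimate `Λ` of `Λ_uu`. -/
def offTheta (D : p.Experiment) (K : Matrix (Fin m) (GradIdx n L) ℝ)
    (Λ : Matrix (Fin m) (Fin m) ℝ) : ThetaIdx n m L → ℝ :=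
  leastSquares (D.regressorOff Φ (p.policy Φ K)) (D.xi + D.omega Λ (p.policy Φ K))

/-- The pair `(K_i, Λ_uu(i-1))` at iteration `i` of the off-policy algorithm, which uses the
experiment `E i` at iteration `i`; `Λ₀` is the initial value of `Λ_uu`. -/
def offState : ℕ → Matrix (Fin m) (GradIdx n L) ℝ × Matrix (Fin m) (Fin m) ℝ
  | 0 => (K₀, Λ₀)
  | i + 1 =>
    let Θ := p.offTheta Φ (E i) (offState i).1 (offState i).2
    (nextGain Θ, thetaUU Θ)

/-- Policy `u_i` of the off-policy algorithm. -/
def offPolicy (i : ℕ) : AugState n → Fin m → ℝ := p.policy Φ (p.offState Φ E K₀ Λ₀ i).1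

/-- The weight `Λ_uu(i-1)` used at iteration `i` of the off-policy algorithm. -/
def offWeight (i : ℕ) : Matrix (Fin m) (Fin m) ℝ := (p.offState Φ E K₀ Λ₀ i).2

/-- Weights `W_i` of the off-policy algorithm. -/
def offW (i : ℕ) : Fin L → ℝ :=
  thetaW (p.offTheta Φ (E i) (p.offState Φ E K₀ Λ₀ i).1 (p.offState Φ E K₀ Λ₀ i).2)

/-- `Θ` computed by one step of the time-iterative algorithm. -/
def timeTheta (D : p.Experiment) (K : Matrix (Fin m) (GradIdx n L) ℝ) : ThetaIdx n m L → ℝ :=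
  leastSquares (D.regressorTime Φ (p.policy Φ K)) D.xi

/-- Gain `K_i` of the time-iterative algorithm, which uses the experiment `E i` at iteration `i`. -/
def timeGain : ℕ → Matrix (Fin m) (GradIdx n L) ℝ
  | 0 => K₀
  | i + 1 => nextGain (p.timeTheta Φ (E i) (timeGain i))

/-- Policy `u_i` of the time-iterative algorithm. -/
def timePolicy (i : ℕ) : AugState n → Fin m → ℝ := p.policy Φ (p.timeGain Φ E K₀ i)

/-- Weights `W_i` of the time-iterative algorithm. -/
def timeW (i : ℕ) : Fin L → ℝ := thetaW (p.timeTheta Φ (E i) (p.timeGain Φ E K₀ i))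

end Algorithms

end TrackingProblem

end

/-! Each regression is solved exactly, so the algorithms are policy iteration in disguise. If `V =
Wᵀ Φ` is the value of the current policy `μ`, differentiating the dynamic programming identity gives
the Lyapunov equation `H(V, x, μ x) = 0`. Integrating its discounted form along recorded data, with
`G u` split as `G μ + G (u - μ)`, shows that the vector `exactTheta W`, built from `W`, from `W`
times the entries of `G`, and from `R`, satisfies `Δ θ = Ξ` without residual. Full column rank makes
it the only solution, so least squares returns `W` and `R`, and the gain update is the greedy policy
of `V`. These facts are `IsPolicyValue.hamiltonian_eq_zero`, `regressorOff_mulVec`,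
`regressorTime_mulVec` and `policy_nextGain_exactTheta`.

Policy iteration converges because the greedy input minimizes the Hamiltonian (convexity of the
barrier): `V_i` is a supersolution for the next policy, so the values decrease and stay nonnegative.
Full rank also makes `W ↦ Wᵀ Φ` injective, and in finite dimension pointwise convergence of the
values then forces convergence of the weights. The Lyapunov equations pass to the limit and become
the HJB equation.

The delicate point is optimality of the limit `V*` among all controls. The verification argument
needs `e^{-gam t} V*(X(t)) → 0` along every finite-cost trajectory, although `X` itself may grow. As
`0 ≤ V* ≤ V_i`, it is enough to bound the value of one admissible policy. The linear functionals
that are `o(e^{gam t / 2})` on all finite-cost trajectories form a subspace invariant under the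
adjoint drift and containing the rows of `√M`. Splitting the characteristic polynomial upgrades this
to growth at a rate strictly below `gam / 2`, with a constant that is itself `o(e^{gam t / 2})`
along trajectories (`exists_growth_bound`). Integrating the squares bounds the value by squares of
such constants (`IsPolicyValue.tendsto_discount`). -/

noncomputable section

/-! ### The primitive of `artanh`: integrability, closed form, convexity. -/

section Artanh

theorem Real.artanh_odd (x : ℝ) : Real.artanh (-x) = -Real.artanh x := by
  unfold Real.artanh
  have : (1 + -x) / (1 - -x) = ((1 + x) / (1 - x))⁻¹ := by
    rw [inv_div]; congr 1; ring
  rw [this, Real.sqrt_inv, Real.log_inv]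

theorem Real.hasDerivAt_artanh {x : ℝ} (hx : x ∈ Ioo (-1 : ℝ) 1) :
    HasDerivAt Real.artanh (1 / (1 - x ^ 2)) x := by
  have h1 : 0 < 1 + x := by linarith [hx.1]
  have h2 : 0 < 1 - x := by linarith [hx.2]
  have hev : Real.artanh =ᶠ[𝓝 x] fun y => 1 / 2 * (Real.log (1 + y) - Real.log (1 - y)) := by
    filter_upwards [isOpen_Ioo.mem_nhds hx] with y hy
    rw [Real.artanh_eq_half_log ⟨hy.1.le, hy.2.le⟩, Real.log_div] <;> [skip; skip]
    · linarith [hy.1]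
    · linarith [hy.2]
  refine HasDerivAt.congr_of_eventuallyEq ?_ hev
  have e1 := ((hasDerivAt_id x).const_add 1).log h1.ne'
  have e2 := ((hasDerivAt_id x).const_sub 1).log h2.ne'
  refine ((e1.sub e2).const_mul (1 / 2)).congr_deriv ?_
  have h3 : 1 - x ^ 2 ≠ 0 := by nlinarith [mul_pos h1 h2]
  simp only [id]
  field_simp
  ring

theorem Real.abs_artanh_mul_le {s v : ℝ} (hs0 : 0 ≤ s) (hs1 : s < 1) (hv : |v| ≤ 1) :
    |Real.artanh (s * v)| ≤ Real.artanh s := by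
  obtain ⟨hv1, hv2⟩ := abs_le.1 hv
  have h1 : s * v ≤ s := by nlinarith
  have h2 : -s ≤ s * v := by nlinarith
  rw [abs_le]
  constructor
  · rw [← Real.artanh_odd]
    exact Real.artanh_le_artanh (by linarith) (by linarith) h2
  · exact Real.artanh_le_artanh (by linarith) hs1 h1

/-- The singularity at `1` is only logarithmic. This keeps the barrier finite for inputs that touch
the bound. -/
theorem Real.intervalIntegrable_artanh : IntervalIntegrable Real.artanh volume 0 1 := by
  have h1 : IntervalIntegrable (fun s : ℝ => Real.log (1 + s)) volume 0 1 := by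
    have := (intervalIntegral.intervalIntegrable_log' (a := 1) (b := 2)).comp_add_left 1
    norm_num at this
    exact this
  have h2 : IntervalIntegrable (fun s : ℝ => Real.log (1 - s)) volume 0 1 := by
    have := (intervalIntegral.intervalIntegrable_log' (a := 1) (b := 0)).comp_sub_left 1
    norm_num at this
    exact this
  refine ((h1.sub h2).const_mul (1 / 2)).congr_ae ?_
  have : ∀ᵐ s : ℝ, s ≠ 1 := by simp [ae_iff, measure_singleton]
  rw [uIoc_of_le zero_le_one]
  filter_upwards [ae_restrict_of_ae this, ae_restrict_mem measurableSet_Ioc] with s hs1 hs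
  have : s < 1 := lt_of_le_of_ne hs.2 hs1
  rw [Real.artanh_eq_half_log ⟨by linarith [hs.1], hs.2⟩, Real.log_div (by linarith [hs.1])
    (by linarith)]

/-- The mean of `artanh` on the segment from `0` to `v`. -/
def artanhMean (v : ℝ) : ℝ := ∫ s in (0 : ℝ)..1, Real.artanh (s * v)

theorem ae_uIoc_unit_lt_one : ∀ᵐ s : ℝ, s ∈ uIoc (0 : ℝ) 1 → 0 ≤ s ∧ s < 1 := by
  have : ∀ᵐ s : ℝ, s ≠ 1 := by simp [ae_iff, measure_singleton]
  filter_upwards [this] with s hs h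
  rw [uIoc_of_le zero_le_one] at h
  exact ⟨h.1.le, lt_of_le_of_ne h.2 hs⟩

theorem Real.measurable_artanh : Measurable Real.artanh := by
  unfold Real.artanh
  fun_prop

theorem intervalIntegrable_artanh_mul {v : ℝ} (hv : |v| ≤ 1) :
    IntervalIntegrable (fun s => Real.artanh (s * v)) volume 0 1 := by
  refine Real.intervalIntegrable_artanh.mono_fun ?_ ?_
  · exact (Real.measurable_artanh.comp (by fun_prop)).aestronglyMeasurable
  · filter_upwards [(ae_restrict_iff' measurableSet_uIoc).2 ae_uIoc_unit_lt_one] with s hs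
    rw [Real.norm_eq_abs, Real.norm_eq_abs]
    exact (Real.abs_artanh_mul_le hs.1 hs.2 hv).trans (le_abs_self _)

/-- Dominated convergence: `artanh` itself dominates all the integrands. Closedness of the interval
matters, since competing controls may saturate. -/
theorem continuousOn_artanhMean : ContinuousOn artanhMean (Icc (-1) 1) := by
  intro v hv
  refine intervalIntegral.continuousWithinAt_of_dominated_interval (bound := Real.artanh)
    ?_ ?_ Real.intervalIntegrable_artanh ?_
  · exact Eventually.of_forall fun v =>
      (Real.measurable_artanh.comp (by fun_prop)).aestronglyMeasurable
  · filter_upwards [self_mem_nhdsWithin] with w hw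
    filter_upwards [ae_uIoc_unit_lt_one] with s hs h
    exact Real.abs_artanh_mul_le (hs h).1 (hs h).2 (abs_le.2 hw)
  · filter_upwards [ae_uIoc_unit_lt_one] with s hs h
    obtain ⟨h0, h1⟩ := hs h
    have : s * v ∈ Ioo (-1 : ℝ) 1 := ⟨by nlinarith [hv.1], by nlinarith [hv.2]⟩
    exact ((Real.hasDerivAt_artanh this).continuousAt.comp (x := v)
      (f := fun x => s * x) (by fun_prop)).continuousWithinAt

theorem mul_artanhMean_eq_integral (v : ℝ) :
    v * artanhMean v = ∫ s in (0 : ℝ)..v, Real.artanh s := by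
  simp [artanhMean]

theorem intervalIntegrable_artanh_zero {v : ℝ} (hv : |v| ≤ 1) :
    IntervalIntegrable Real.artanh volume 0 v := by
  rcases eq_or_ne v 0 with rfl | hne
  · simp
  have := (intervalIntegrable_artanh_mul hv)
  have h2 := this.comp_mul_right (c := v⁻¹)
  simpa [mul_assoc, hne] using h2

/-- This closed form of the primitive is what the diagonal of `nuIntegrand` encodes. The bound is
strict because the two terms on the right blow up separately at `±1`. -/
theorem mul_artanhMean_eq {v : ℝ} (hv : |v| < 1) :
    v * artanhMean v = v * Real.artanh v + 1 / 2 * Real.log (1 - v ^ 2) := by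
  obtain ⟨hv1, hv2⟩ := abs_lt.1 hv
  rw [mul_artanhMean_eq_integral]
  have hsub : uIcc 0 v ⊆ Ioo (-1 : ℝ) 1 := by
    intro x hx
    rw [mem_uIcc] at hx
    rcases hx with h | h <;> constructor <;> linarith [h.1, h.2]
  have key : ∀ x ∈ uIcc 0 v, HasDerivAt
      (fun x => x * Real.artanh x + 1 / 2 * Real.log (1 - x ^ 2)) (Real.artanh x) x := by
    intro x hx
    have hx' := hsub hx
    have h3 : 0 < 1 - x ^ 2 := by nlinarith [hx'.1, hx'.2]
    have e1 := (hasDerivAt_id x).mul (Real.hasDerivAt_artanh hx')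
    have e2 := ((((hasDerivAt_id x).pow 2).const_sub 1).log h3.ne').const_mul (1 / 2)
    refine (e1.add e2).congr_deriv ?_
    simp only [id, Pi.pow_apply]
    field_simp
    simp
    ring
  rw [intervalIntegral.integral_eq_sub_of_hasDerivAt key
    (intervalIntegrable_artanh_zero hv.le)]
  simp

/-- The primitive of an increasing function is convex and lies above its tangents. The point of
tangency must be interior, while `v` may be an endpoint. -/
theorem artanhMean_tangent_le {v w : ℝ} (hv : |v| ≤ 1) (hw : |w| < 1) :
    (v - w) * Real.artanh w ≤ v * artanhMean v - w * artanhMean w := by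
  obtain ⟨hw1, hw2⟩ := abs_lt.1 hw
  obtain ⟨hv1, hv2⟩ := abs_le.1 hv
  rw [mul_artanhMean_eq_integral, mul_artanhMean_eq_integral]
  have hiv := intervalIntegrable_artanh_zero hv
  have hiw := intervalIntegrable_artanh_zero hw.le
  rw [intervalIntegral.integral_interval_sub_left hiv hiw]
  have hwv : IntervalIntegrable Real.artanh volume w v := hiw.symm.trans hiv
  rcases le_total w v with h | h
  · have : ∫ _s in w..v, Real.artanh w ≤ ∫ s in w..v, Real.artanh s := by
      refine intervalIntegral.integral_mono_ae_restrict h (by simp) hwv ?_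
      -- At `s = 1` the function takes the default value `0`, which breaks monotonicity, so this
      -- null set is removed.
      have h1 : ∀ᵐ s : ℝ, s ≠ 1 := by simp [ae_iff, measure_singleton]
      filter_upwards [ae_restrict_of_ae h1, ae_restrict_mem measurableSet_Icc] with s hs1 hs
      exact Real.artanh_le_artanh hw1 (lt_of_le_of_ne (hs.2.trans hv2) hs1) hs.1
    simpa using this
  · have : ∫ s in v..w, Real.artanh s ≤ ∫ _s in v..w, Real.artanh w := by
      refine intervalIntegral.integral_mono_ae_restrict h hwv.symm (by simp) ?_
      have h1 : ∀ᵐ s : ℝ, s ≠ -1 := by simp [ae_iff, measure_singleton]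
      filter_upwards [ae_restrict_of_ae h1, ae_restrict_mem measurableSet_Icc] with s hs1 hs
      exact Real.artanh_le_artanh (lt_of_le_of_ne (hv1.trans hs.1) hs1.symm) hw2 hs.2
    rw [intervalIntegral.integral_symm]
    have h2 : ∫ _s in v..w, Real.artanh w = (w - v) * Real.artanh w := by simp
    linarith

theorem mul_artanhMean_nonneg {v : ℝ} (hv : |v| ≤ 1) : 0 ≤ v * artanhMean v := by
  simpa using artanhMean_tangent_le hv (w := 0) (by simp)

theorem Real.abs_tanh_lt_one' (x : ℝ) : |Real.tanh x| < 1 :=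
  abs_lt.2 ⟨Real.neg_one_lt_tanh x, Real.tanh_lt_one x⟩

theorem Real.contDiff_tanh' {k : WithTop ℕ∞} : ContDiff ℝ k Real.tanh := by
  have : Real.tanh = fun x => Real.sinh x / Real.cosh x := by
    ext x; exact Real.tanh_eq_sinh_div_cosh x
  rw [this]
  exact Real.contDiff_sinh.div Real.contDiff_cosh fun x => (Real.cosh_pos x).ne'

end Artanh

/-! ### The chain rule along Carathéodory trajectories. -/

section ChainRule

variable {E F : Type*} [NormedAddCommGroup E] [NormedSpace ℝ E]
  [NormedAddCommGroup F] [NormedSpace ℝ F]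

theorem integrableOn_Icc_of_bounded {E : Type*} [NormedAddCommGroup E] {v : ℝ → E}
    {a b C : ℝ} (hC : ∀ t ∈ Icc a b, ‖v t‖ ≤ C)
    (hv : AEStronglyMeasurable v (volume.restrict (Icc a b))) : IntegrableOn v (Icc a b) := by
  refine Integrable.of_bound hv C ?_
  filter_upwards [ae_restrict_mem measurableSet_Icc] with t ht using hC t ht

theorem lipschitzOnWith_of_integral_eq {X v : ℝ → E} {a b C : ℝ}
    (hX : ∀ t ∈ Icc a b, X t = X a + ∫ s in a..t, v s)
    (hC : ∀ t ∈ Icc a b, ‖v t‖ ≤ C) (hv : IntegrableOn v (Icc a b)) :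
    LipschitzOnWith C.toNNReal X (Icc a b) := by
  refine LipschitzOnWith.of_dist_le_mul fun t ht s hs => ?_
  have hab : a ≤ b := ht.1.trans ht.2
  have hint : ∀ t ∈ Icc a b, IntervalIntegrable v volume a t := fun t ht => by
    rw [intervalIntegrable_iff_integrableOn_Ioc_of_le ht.1]
    exact hv.mono_set (Ioc_subset_Icc_self.trans (Icc_subset_Icc_right ht.2))
  rw [dist_eq_norm, hX t ht, hX s hs, add_sub_add_left_eq_sub,
    intervalIntegral.integral_interval_sub_left (hint t ht) (hint s hs), Real.dist_eq]
  have hC0 : 0 ≤ C := (norm_nonneg _).trans (hC t ht)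
  rw [Real.coe_toNNReal _ hC0]
  refine intervalIntegral.norm_integral_le_of_norm_le_const fun r hr => hC r ?_
  rw [uIoc, mem_Ioc] at hr
  exact ⟨(le_min hs.1 ht.1).trans hr.1.le, hr.2.trans (max_le hs.2 ht.2)⟩

theorem ae_hasDerivAt_of_integral_eq [CompleteSpace E] {X v : ℝ → E} {a b : ℝ} (hab : a ≤ b)
    (hX : ∀ t ∈ Icc a b, X t = X a + ∫ s in a..t, v s) (hv : IntegrableOn v (Icc a b)) :
    ∀ᵐ t, t ∈ uIcc a b → HasDerivAt X (v t) t := by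
  have hi : IntervalIntegrable v volume a b := by
    rw [intervalIntegrable_iff_integrableOn_Ioc_of_le hab]
    exact hv.mono_set Ioc_subset_Icc_self
  have h1 : ∀ᵐ s : ℝ, s ≠ a := by simp [ae_iff, measure_singleton]
  have h2 : ∀ᵐ s : ℝ, s ≠ b := by simp [ae_iff, measure_singleton]
  filter_upwards [hi.ae_hasDerivAt_integral, h1, h2] with t ht hta htb hmem
  have := (ht hmem a left_mem_uIcc).const_add (X a)
  rw [uIcc_of_le hab] at hmem
  refine this.congr_of_eventuallyEq ?_
  filter_upwards [Icc_mem_nhds (lt_of_le_of_ne hmem.1 hta.symm) (lt_of_le_of_ne hmem.2 htb)]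
    with s hs using hX s hs

/-- The fundamental theorem of calculus for a Lipschitz function with a bounded derivative known
almost everywhere. -/
theorem LipschitzOnWith.integral_eq_sub_of_ae_hasDerivAt [CompleteSpace F] {g h : ℝ → F} {a b C : ℝ}
    {K : NNReal} (hab : a ≤ b) (hg : LipschitzOnWith K g (Icc a b))
    (hC : ∀ t ∈ Icc a b, ‖h t‖ ≤ C) (hh : IntegrableOn h (Icc a b))
    (hd : ∀ᵐ t, t ∈ uIcc a b → HasDerivAt g (h t) t) :
    ∫ t in a..b, h t = g b - g a := by
  -- Both `g` and the indefinite integral `k` are Lipschitz, hence absolutely continuous, with the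
  -- same derivative almost everywhere; their difference is constant.
  let k : ℝ → F := fun t => g a + ∫ s in a..t, h s
  have hk : ∀ t ∈ Icc a b, k t = k a + ∫ s in a..t, h s := fun t _ => by simp [k]
  have hkl := lipschitzOnWith_of_integral_eq hk hC hh
  have hkd := ae_hasDerivAt_of_integral_eq hab hk hh
  rw [← uIcc_of_le hab] at hg hkl
  obtain ⟨c, hc⟩ := (hg.absolutelyContinuousOnInterval.sub
    hkl.absolutelyContinuousOnInterval).const_of_ae_hasDerivAt_zero (by
      filter_upwards [hd, hkd] with t h1 h2 ht
      simpa using (h1 ht).sub (h2 ht))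
  have ha := hc a left_mem_uIcc
  have hb := hc b right_mem_uIcc
  simp only [Pi.sub_apply, k, intervalIntegral.integral_same, add_zero, sub_self] at ha hb
  rw [← ha] at hb
  rw [sub_eq_zero] at hb
  rw [hb]; simp

/-- The chain rule along a Carathéodory trajectory with bounded velocity. -/
theorem integral_fderiv_comp_trajectory [FiniteDimensional ℝ E] [CompleteSpace F]
    {X v : ℝ → E} {a b C : ℝ} (hab : a ≤ b)
    (hX : ∀ t ∈ Icc a b, X t = X a + ∫ s in a..t, v s)
    (hC : ∀ t ∈ Icc a b, ‖v t‖ ≤ C)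
    (hv : AEStronglyMeasurable v (volume.restrict (Icc a b)))
    {Ψ : ℝ × E → F} (hΨ : ContDiff ℝ 1 Ψ) :
    ∫ t in a..b, fderiv ℝ Ψ (t, X t) (1, v t) = Ψ (b, X b) - Ψ (a, X a) := by
  have : CompleteSpace E := FiniteDimensional.complete ℝ E
  have : ProperSpace E := FiniteDimensional.proper ℝ E
  have hvi : IntegrableOn v (Icc a b) := integrableOn_Icc_of_bounded hC hv
  have hXl := lipschitzOnWith_of_integral_eq hX hC hvi
  have hpair : LipschitzOnWith (max 1 C.toNNReal) (fun t => (t, X t)) (Icc a b) :=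
    LipschitzWith.id.lipschitzOnWith.prodMk hXl
  have hpc : ContinuousOn (fun t => (t, X t)) (Icc a b) := hpair.continuousOn
  -- The graph of the trajectory is compact, so it lies in a ball on which the `C¹` function `Ψ` is
  -- Lipschitz; the composition is then Lipschitz in time.
  obtain ⟨R, hR⟩ := (isCompact_Icc.image_of_continuousOn hpc).isBounded.subset_closedBall
    (0 : ℝ × E)
  obtain ⟨K, hK⟩ := (hΨ.contDiffOn (s := Metric.closedBall 0 R)).exists_lipschitzOnWith (by decide)
    (convex_closedBall _ _) (isCompact_closedBall _ _)
  have hmap : MapsTo (fun t => (t, X t)) (Icc a b) (Metric.closedBall 0 R) := fun t ht =>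
    hR (mem_image_of_mem _ ht)
  have hgl := hK.comp hpair hmap
  have hfc : ContinuousOn (fun t => fderiv ℝ Ψ (t, X t)) (Icc a b) :=
    (hΨ.continuous_fderiv (by decide)).comp_continuousOn hpc
  obtain ⟨D, hD⟩ := isCompact_Icc.exists_bound_of_continuousOn hfc
  have hbd : ∀ t ∈ Icc a b, ‖fderiv ℝ Ψ (t, X t) (1, v t)‖ ≤ D * (max 1 C) := fun t ht => by
    refine (ContinuousLinearMap.le_opNorm _ _).trans ?_
    have hD0 : 0 ≤ D := (norm_nonneg _).trans (hD t ht)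
    refine mul_le_mul (hD t ht) ?_ (norm_nonneg _) hD0
    rw [Prod.norm_mk]
    exact max_le_max (by simp) (hC t ht)
  have hmeas : AEStronglyMeasurable (fun t => fderiv ℝ Ψ (t, X t) (1, v t))
      (volume.restrict (Icc a b)) :=
    (ContinuousLinearMap.id ℝ (ℝ × E →L[ℝ] F)).aestronglyMeasurable_comp₂
      (hfc.aestronglyMeasurable measurableSet_Icc) (aestronglyMeasurable_const.prodMk hv)
  refine LipschitzOnWith.integral_eq_sub_of_ae_hasDerivAt (g := fun t => Ψ (t, X t)) hab hgl hbd
    (integrableOn_Icc_of_bounded hbd hmeas) ?_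
  filter_upwards [ae_hasDerivAt_of_integral_eq hab hX hvi] with t ht hmem
  exact (hΨ.differentiable (by decide) (t, X t)).hasFDerivAt.comp_hasDerivAt t
    ((hasDerivAt_id t).prodMk (ht hmem))

end ChainRule

end

/-! ### The barrier, the greedy input and the exact parameter vector. -/

noncomputable section

section Gradients

variable {n L : ℕ}

theorem fderiv_eq_stateGrad_dotProduct (V : AugState n → ℝ) (x v : AugState n) :
    fderiv ℝ V x v = stateGrad V x ⬝ᵥ v := by
  conv_lhs => rw [pi_eq_sum_univ' v]
  simp only [map_sum, map_smul, smul_eq_mul, dotProduct, stateGrad, mul_comm]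

theorem contDiff_dotProduct {k : WithTop ℕ∞} {Φ : AugState n → Fin L → ℝ} (hΦ : ContDiff ℝ k Φ)
    (W : Fin L → ℝ) : ContDiff ℝ k fun y => W ⬝ᵥ Φ y := by
  unfold dotProduct
  have := contDiff_pi.1 hΦ
  exact ContDiff.sum fun l _ => contDiff_const.mul (this l)

theorem stateGrad_dotProduct {Φ : AugState n → Fin L → ℝ} (hΦ : ContDiff ℝ 2 Φ)
    (W : Fin L → ℝ) (x : AugState n) (k : Fin n ⊕ Fin n) :
    stateGrad (fun y => W ⬝ᵥ Φ y) x k = ∑ l, W l * vecGrad Φ x (l, k) := by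
  have h := fun l => ((contDiff_pi.1 hΦ l).differentiable (by decide) x)
  unfold stateGrad dotProduct
  rw [fderiv_fun_sum fun l _ => (h l).const_mul (W l)]
  simp only [_root_.sum_apply]
  refine Finset.sum_congr rfl fun l _ => ?_
  rw [fderiv_const_mul (h l)]
  simp [vecGrad, jacobian, Matrix.vec, stateGrad]

theorem contDiff_vecGrad {Φ : AugState n → Fin L → ℝ} (hΦ : ContDiff ℝ 2 Φ) :
    ContDiff ℝ 1 (vecGrad Φ) := by
  refine contDiff_pi.2 fun ⟨l, k⟩ => ?_
  have h := (contDiff_pi.1 hΦ l)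
  have := h.fderiv_right (m := 1) (by norm_num)
  simpa [vecGrad, jacobian, Matrix.vec, stateGrad] using this.clm_apply contDiff_const

end Gradients

namespace TrackingProblem

variable {n m L : ℕ} (p : TrackingProblem n m)

theorem barrier_eq (hlam : 0 < p.lam) (Λ : Matrix (Fin m) (Fin m) ℝ) {u : Fin m → ℝ}
    (hu : ∀ a, |u a| ≤ p.lam) :
    p.barrier Λ u = 2 * ∑ a, p.lam * artanhMean (u a / p.lam) * (Λ *ᵥ u) a := by
  unfold barrier dotProduct
  have hu' : ∀ a, |u a / p.lam| ≤ 1 := fun a => by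
    rw [abs_div, abs_of_pos hlam]; exact (div_le_one hlam).2 (hu a)
  rw [intervalIntegral.integral_finsetSum]
  · congr 1
    refine Finset.sum_congr rfl fun a _ => ?_
    rw [intervalIntegral.integral_mul_const, intervalIntegral.integral_const_mul]
    simp only [artanhMean, mul_div_assoc]
  · intro a _
    have := ((intervalIntegrable_artanh_mul (hu' a)).const_mul p.lam).mul_const ((Λ *ᵥ u) a)
    simpa only [mul_div_assoc] using this

theorem continuousOn_barrier (hlam : 0 < p.lam) (Λ : Matrix (Fin m) (Fin m) ℝ) :
    ContinuousOn (p.barrier Λ) {u | ∀ a, |u a| ≤ p.lam} := by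
  have : ContinuousOn (fun u : Fin m → ℝ =>
      2 * ∑ a, p.lam * artanhMean (u a / p.lam) * (Λ *ᵥ u) a) {u | ∀ a, |u a| ≤ p.lam} := by
    refine continuousOn_const.mul (continuousOn_finsetSum _ fun a _ => ?_)
    refine ContinuousOn.mul (continuousOn_const.mul ?_) ?_
    · refine continuousOn_artanhMean.comp (by fun_prop) fun u hu => ?_
      rw [mem_Icc, ← abs_le, abs_div, abs_of_pos hlam]
      exact (div_le_one hlam).2 (hu a)
    · exact Continuous.continuousOn ((continuous_apply a).comp
        (continuous_const.matrix_mulVec continuous_id))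
  exact this.congr fun u hu => p.barrier_eq hlam Λ hu

theorem isCompact_inputSet : IsCompact {u : Fin m → ℝ | ∀ a, |u a| ≤ p.lam} := by
  have : {u : Fin m → ℝ | ∀ a, |u a| ≤ p.lam} = Set.pi univ fun _ => Icc (-p.lam) p.lam := by
    ext u; simp only [mem_ofPred_eq, abs_le, mem_univ_pi, mem_Icc]
  rw [this]
  exact isCompact_univ_pi fun _ => isCompact_Icc

/-- A continuous function on the compact input box is bounded. No sign or symmetry of `Λ` is needed,
which is what allows an arbitrary initial weight in the off-policy algorithm. -/
theorem exists_barrier_bound (hlam : 0 < p.lam) (Λ : Matrix (Fin m) (Fin m) ℝ) :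
    ∃ C, 0 ≤ C ∧ ∀ u : Fin m → ℝ, (∀ a, |u a| ≤ p.lam) → |p.barrier Λ u| ≤ C := by
  obtain ⟨C, hC⟩ := p.isCompact_inputSet.exists_bound_of_continuousOn
    (p.continuousOn_barrier hlam Λ)
  exact ⟨max C 0, le_max_right _ _, fun u hu => (hC u hu).trans (le_max_left _ _)⟩

theorem barrier_diag (hlam : 0 < p.lam) {R : Matrix (Fin m) (Fin m) ℝ} (hR : R.IsDiag)
    {u : Fin m → ℝ} (hu : ∀ a, |u a| ≤ p.lam) :
    p.barrier R u =
      ∑ a, 2 * p.lam ^ 2 * R a a * (u a / p.lam * artanhMean (u a / p.lam)) := by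
  rw [p.barrier_eq hlam R hu, Finset.mul_sum]
  refine Finset.sum_congr rfl fun a _ => ?_
  have : (R *ᵥ u) a = R a a * u a := by
    rw [mulVec, dotProduct, Finset.sum_eq_single a]
    · intro b _ hb; rw [hR (Ne.symm hb), zero_mul]
    · simp
  rw [this]
  field_simp

theorem barrier_nonneg (hlam : 0 < p.lam) {R : Matrix (Fin m) (Fin m) ℝ} (hRd : R.IsDiag)
    (hR : R.PosDef) {u : Fin m → ℝ} (hu : ∀ a, |u a| ≤ p.lam) : 0 ≤ p.barrier R u := by
  rw [p.barrier_diag hlam hRd hu]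
  refine Finset.sum_nonneg fun a _ => mul_nonneg ?_ (mul_artanhMean_nonneg ?_)
  · have : 0 < R a a := hR.diag_pos
    positivity
  · rw [abs_div, abs_of_pos hlam]; exact (div_le_one hlam).2 (hu a)

/-- Minimization of the Hamiltonian over the input. -/
theorem barrier_add_dotProduct_le (hlam : 0 < p.lam) {R : Matrix (Fin m) (Fin m) ℝ}
    (hRd : R.IsDiag) (hR : R.PosDef) {u w g : Fin m → ℝ} (hu : ∀ a, |u a| ≤ p.lam)
    (hw : ∀ a, w a = -p.lam * Real.tanh (1 / 2 * ((p.lam * R a a)⁻¹ * g a))) :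
    p.barrier R w + g ⬝ᵥ w ≤ p.barrier R u + g ⬝ᵥ u := by
  have hwl : ∀ a, |w a / p.lam| < 1 := fun a => by
    rw [hw, neg_mul, neg_div, abs_neg, mul_div_cancel_left₀ _ hlam.ne']
    exact Real.abs_tanh_lt_one' _
  have hw' : ∀ a, |w a| ≤ p.lam := fun a => by
    have := hwl a
    rw [abs_div, abs_of_pos hlam, div_lt_one hlam] at this
    exact this.le
  rw [p.barrier_diag hlam hRd hu, p.barrier_diag hlam hRd hw', dotProduct, dotProduct,
    ← Finset.sum_add_distrib, ← Finset.sum_add_distrib]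
  refine Finset.sum_le_sum fun a _ => ?_
  have hRa : 0 < R a a := hR.diag_pos
  have hua : |u a / p.lam| ≤ 1 := by
    rw [abs_div, abs_of_pos hlam]; exact (div_le_one hlam).2 (hu a)
  have key := artanhMean_tangent_le hua (hwl a)
  -- This is the first-order condition for minimizing the barrier plus a linear term, coordinate by
  -- coordinate; the tangent inequality at `w a / p.lam` makes it sufficient.
  have hart : Real.artanh (w a / p.lam) = -(1 / 2 * ((p.lam * R a a)⁻¹ * g a)) := by
    rw [hw, neg_mul, neg_div, mul_div_cancel_left₀ _ hlam.ne', Real.artanh_odd, Real.artanh_tanh]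
  rw [hart] at key
  have hpos : 0 < 2 * p.lam ^ 2 * R a a := by positivity
  have h2 := mul_le_mul_of_nonneg_left key hpos.le
  have h3 : 2 * p.lam ^ 2 * R a a * ((u a / p.lam - w a / p.lam) *
      -(1 / 2 * ((p.lam * R a a)⁻¹ * g a))) = g a * w a - g a * u a := by
    field_simp
    ring
  rw [h3, mul_sub] at h2
  linarith

/-- The closed form of the primitive of `artanh`, summed over coordinates. It makes the `ν̃` columns
paired with `vec R` measure the integrated barrier. -/
theorem sum_nuIntegrand_mul (hlam : 0 < p.lam) {R : Matrix (Fin m) (Fin m) ℝ} (hRd : R.IsDiag)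
    {u : Fin m → ℝ} (hu : ∀ a, |u a| < p.lam) :
    ∑ a, p.nuIntegrand u (a, a) * R a a = p.barrier R u := by
  rw [p.barrier_diag hlam hRd fun a => (hu a).le]
  refine Finset.sum_congr rfl fun a _ => ?_
  rw [mul_artanhMean_eq (by rw [abs_div, abs_of_pos hlam]; exact (div_lt_one hlam).2 (hu a))]
  simp only [nuIntegrand, kronVec, Pi.add_apply]
  field_simp

/-- Writing the cost as a sum of squares of linear outputs lets the growth of trajectories be
studied one linear functional at a time. -/
theorem stateCost_eq {sqrtM : Matrix (Fin n) (Fin n) ℝ} (hsqrt : sqrtM.PosSemidef)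
    (hsqrtM : sqrtM * sqrtM = p.M) (x : AugState n) :
    p.stateCost x = ∑ j, (∑ k, sqrtM j k * x (Sum.inl k)) ^ 2 := by
  have hT : sqrtMᵀ = sqrtM := by simpa using hsqrt.isHermitian.eq
  have h1 : p.stateCost x = (x ∘ Sum.inl) ⬝ᵥ (p.M *ᵥ (x ∘ Sum.inl)) := by
    simp [stateCost, fromBlocks_mulVec, dotProduct, Fintype.sum_sum_type]
  rw [h1, ← hsqrtM, ← mulVec_mulVec, dotProduct_mulVec, ← mulVec_transpose, hT, dotProduct]
  refine Finset.sum_congr rfl fun j _ => ?_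
  simp [mulVec, dotProduct, sq]

theorem stateCost_nonneg (hM : p.M.PosSemidef) (x : AugState n) : 0 ≤ p.stateCost x := by
  have h1 : p.stateCost x = (x ∘ Sum.inl) ⬝ᵥ (p.M *ᵥ (x ∘ Sum.inl)) := by
    simp [stateCost, fromBlocks_mulVec, dotProduct, Fintype.sum_sum_type]
  rw [h1]
  simpa using hM.dotProduct_mulVec_nonneg (x ∘ Sum.inl)

theorem continuous_stateCost : Continuous p.stateCost := by
  unfold stateCost
  exact continuous_id.dotProduct (continuous_const.matrix_mulVec continuous_id)

section Policy

variable {Φ : AugState n → Fin L → ℝ} (K : Matrix (Fin m) (GradIdx n L) ℝ)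

theorem abs_policy_lt (hlam : 0 < p.lam) (x : AugState n) (a : Fin m) :
    |p.policy Φ K x a| < p.lam := by
  rw [policy, neg_mul, abs_neg, abs_mul, abs_of_pos hlam]
  exact mul_lt_of_lt_one_right hlam (Real.abs_tanh_lt_one' _)

/-- Two derivatives of `Φ` make the feedback `C¹`, hence locally Lipschitz; uniqueness of
closed-loop trajectories rests on this. -/
theorem contDiff_policy (hΦ : ContDiff ℝ 2 Φ) : ContDiff ℝ 1 (p.policy Φ K) := by
  refine contDiff_pi.2 fun a => ?_
  unfold policy
  refine contDiff_const.mul (Real.contDiff_tanh'.comp (contDiff_const.mul ?_))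
  simp only [mulVec, dotProduct]
  exact ContDiff.sum fun j _ => contDiff_const.mul (contDiff_pi.1 (contDiff_vecGrad hΦ) j)

end Policy

/-- The parameter vector `(W, vec Λ_xu, vec R)` of the value function `Wᵀ Φ`. -/
def exactTheta (W : Fin L → ℝ) : ThetaIdx n m L → ℝ :=
  Sum.elim W (Sum.elim (fun q => W q.2.1 * p.G q.2.2 q.1) fun q => p.R q.2 q.1)

@[simp] theorem thetaW_exactTheta (W : Fin L → ℝ) : thetaW (p.exactTheta W) = W := rfl

@[simp] theorem thetaUU_exactTheta (W : Fin L → ℝ) : thetaUU (p.exactTheta W) = p.R := rfl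

theorem inv_mulVec_of_isDiag {R : Matrix (Fin m) (Fin m) ℝ} (hRd : R.IsDiag)
    (hR : ∀ a, R a a ≠ 0) (g : Fin m → ℝ) (a : Fin m) : (R⁻¹ *ᵥ g) a = (R a a)⁻¹ * g a := by
  have h1 : R * diagonal (fun a => (R a a)⁻¹) = 1 := by
    conv_lhs => rw [← hRd.diagonal_diag]
    rw [diagonal_mul_diagonal, ← diagonal_one]
    congr 1
    ext a
    simp [hR a]
  rw [inv_eq_right_inv h1, mulVec_diagonal]

theorem greedy_apply (hlam : 0 < p.lam) (hRd : p.R.IsDiag) (hR : p.R.PosDef)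
    (V : AugState n → ℝ) (x : AugState n) (a : Fin m) :
    p.greedy V x a =
      -p.lam * Real.tanh (1 / 2 * ((p.lam * p.R a a)⁻¹ * (p.Gᵀ *ᵥ stateGrad V x) a)) := by
  have hpos : ∀ a, p.R a a ≠ 0 := fun a => (hR.diag_pos (i := a)).ne'
  rw [greedy, inv_mulVec_of_isDiag (R := p.lam • p.R)]
  · simp
  · intro i j hij
    simp [hRd hij]
  · intro a
    simp [hlam.ne', hpos a]

theorem abs_greedy_lt (hlam : 0 < p.lam) (V : AugState n → ℝ) (x : AugState n) (a : Fin m) :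
    |p.greedy V x a| < p.lam := by
  rw [greedy, neg_mul, abs_neg, abs_mul, abs_of_pos hlam]
  exact mul_lt_of_lt_one_right hlam (Real.abs_tanh_lt_one' _)

/-- The `Λ_xu` block is arranged so that `Λ_xuᵀ vec(∇Φᵀ) = Gᵀ ∇V`; the factor `1 / lam` in the
policy then turns `½ R⁻¹` into `½ (lam R)⁻¹`. -/
theorem policy_nextGain_exactTheta (hlam : 0 < p.lam) (hRd : p.R.IsDiag) (hR : p.R.PosDef)
    {Φ : AugState n → Fin L → ℝ} (hΦ : ContDiff ℝ 2 Φ) (W : Fin L → ℝ) :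
    p.policy Φ (nextGain (p.exactTheta W)) = p.greedy fun y => W ⬝ᵥ Φ y := by
  ext x a
  have hpos : ∀ a, p.R a a ≠ 0 := fun a => (hR.diag_pos (i := a)).ne'
  rw [p.greedy_apply hlam hRd hR, policy, nextGain, smul_mulVec, ← mulVec_mulVec,
    thetaUU_exactTheta, Pi.smul_apply, inv_mulVec_of_isDiag hRd hpos]
  congr 2
  have : ((thetaXU (p.exactTheta W))ᵀ *ᵥ vecGrad Φ x) a =
      (p.Gᵀ *ᵥ stateGrad (fun y => W ⬝ᵥ Φ y) x) a := by
    simp only [mulVec, dotProduct, transpose_apply, thetaXU, exactTheta, Sum.elim_inr,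
      Sum.elim_inl, of_apply]
    rw [Fintype.sum_prod_type, Finset.sum_comm]
    refine Finset.sum_congr rfl fun k _ => ?_
    have hk := stateGrad_dotProduct hΦ W x k
    simp only [dotProduct] at hk
    rw [hk, Finset.mul_sum]
    exact Finset.sum_congr rfl fun l _ => by ring
  rw [this, smul_eq_mul, mul_inv]
  field_simp

/-- The input enters the Hamiltonian only through the barrier plus the linear form `Gᵀ ∇V`. -/
theorem hamiltonian_greedy_le (hlam : 0 < p.lam) (hRd : p.R.IsDiag) (hR : p.R.PosDef)
    (V : AugState n → ℝ) (x : AugState n) {u : Fin m → ℝ} (hu : ∀ a, |u a| ≤ p.lam) :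
    p.hamiltonian p.R V x (p.greedy V x) ≤ p.hamiltonian p.R V x u := by
  have := p.barrier_add_dotProduct_le hlam hRd hR hu (p.greedy_apply hlam hRd hR V x)
  simp only [hamiltonian, reward, dotProduct_add, dotProduct_mulVec _ p.G, ← mulVec_transpose]
  linarith

end TrackingProblem

end

/-! ### Existence and uniqueness of closed-loop trajectories. -/

noncomputable section

section Ode

variable {E : Type*} [NormedAddCommGroup E] [NormedSpace ℝ E]

/-- `X` is, for nonnegative times, the integral curve from `x₀` of the vector field `f`. -/
def IsForwardOrbit (f : E → E) (x₀ : E) (X : ℝ → E) : Prop :=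
  ContinuousOn X (Ici 0) ∧ ∀ t, 0 ≤ t → X t = x₀ + ∫ s in (0 : ℝ)..t, f (X s)

theorem IsForwardOrbit.zero {f : E → E} {x₀ : E} {X : ℝ → E} (h : IsForwardOrbit f x₀ X) :
    X 0 = x₀ := by
  simpa using h.2 0 le_rfl

theorem IsForwardOrbit.hasDerivWithinAt [CompleteSpace E] {f : E → E} {x₀ : E} {X : ℝ → E}
    (h : IsForwardOrbit f x₀ X) (hf : Continuous f) {t : ℝ} (ht : 0 ≤ t) :
    HasDerivWithinAt X (f (X t)) (Ici 0) t := by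
  -- Freezing `X` at negative times makes the integrand continuous on the whole line, so that the
  -- derivative is also available at `t = 0`.
  have hXc : Continuous fun s => X (max s 0) := by
    refine h.1.comp_continuous (by fun_prop) fun s => mem_Ici.2 (le_max_right _ _)
  have hw : Continuous fun s => f (X (max s 0)) := hf.comp hXc
  have hd := ((hw.integral_hasStrictDerivAt 0 t).hasDerivAt.const_add x₀).hasDerivWithinAt
    (s := Ici 0)
  rw [max_eq_left ht] at hd
  have heq : ∀ s ∈ Ici (0 : ℝ), X s = x₀ + ∫ r in (0 : ℝ)..s, f (X (max r 0)) := fun s hs => by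
    rw [h.2 s hs]
    congr 1
    refine intervalIntegral.integral_congr fun r hr => ?_
    rw [uIcc_of_le hs] at hr
    simp only [max_eq_left hr.1]
  exact hd.congr heq (heq t ht)

/-- Both curves stay in a common ball over the compact interval, and there `f` is Lipschitz; a
global Lipschitz constant is not needed. -/
theorem ContDiff.eqOn_Icc_of_hasDerivWithinAt [FiniteDimensional ℝ E] {f : E → E}
    (hf : ContDiff ℝ 1 f) {X Y : ℝ → E} {T : ℝ}
    (hX : ∀ t ∈ Icc 0 T, HasDerivWithinAt X (f (X t)) (Icc 0 T) t)
    (hY : ∀ t ∈ Icc 0 T, HasDerivWithinAt Y (f (Y t)) (Icc 0 T) t) (h0 : X 0 = Y 0) :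
    EqOn X Y (Icc 0 T) := by
  have : ProperSpace E := FiniteDimensional.proper ℝ E
  have hXc : ContinuousOn X (Icc 0 T) := fun t ht => (hX t ht).continuousWithinAt
  have hYc : ContinuousOn Y (Icc 0 T) := fun t ht => (hY t ht).continuousWithinAt
  obtain ⟨R, hR⟩ := ((isCompact_Icc.image_of_continuousOn hXc).isBounded.union
    (isCompact_Icc.image_of_continuousOn hYc).isBounded).subset_closedBall (0 : E)
  obtain ⟨K, hK⟩ := (hf.contDiffOn (s := Metric.closedBall 0 R)).exists_lipschitzOnWith (by decide)
    (convex_closedBall _ _) (isCompact_closedBall _ _)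
  refine ODE_solution_unique_of_mem_Icc_right (v := fun _ => f)
    (s := fun _ => Metric.closedBall 0 R) (K := K) (fun _ _ => hK) hXc ?_ ?_ hYc ?_ ?_ h0
  · exact fun t ht => (hX t (Ico_subset_Icc_self ht)).mono_of_mem_nhdsWithin
      (Icc_mem_nhdsGE_of_mem ht)
  · exact fun t ht => hR (Or.inl (mem_image_of_mem _ (Ico_subset_Icc_self ht)))
  · exact fun t ht => (hY t (Ico_subset_Icc_self ht)).mono_of_mem_nhdsWithin
      (Icc_mem_nhdsGE_of_mem ht)
  · exact fun t ht => hR (Or.inr (mem_image_of_mem _ (Ico_subset_Icc_self ht)))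

theorem IsForwardOrbit.eqOn [FiniteDimensional ℝ E] {f : E → E} (hf : ContDiff ℝ 1 f) {x₀ : E}
    {X Y : ℝ → E} (hX : IsForwardOrbit f x₀ X) (hY : IsForwardOrbit f x₀ Y) :
    EqOn X Y (Ici 0) := by
  have : CompleteSpace E := FiniteDimensional.complete ℝ E
  intro t ht
  refine hf.eqOn_Icc_of_hasDerivWithinAt (T := t) ?_ ?_ (hX.zero.trans hY.zero.symm) ⟨ht, le_rfl⟩
  · exact fun s hs => (hX.hasDerivWithinAt hf.continuous hs.1).mono Icc_subset_Ici_self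
  · exact fun s hs => (hY.hasDerivWithinAt hf.continuous hs.1).mono Icc_subset_Ici_self

theorem contDiff_exp_smul {𝔸 : Type*} [NormedRing 𝔸] [NormedAlgebra ℝ 𝔸] [CompleteSpace 𝔸]
    (x : 𝔸) {k : WithTop ℕ∞} : ContDiff ℝ k fun t : ℝ => NormedSpace.exp (t • x) := by
  have h : ContDiff ℝ k (NormedSpace.exp : 𝔸 → 𝔸) := by
    rw [contDiff_iff_contDiffAt]
    exact fun y => (NormedSpace.exp_analytic (𝕂 := ℝ) y).contDiffAt
  exact h.comp (contDiff_id.smul contDiff_const)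

/-- A bounded `C¹` perturbation of a linear vector field has solutions on every bounded interval. -/
theorem exists_hasDerivWithinAt_Icc [FiniteDimensional ℝ E] (A : E →L[ℝ] E) {b : E → E}
    (hb : ContDiff ℝ 1 b) {C : ℝ} (hC : ∀ x, ‖b x‖ ≤ C) (x₀ : E) {T : ℝ} (hT : 0 ≤ T) :
    ∃ X : ℝ → E, X 0 = x₀ ∧
      ∀ t ∈ Icc 0 T, HasDerivWithinAt X (A (X t) + b (X t)) (Icc 0 T) t := by
  have : ProperSpace E := FiniteDimensional.proper ℝ E
  have : CompleteSpace E := FiniteDimensional.complete ℝ E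
  let e : ℝ → E →L[ℝ] E := fun t => NormedSpace.exp (t • A)
  have he : ContDiff ℝ 1 e := contDiff_exp_smul A
  have hinv : ∀ t, e t * e (-t) = 1 := fun t => by
    let := NormedAlgebra.restrictScalars ℚ ℝ (E →L[ℝ] E)
    simp only [e]
    rw [← NormedSpace.exp_add_of_commute]
    · simp
    · exact ((Commute.refl A).smul_left t).smul_right (-t)
  -- In the variable `Y = e^{-tA} X` the linear part disappears and the velocity is at most `D * C`
  -- on `[0, T]`. Picard–Lindelöf on the ball of radius `D * C * T` therefore covers the whole
  -- interval at once.
  let g : ℝ × E → E := fun q => e (-q.1) (b (e q.1 q.2))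
  have hg : ContDiff ℝ 1 g := by
    refine (he.comp contDiff_fst.neg).clm_apply (hb.comp ?_)
    exact (he.comp contDiff_fst).clm_apply contDiff_snd
  have hC0 : 0 ≤ C := (norm_nonneg _).trans (hC x₀)
  obtain ⟨D, hD⟩ := (isCompact_Icc (a := (0 : ℝ)) (b := T)).exists_bound_of_continuousOn
    (f := fun t => e (-t)) (he.continuous.comp continuous_neg).continuousOn
  have hD0 : 0 ≤ D := (norm_nonneg _).trans (hD 0 ⟨le_rfl, hT⟩)
  let a : NNReal := ⟨D * C * T, by positivity⟩
  obtain ⟨K, hK⟩ := (hg.contDiffOn (s := Icc 0 T ×ˢ Metric.closedBall x₀ a)).exists_lipschitzOnWith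
    (by decide) ((convex_Icc _ _).prod (convex_closedBall _ _))
    (isCompact_Icc.prod (isCompact_closedBall _ _))
  have hPL : IsPicardLindelof (fun t y => g (t, y)) (⟨0, le_rfl, hT⟩ : Icc (0 : ℝ) T) x₀ a 0
      ⟨D * C, by positivity⟩ K := by
    refine ⟨fun t ht => ?_, fun x _ => ?_, fun t ht x _ => ?_, ?_⟩
    · refine LipschitzOnWith.of_dist_le_mul fun x hx y hy => ?_
      have := hK.dist_le_mul (t, x) ⟨ht, hx⟩ (t, y) ⟨ht, hy⟩
      simpa [Prod.dist_eq] using this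
    · exact (hg.continuous.comp (by fun_prop : Continuous fun t : ℝ => (t, x))).continuousOn
    · exact (ContinuousLinearMap.le_opNorm _ _).trans
        (mul_le_mul (hD t ht) (hC _) (norm_nonneg _) hD0)
    · simp only [sub_self, sub_zero, max_eq_left hT, NNReal.coe_zero]
      exact le_rfl
  obtain ⟨Y, hY0, hY⟩ := hPL.exists_eq_forall_mem_Icc_hasDerivWithinAt₀
  refine ⟨fun t => e t (Y t), ?_, fun t ht => ?_⟩
  · have : Y 0 = x₀ := hY0
    simp [e, this]
  · have h1 : HasDerivWithinAt e (A * e t) (Icc 0 T) t :=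
      (hasDerivAt_exp_smul_const' A t).hasDerivWithinAt
    have h2 := h1.clm_apply (hY t ht)
    convert h2 using 1
    have h3 : e t (g (t, Y t)) = b (e t (Y t)) := by
      change (e t * e (-t)) (b (e t (Y t))) = _
      rw [hinv]; rfl
    rw [h3]; rfl

theorem exists_isForwardOrbit [FiniteDimensional ℝ E] (A : E →L[ℝ] E) {b : E → E}
    (hb : ContDiff ℝ 1 b) {C : ℝ} (hC : ∀ x, ‖b x‖ ≤ C) (x₀ : E) :
    ∃ X, IsForwardOrbit (fun x => A x + b x) x₀ X := by
  have : CompleteSpace E := FiniteDimensional.complete ℝ E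
  have hf : ContDiff ℝ 1 fun x => A x + b x := A.contDiff.add hb
  choose Z hZ0 hZ using fun N : ℕ => exists_hasDerivWithinAt_Icc A hb hC x₀ (Nat.cast_nonneg N)
  have hagree : ∀ M N : ℕ, M ≤ N → EqOn (Z M) (Z N) (Icc 0 M) := fun M N hMN => by
    have hsub : Icc (0 : ℝ) M ⊆ Icc 0 N := Icc_subset_Icc_right (by exact_mod_cast hMN)
    exact hf.eqOn_Icc_of_hasDerivWithinAt (hZ M)
      (fun t ht => (hZ N t (hsub ht)).mono hsub) ((hZ0 M).trans (hZ0 N).symm)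
  have hX : ∀ N : ℕ, EqOn (fun t => Z (⌊t⌋₊ + 1) t) (Z N) (Icc 0 N) := fun N t ht => by
    have hlt : t ≤ ((⌊t⌋₊ + 1 : ℕ) : ℝ) := by exact_mod_cast (Nat.lt_floor_add_one t).le
    rcases le_total (⌊t⌋₊ + 1) N with h | h
    · exact hagree _ _ h ⟨ht.1, hlt⟩
    · exact (hagree _ _ h ht).symm
  have hZc : ∀ N, ContinuousOn (Z N) (Icc 0 N) := fun N t ht => (hZ N t ht).continuousWithinAt
  -- The solutions on `[0, N]` agree on overlaps by uniqueness, so at time `t` any integer `N ≥ t`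
  -- may be used; `⌊t⌋₊ + 1` is one.
  refine ⟨fun t => Z (⌊t⌋₊ + 1) t, fun t ht => ?_, fun t ht => ?_⟩
  · obtain ⟨N, hN⟩ := exists_nat_gt t
    have h1 : ContinuousWithinAt (fun t => Z (⌊t⌋₊ + 1) t) (Icc 0 N) t :=
      ((hZc N).congr (hX N)) t ⟨ht, hN.le⟩
    exact h1.mono_of_mem_nhdsWithin (mem_nhdsWithin.2
      ⟨Iio (N : ℝ), isOpen_Iio, hN, fun s hs => ⟨hs.2, le_of_lt hs.1⟩⟩)
  · obtain ⟨N, hN⟩ := exists_nat_gt t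
    have hsub : Icc (0 : ℝ) t ⊆ Icc 0 N := Icc_subset_Icc_right hN.le
    have hcont : ContinuousOn (fun s => A (Z N s) + b (Z N s)) (Icc 0 t) :=
      hf.continuous.comp_continuousOn ((hZc N).mono hsub)
    have h1 : ∫ s in (0 : ℝ)..t, (A (Z N s) + b (Z N s)) = Z N t - Z N 0 := by
      refine intervalIntegral.integral_eq_sub_of_hasDeriv_right_of_le ht ((hZc N).mono hsub)
        (fun s hs => ?_) ?_
      · exact (hZ N s ⟨hs.1.le, hs.2.le.trans hN.le⟩).mono_of_mem_nhdsWithin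
          (nhdsWithin_le_nhds (Icc_mem_nhds hs.1 (hs.2.trans hN)))
      · exact ContinuousOn.intervalIntegrable (by rwa [uIcc_of_le ht])
    have h2 : Z (⌊t⌋₊ + 1) t = Z N t := hX N ⟨ht, hN.le⟩
    have h3 : ∫ s in (0 : ℝ)..t, (A (Z (⌊s⌋₊ + 1) s) + b (Z (⌊s⌋₊ + 1) s)) =
        ∫ s in (0 : ℝ)..t, (A (Z N s) + b (Z N s)) := by
      refine intervalIntegral.integral_congr fun s hs => ?_
      rw [uIcc_of_le ht] at hs
      have : Z (⌊s⌋₊ + 1) s = Z N s := hX N (hsub hs)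
      simp only [this]
    simp only [h2, h3, h1, hZ0]
    abel

theorem IsForwardOrbit.shift [CompleteSpace E] {f : E → E} (hf : Continuous f) {x₀ : E}
    {X : ℝ → E} (h : IsForwardOrbit f x₀ X) {T : ℝ} (hT : 0 ≤ T) :
    IsForwardOrbit f (X T) fun t => X (T + t) := by
  have hi : ∀ t, 0 ≤ t → IntervalIntegrable (fun s => f (X s)) volume 0 t := fun t ht =>
    ContinuousOn.intervalIntegrable ((hf.comp_continuousOn h.1).mono (by
      rw [uIcc_of_le ht]; exact Icc_subset_Ici_self))
  refine ⟨h.1.comp (by fun_prop) fun t ht => mem_Ici.2 (add_nonneg hT ht), fun t ht => ?_⟩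
  beta_reduce
  rw [intervalIntegral.integral_comp_add_left (fun s => f (X s)) T, h.2 T hT,
    h.2 (T + t) (add_nonneg hT ht), add_zero, add_assoc,
    intervalIntegral.integral_add_adjacent_intervals (hi T hT)
      ((hi T hT).symm.trans (hi _ (add_nonneg hT ht)))]

end Ode

end

/-! ### Discounted costs, policy values and the Lyapunov equation. -/

noncomputable section

section Chain

variable {E F : Type*} [NormedAddCommGroup E] [NormedSpace ℝ E] [FiniteDimensional ℝ E]
  [NormedAddCommGroup F] [NormedSpace ℝ F] [CompleteSpace F]

/-- The product rule along a Carathéodory trajectory. -/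
theorem integral_deriv_clm_apply_trajectory {X v : ℝ → E} {a b C : ℝ} (hab : a ≤ b)
    (hX : ∀ t ∈ Icc a b, X t = X a + ∫ s in a..t, v s)
    (hC : ∀ t ∈ Icc a b, ‖v t‖ ≤ C)
    (hv : AEStronglyMeasurable v (volume.restrict (Icc a b)))
    {φ φ' : ℝ → E →L[ℝ] F} (hφ : ContDiff ℝ 1 φ) (hφ' : ∀ t, HasDerivAt φ (φ' t) t) :
    ∫ t in a..b, (φ' t (X t) + φ t (v t)) = φ b (X b) - φ a (X a) := by
  have hΨ : ContDiff ℝ 1 fun q : ℝ × E => φ q.1 q.2 :=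
    (hφ.comp contDiff_fst).clm_apply contDiff_snd
  rw [← integral_fderiv_comp_trajectory hab hX hC hv hΨ]
  refine intervalIntegral.integral_congr fun t _ => ?_
  have h1 : HasFDerivAt (fun q : ℝ × E => φ q.1) ((ContinuousLinearMap.toSpanSingleton ℝ (φ' t)).comp
      (ContinuousLinearMap.fst ℝ ℝ E)) (t, X t) :=
    HasFDerivAt.comp (t, X t) (hφ' t).hasFDerivAt hasFDerivAt_fst
  have h2 := h1.clm_apply (hasFDerivAt_snd (𝕜 := ℝ) (p := (t, X t)))
  rw [h2.fderiv]
  simp [add_comm]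

theorem integral_deriv_mul_comp_trajectory {X v : ℝ → E} {a b C : ℝ} (hab : a ≤ b)
    (hX : ∀ t ∈ Icc a b, X t = X a + ∫ s in a..t, v s)
    (hC : ∀ t ∈ Icc a b, ‖v t‖ ≤ C)
    (hv : AEStronglyMeasurable v (volume.restrict (Icc a b)))
    {φ φ' : ℝ → ℝ} (hφ : ContDiff ℝ 1 φ) (hφ' : ∀ t, HasDerivAt φ (φ' t) t)
    {V : E → ℝ} (hV : ContDiff ℝ 1 V) :
    ∫ t in a..b, (φ' t * V (X t) + φ t * fderiv ℝ V (X t) (v t)) =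
      φ b * V (X b) - φ a * V (X a) := by
  have hΨ : ContDiff ℝ 1 fun q : ℝ × E => φ q.1 * V q.2 :=
    (hφ.comp contDiff_fst).mul (hV.comp contDiff_snd)
  rw [← integral_fderiv_comp_trajectory hab hX hC hv hΨ]
  refine intervalIntegral.integral_congr fun t _ => ?_
  have h1 : HasFDerivAt (fun q : ℝ × E => φ q.1) ((ContinuousLinearMap.toSpanSingleton ℝ (φ' t)).comp
      (ContinuousLinearMap.fst ℝ ℝ E)) (t, X t) :=
    HasFDerivAt.comp (t, X t) (hφ' t).hasFDerivAt hasFDerivAt_fst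
  have h2 : HasFDerivAt (fun q : ℝ × E => V q.2) ((fderiv ℝ V (X t)).comp
      (ContinuousLinearMap.snd ℝ ℝ E)) (t, X t) :=
    HasFDerivAt.comp (t, X t) (hV.differentiable (by decide) (X t)).hasFDerivAt hasFDerivAt_snd
  have h3 := h1.fun_mul h2
  rw [h3.fderiv]
  simp
  ring

end Chain

theorem hasDerivAt_discount (g c t : ℝ) :
    HasDerivAt (fun t => Real.exp (-g * (t - c))) (-g * Real.exp (-g * (t - c))) t := by
  have := (((hasDerivAt_id t).sub_const c).const_mul (-g)).exp
  simpa [mul_comm] using this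

theorem contDiff_discount (g c : ℝ) : ContDiff ℝ 1 fun t : ℝ => Real.exp (-g * (t - c)) := by
  fun_prop

theorem integrableOn_exp_mul_of_bounded {g : ℝ} (hg : 0 < g) {b : ℝ → ℝ} {C : ℝ}
    (hb : AEMeasurable b (volume.restrict (Ioi 0))) (hC : ∀ t ∈ Ioi (0 : ℝ), |b t| ≤ C) :
    IntegrableOn (fun t => Real.exp (-g * t) * b t) (Ioi 0) := by
  have h1 := (integrableOn_exp_mul_Ioi (a := -g) (by linarith) 0).mul_const C
  refine Integrable.mono' h1 ?_ ?_
  · exact (Continuous.aestronglyMeasurable (by fun_prop)).mul hb.aestronglyMeasurable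
  · filter_upwards [ae_restrict_mem measurableSet_Ioi] with t ht
    rw [norm_mul, Real.norm_eq_abs, Real.norm_eq_abs, Real.abs_exp]
    exact mul_le_mul_of_nonneg_left (hC t ht) (Real.exp_pos _).le

theorem integral_exp_neg_mul_le {g : ℝ} (hg : 0 < g) {T : ℝ} (hT : 0 ≤ T) :
    ∫ t in (0 : ℝ)..T, Real.exp (-g * t) ≤ 1 / g := by
  have h := integral_exp_mul_Ioi (a := -g) (by linarith) 0
  have h2 := integrableOn_exp_mul_Ioi (a := -g) (by linarith) 0
  have : ∫ t in (0 : ℝ)..T, Real.exp (-g * t) ≤ ∫ t in Ioi (0 : ℝ), Real.exp (-g * t) := by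
    rw [intervalIntegral.integral_of_le hT]
    exact setIntegral_mono_set h2 (Eventually.of_forall fun t => (Real.exp_pos _).le)
      (Eventually.of_forall Ioc_subset_Ioi_self)
  rw [h] at this
  simpa using this

namespace TrackingProblem

variable {n m L : ℕ} (p : TrackingProblem n m)

/-- The velocity `F X + G u` along `(X, u)`. -/
def velocity (X : ℝ → AugState n) (u : ℝ → Fin m → ℝ) (t : ℝ) : AugState n :=
  p.F *ᵥ X t + p.G *ᵥ u t

variable {p}

theorem continuous_mulVec {ι κ : Type*} [Fintype κ] (A : Matrix ι κ ℝ) :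
    Continuous fun x : κ → ℝ => A *ᵥ x :=
  continuous_const.matrix_mulVec continuous_id

/-- On a compact interval `F X` is bounded by continuity and `G u` by the input constraint. This
puts any piece of a trajectory, with a new starting time, in the form required by the chain rule. -/
theorem IsSolution.restart {S : Set ℝ} {t₀ : ℝ} {X : ℝ → AugState n} {u : ℝ → Fin m → ℝ}
    (h : p.IsSolution S t₀ X u) (hu : ∀ t ∈ S, ∀ a, |u t a| ≤ p.lam) {a b : ℝ} (hta : t₀ ≤ a)
    (hab : a ≤ b) (hsub : Icc t₀ b ⊆ S) :
    ∃ C, (∀ t ∈ Icc a b, ‖p.velocity X u t‖ ≤ C) ∧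
      AEStronglyMeasurable (p.velocity X u) (volume.restrict (Icc a b)) ∧
      ∀ t ∈ Icc a b, X t = X a + ∫ s in a..t, p.velocity X u s := by
  have hcont : ContinuousOn (fun t => p.F *ᵥ X t) (Icc t₀ b) :=
    (continuous_mulVec p.F).comp_continuousOn (h.continuousOn.mono hsub)
  obtain ⟨C₁, hC₁⟩ := isCompact_Icc.exists_bound_of_continuousOn hcont
  obtain ⟨C₂, hC₂⟩ := p.isCompact_inputSet.exists_bound_of_continuousOn
    (continuous_mulVec p.G).continuousOn
  have hbd : ∀ t ∈ Icc t₀ b, ‖p.velocity X u t‖ ≤ C₁ + C₂ := fun t ht =>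
    (norm_add_le _ _).trans (add_le_add (hC₁ t ht) (hC₂ _ (hu t (hsub ht))))
  have hmeas : AEStronglyMeasurable (p.velocity X u) (volume.restrict (Icc t₀ b)) := by
    refine (hcont.aestronglyMeasurable measurableSet_Icc).add ?_
    exact (continuous_mulVec p.G).comp_aestronglyMeasurable
      (h.aemeasurable.mono_measure (Measure.restrict_mono hsub le_rfl)).aestronglyMeasurable
  have hint := integrableOn_Icc_of_bounded hbd hmeas
  have hii : ∀ t ∈ Icc t₀ b, IntervalIntegrable (p.velocity X u) volume t₀ t := fun t ht => by
    rw [intervalIntegrable_iff_integrableOn_Ioc_of_le ht.1]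
    exact hint.mono_set (Ioc_subset_Icc_self.trans (Icc_subset_Icc_right ht.2))
  have hsub' : Icc a b ⊆ Icc t₀ b := Icc_subset_Icc_left hta
  refine ⟨C₁ + C₂, fun t ht => hbd t (hsub' ht), hmeas.mono_measure
    (Measure.restrict_mono hsub' le_rfl), fun t ht => ?_⟩
  have ht' := hsub' ht
  have ha' : a ∈ Icc t₀ b := ⟨hta, hab⟩
  have e1 := h.eq t (hsub ht')
  have e2 := h.eq a (hsub ha')
  change X t = X t₀ + ∫ s in t₀..t, p.velocity X u s at e1
  change X a = X t₀ + ∫ s in t₀..a, p.velocity X u s at e2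
  rw [e1, e2, add_assoc,
    intervalIntegral.integral_add_adjacent_intervals (hii a ha') ((hii a ha').symm.trans (hii t ht'))]

/-- The discounted chain rule for a `C¹` function along a trajectory. -/
theorem IsSolution.integral_discount {S : Set ℝ} {t₀ : ℝ} {X : ℝ → AugState n}
    {u : ℝ → Fin m → ℝ} (h : p.IsSolution S t₀ X u) (hu : ∀ t ∈ S, ∀ a, |u t a| ≤ p.lam)
    {a b : ℝ} (hta : t₀ ≤ a) (hab : a ≤ b) (hsub : Icc t₀ b ⊆ S) {V : AugState n → ℝ}
    (hV : ContDiff ℝ 1 V) (c : ℝ) :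
    ∫ t in a..b, Real.exp (-p.gam * (t - c)) *
        (stateGrad V (X t) ⬝ᵥ p.velocity X u t - p.gam * V (X t)) =
      Real.exp (-p.gam * (b - c)) * V (X b) - Real.exp (-p.gam * (a - c)) * V (X a) := by
  obtain ⟨C, hC, hm, hX⟩ := h.restart hu hta hab hsub
  rw [← integral_deriv_mul_comp_trajectory hab hX hC hm (contDiff_discount p.gam c)
    (hasDerivAt_discount p.gam c) hV]
  refine intervalIntegral.integral_congr fun t _ => ?_
  simp only [fderiv_eq_stateGrad_dotProduct]
  ring

theorem IsSolution.intervalIntegrable_discount {S : Set ℝ} {t₀ : ℝ} {X : ℝ → AugState n}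
    {u : ℝ → Fin m → ℝ} (h : p.IsSolution S t₀ X u) (hu : ∀ t ∈ S, ∀ a, |u t a| ≤ p.lam)
    {a b : ℝ} (hta : t₀ ≤ a) (hab : a ≤ b) (hsub : Icc t₀ b ⊆ S) {V : AugState n → ℝ}
    (hV : ContDiff ℝ 1 V) (c : ℝ) :
    IntervalIntegrable (fun t => Real.exp (-p.gam * (t - c)) *
        (stateGrad V (X t) ⬝ᵥ p.velocity X u t - p.gam * V (X t))) volume a b := by
  obtain ⟨C, hC, hm, hX⟩ := h.restart hu hta hab hsub
  have hXc : ContinuousOn X (uIcc a b) := by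
    rw [uIcc_of_le hab]
    exact h.continuousOn.mono ((Icc_subset_Icc_left hta).trans hsub)
  have hvii : IntervalIntegrable (p.velocity X u) volume a b := by
    rw [intervalIntegrable_iff_integrableOn_Ioc_of_le hab]
    exact (integrableOn_Icc_of_bounded hC hm).mono_set Ioc_subset_Icc_self
  have hgc : ∀ k, ContinuousOn (fun t => stateGrad V (X t) k) (uIcc a b) := fun k =>
    ((hV.continuous_fderiv (by decide)).clm_apply continuous_const).comp_continuousOn hXc
  refine IntervalIntegrable.continuousOn_mul ?_ (by fun_prop)
  refine IntervalIntegrable.sub ?_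
    (continuousOn_const.mul (hV.continuous.comp_continuousOn hXc)).intervalIntegrable
  have : IntervalIntegrable (∑ k, fun t => stateGrad V (X t) k * p.velocity X u t k)
      volume a b := IntervalIntegrable.sum _ fun k _ => by
    refine IntervalIntegrable.continuousOn_mul ?_ (hgc k)
    rw [intervalIntegrable_iff] at hvii ⊢
    exact hvii.eval k
  exact this.congr fun t _ => by simp [dotProduct]

theorem IsControlled.abs_le {x₀ : AugState n} {X : ℝ → AugState n} {u : ℝ → Fin m → ℝ}
    (h : p.IsControlled x₀ X u) : ∀ t ∈ Ici (0 : ℝ), ∀ a, |u t a| ≤ p.lam := h.2.2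

theorem IsClosedLoop.isControlled {μ : AugState n → Fin m → ℝ} (hμ : ∀ x a, |μ x a| ≤ p.lam)
    {x₀ : AugState n} {X : ℝ → AugState n} (h : p.IsClosedLoop μ x₀ X) :
    p.IsControlled x₀ X fun t => μ (X t) := ⟨h.1, h.2, fun _ _ => hμ _⟩

/-- The barrier composed with a clamped input; it is continuous on the whole input space. -/
theorem continuous_barrier_clamp (hlam : 0 < p.lam) (Λ : Matrix (Fin m) (Fin m) ℝ) :
    Continuous fun u : Fin m → ℝ => p.barrier Λ fun a => max (-p.lam) (min (u a) p.lam) := by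
  refine (p.continuousOn_barrier hlam Λ).comp_continuous (by fun_prop) fun u a => ?_
  rw [_root_.abs_le]
  exact ⟨le_max_left _ _, max_le (by linarith) (min_le_right _ _)⟩

theorem clamp_eq_self {u : Fin m → ℝ} (hu : ∀ a, |u a| ≤ p.lam) :
    (fun a => max (-p.lam) (min (u a) p.lam)) = u := by
  ext a
  obtain ⟨h1, h2⟩ := _root_.abs_le.1 (hu a)
  rw [min_eq_left h2, max_eq_right h1]

/-- Continuity of the barrier is only available on the input box, so measurability goes through the
clamped barrier, which agrees with it along an admissible input. -/
theorem aemeasurable_barrier (hlam : 0 < p.lam) (Λ : Matrix (Fin m) (Fin m) ℝ) {S : Set ℝ}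
    (hS : MeasurableSet S) {u : ℝ → Fin m → ℝ} (hm : AEMeasurable u (volume.restrict S))
    (hu : ∀ t ∈ S, ∀ a, |u t a| ≤ p.lam) :
    AEMeasurable (fun t => p.barrier Λ (u t)) (volume.restrict S) := by
  refine ((continuous_barrier_clamp hlam Λ).measurable.comp_aemeasurable hm).congr ?_
  filter_upwards [ae_restrict_mem hS] with t ht
  simp only [Function.comp, clamp_eq_self (hu t ht)]

variable (p) in
/-- The discounted state cost of the trajectory `X` is finite. -/
def HasFiniteStateCost (X : ℝ → AugState n) : Prop :=
  IntegrableOn (fun t => Real.exp (-p.gam * t) * p.stateCost (X t)) (Ioi 0)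

theorem IsControlled.integrableOn_barrier (hlam : 0 < p.lam) (hgam : 0 < p.gam)
    (Λ : Matrix (Fin m) (Fin m) ℝ) {x₀ : AugState n} {X : ℝ → AugState n} {u : ℝ → Fin m → ℝ}
    (h : p.IsControlled x₀ X u) :
    IntegrableOn (fun t => Real.exp (-p.gam * t) * p.barrier Λ (u t)) (Ioi 0) := by
  obtain ⟨C, -, hC⟩ := p.exists_barrier_bound hlam Λ
  refine integrableOn_exp_mul_of_bounded hgam (C := C) ?_ fun t ht => hC _ (h.2.2 t (le_of_lt ht))
  exact aemeasurable_barrier hlam Λ measurableSet_Ioi (h.1.aemeasurable.mono_measure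
    (Measure.restrict_mono Ioi_subset_Ici_self le_rfl)) fun t ht => h.2.2 t (le_of_lt ht)

/-- The barrier is bounded, hence integrable after discounting. Finiteness of the cost is thus
independent of the input weight. -/
theorem IsControlled.integrableOn_reward_iff (hlam : 0 < p.lam) (hgam : 0 < p.gam)
    (Λ : Matrix (Fin m) (Fin m) ℝ) {x₀ : AugState n} {X : ℝ → AugState n} {u : ℝ → Fin m → ℝ}
    (h : p.IsControlled x₀ X u) :
    IntegrableOn (fun t => Real.exp (-p.gam * t) * p.reward Λ (X t) (u t)) (Ioi 0) ↔
      p.HasFiniteStateCost X := by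
  have hb := h.integrableOn_barrier hlam hgam Λ
  constructor
  · intro hr
    refine (hr.sub hb).congr (Eventually.of_forall fun t => ?_)
    simp only [Pi.sub_apply, reward]; ring
  · intro hr
    refine (hr.add hb).congr (Eventually.of_forall fun t => ?_)
    simp only [Pi.add_apply, reward]; ring

theorem isClosedLoop_iff {μ : AugState n → Fin m → ℝ} (hμ : Continuous μ) {x₀ : AugState n}
    {X : ℝ → AugState n} :
    p.IsClosedLoop μ x₀ X ↔ IsForwardOrbit (fun x => p.F *ᵥ x + p.G *ᵥ μ x) x₀ X := by
  constructor
  · rintro ⟨h, rfl⟩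
    exact ⟨h.continuousOn, fun t ht => h.eq t ht⟩
  · intro h
    refine ⟨⟨h.1, ?_, fun t ht => ?_⟩, h.zero⟩
    · exact (hμ.comp_continuousOn h.1).aemeasurable measurableSet_Ici
    · rw [h.zero]; exact h.2 t ht

theorem contDiff_closedLoop {μ : AugState n → Fin m → ℝ} (hμ : ContDiff ℝ 1 μ) :
    ContDiff ℝ 1 fun x => p.F *ᵥ x + p.G *ᵥ μ x :=
  (p.F.mulVecLin.toContinuousLinearMap.contDiff).add
    (p.G.mulVecLin.toContinuousLinearMap.contDiff.comp hμ)

theorem exists_isClosedLoop {μ : AugState n → Fin m → ℝ} (hμ : ContDiff ℝ 1 μ)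
    (hb : ∀ x a, |μ x a| ≤ p.lam) (x₀ : AugState n) : ∃ X, p.IsClosedLoop μ x₀ X := by
  obtain ⟨C, hC⟩ := p.isCompact_inputSet.exists_bound_of_continuousOn
    (continuous_mulVec p.G).continuousOn
  obtain ⟨X, hX⟩ := exists_isForwardOrbit p.F.mulVecLin.toContinuousLinearMap
    (p.G.mulVecLin.toContinuousLinearMap.contDiff.comp hμ) (C := C)
    (fun x => hC _ (hb x)) x₀
  exact ⟨X, (isClosedLoop_iff hμ.continuous).2 hX⟩

theorem IsClosedLoop.eqOn {μ : AugState n → Fin m → ℝ} (hμ : ContDiff ℝ 1 μ) {x₀ : AugState n}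
    {X Y : ℝ → AugState n} (hX : p.IsClosedLoop μ x₀ X) (hY : p.IsClosedLoop μ x₀ Y) :
    EqOn X Y (Ici 0) :=
  ((isClosedLoop_iff hμ.continuous).1 hX).eqOn (contDiff_closedLoop hμ)
    ((isClosedLoop_iff hμ.continuous).1 hY)

/-- By uniqueness of closed-loop trajectories, the cost along one chosen trajectory is the cost
along all of them. -/
theorem exists_isPolicyValue (hlam : 0 < p.lam) (hgam : 0 < p.gam) {μ : AugState n → Fin m → ℝ}
    (hμ : ContDiff ℝ 1 μ) (hb : ∀ x a, |μ x a| ≤ p.lam) (Λ : Matrix (Fin m) (Fin m) ℝ)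
    (hfin : ∀ x₀ X, p.IsClosedLoop μ x₀ X → p.HasFiniteStateCost X) :
    ∃ V, p.IsPolicyValue Λ μ V := by
  choose Z hZ using exists_isClosedLoop (p := p) hμ hb
  refine ⟨fun x₀ => ∫ t in Ioi (0 : ℝ), Real.exp (-p.gam * t) * p.reward Λ (Z x₀ t) (μ (Z x₀ t)),
    fun x₀ => ⟨⟨Z x₀, hZ x₀⟩, fun X hX => ⟨?_, ?_⟩⟩⟩
  · exact ((hX.isControlled hb).integrableOn_reward_iff hlam hgam Λ).2 (hfin x₀ X hX)
  · refine setIntegral_congr_fun measurableSet_Ioi fun t ht => ?_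
    simp only [hX.eqOn hμ (hZ x₀) (mem_Ici.2 (le_of_lt ht))]

theorem IsPolicyValue.hasFiniteStateCost (hlam : 0 < p.lam) (hgam : 0 < p.gam)
    {μ : AugState n → Fin m → ℝ} (hb : ∀ x a, |μ x a| ≤ p.lam) {Λ : Matrix (Fin m) (Fin m) ℝ}
    {V : AugState n → ℝ} (hV : p.IsPolicyValue Λ μ V) {x₀ : AugState n} {X : ℝ → AugState n}
    (hX : p.IsClosedLoop μ x₀ X) : p.HasFiniteStateCost X :=
  ((hX.isControlled hb).integrableOn_reward_iff hlam hgam Λ).1 ((hV x₀).2 X hX).1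

/-- Dynamic programming along a closed-loop trajectory. -/
theorem IsPolicyValue.discount_eq {μ : AugState n → Fin m → ℝ} (hμ : ContDiff ℝ 1 μ)
    {Λ : Matrix (Fin m) (Fin m) ℝ} {V : AugState n → ℝ} (hV : p.IsPolicyValue Λ μ V)
    {x₀ : AugState n} {X : ℝ → AugState n} (hX : p.IsClosedLoop μ x₀ X) {t : ℝ} (ht : 0 ≤ t) :
    Real.exp (-p.gam * t) * V (X t) =
      V x₀ - ∫ s in (0 : ℝ)..t, Real.exp (-p.gam * s) * p.reward Λ (X s) (μ (X s)) := by
  have hf := (contDiff_closedLoop (p := p) hμ).continuous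
  have hY : p.IsClosedLoop μ (X t) fun s => X (t + s) :=
    (isClosedLoop_iff hμ.continuous).2 (((isClosedLoop_iff hμ.continuous).1 hX).shift hf ht)
  obtain ⟨i1, e1⟩ := (hV x₀).2 X hX
  obtain ⟨i2, e2⟩ := (hV (X t)).2 _ hY
  set ρ : ℝ → ℝ := fun s => Real.exp (-p.gam * s) * p.reward Λ (X s) (μ (X s)) with hρ
  -- Both sides are limits of truncated integrals: the cost from `X t`, multiplied by `e^{-gam t}`,
  -- is the tail of the cost from `x₀`.
  have lim1 := intervalIntegral_tendsto_integral_Ioi 0 i1 tendsto_id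
  have lim2 := (intervalIntegral_tendsto_integral_Ioi 0 i2 tendsto_id).const_mul
    (Real.exp (-p.gam * t))
  rw [e2] at lim2
  rw [e1] at lim1
  have lim3 := (lim1.comp (tendsto_atTop_add_const_left atTop t tendsto_id)).sub_const
    (∫ s in (0 : ℝ)..t, ρ s)
  refine tendsto_nhds_unique lim2 (lim3.congr' ?_)
  filter_upwards [eventually_ge_atTop 0] with T hT
  have hii : ∀ r, 0 ≤ r → IntervalIntegrable ρ volume 0 r := fun r hr => by
    rw [intervalIntegrable_iff_integrableOn_Ioc_of_le hr]
    exact i1.mono_set Ioc_subset_Ioi_self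
  simp only [Function.comp, id]
  rw [← intervalIntegral.integral_const_mul, intervalIntegral.integral_interval_sub_left
    (hii _ (add_nonneg ht hT)) (hii t ht)]
  have := intervalIntegral.integral_comp_add_left (a := 0) (b := T) ρ t
  rw [add_zero] at this
  rw [← this]
  refine intervalIntegral.integral_congr fun s _ => ?_
  simp only [hρ, ← mul_assoc, ← Real.exp_add]
  ring_nf

theorem continuous_reward (hlam : 0 < p.lam) {μ : AugState n → Fin m → ℝ} (hμ : Continuous μ)
    (hb : ∀ x a, |μ x a| ≤ p.lam) (Λ : Matrix (Fin m) (Fin m) ℝ) :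
    Continuous fun x => p.reward Λ x (μ x) :=
  p.continuous_stateCost.add ((p.continuousOn_barrier hlam Λ).comp_continuous hμ hb)

/-- The value function of a policy solves the Lyapunov equation. -/
theorem IsPolicyValue.hamiltonian_eq_zero (hlam : 0 < p.lam) {μ : AugState n → Fin m → ℝ}
    (hμ : ContDiff ℝ 1 μ) (hb : ∀ x a, |μ x a| ≤ p.lam) {Λ : Matrix (Fin m) (Fin m) ℝ}
    {V : AugState n → ℝ} (hV : p.IsPolicyValue Λ μ V) (hVd : ContDiff ℝ 1 V) (x : AugState n) :
    p.hamiltonian Λ V x (μ x) = 0 := by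
  obtain ⟨X, hX⟩ := (hV x).1
  have hfo := (isClosedLoop_iff hμ.continuous).1 hX
  have hd := hfo.hasDerivWithinAt (contDiff_closedLoop (p := p) hμ).continuous le_rfl
  have hX0 : X 0 = x := hX.2
  have h1 : HasDerivWithinAt (fun t => V (X t))
      (fderiv ℝ V x (p.F *ᵥ x + p.G *ᵥ μ x)) (Ici 0) 0 := by
    have := ((hVd.differentiable (by decide) (X 0)).hasFDerivAt).comp_hasDerivWithinAt 0 hd
    rw [hX0] at this
    exact this
  have h2 := (hasDerivAt_discount p.gam 0 0).hasDerivWithinAt (s := Ici 0)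
  have h3 := h2.mul h1
  let ρ : ℝ → ℝ := fun s => Real.exp (-p.gam * s) * p.reward Λ (X (max s 0)) (μ (X (max s 0)))
  have hXc : Continuous fun s => X (max s 0) :=
    hfo.1.comp_continuous (by fun_prop) fun s => mem_Ici.2 (le_max_right _ _)
  have hρ : Continuous ρ := (by fun_prop : Continuous fun s : ℝ => Real.exp (-p.gam * s)).mul
    ((continuous_reward hlam hμ.continuous hb Λ).comp hXc)
  have h4 := ((hρ.integral_hasStrictDerivAt 0 0).hasDerivAt.const_sub (V x)).hasDerivWithinAt
    (s := Ici 0)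
  have heq : ∀ t ∈ Ici (0 : ℝ), Real.exp (-p.gam * (t - 0)) * V (X t) =
      V x - ∫ s in (0 : ℝ)..t, ρ s := fun t ht => by
    rw [sub_zero, hV.discount_eq hμ hX ht]
    congr 1
    refine intervalIntegral.integral_congr fun s hs => ?_
    rw [uIcc_of_le ht] at hs
    simp only [ρ, max_eq_left hs.1]
  -- The right derivative at `0` of `e^{-gam t} V(X(t))` is computed by the chain rule and by
  -- dynamic programming; equating the two gives the Lyapunov equation.
  have h5 := (uniqueDiffWithinAt_Ici (0 : ℝ)).eq_deriv _ h3
    (h4.congr heq (heq 0 (mem_Ici.2 le_rfl)))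
  simp only [ρ, hX0, sub_zero, mul_zero, Real.exp_zero, mul_one, one_mul, max_self] at h5
  rw [fderiv_eq_stateGrad_dotProduct] at h5
  rw [hamiltonian]
  linarith

/-- A trajectory along which the discounted decrease of `V` dominates a nonnegative running cost
has finite discounted running cost. -/
theorem IsControlled.integrableOn_of_decrease (hgam : 0 < p.gam) {x₀ : AugState n}
    {X : ℝ → AugState n} {u : ℝ → Fin m → ℝ} (h : p.IsControlled x₀ X u) {V : AugState n → ℝ}
    (hV : ContDiff ℝ 1 V) {B D : ℝ} (hB : 0 ≤ B) (hD : 0 ≤ D) (hVB : ∀ x, -B ≤ V x) {ρ : ℝ → ℝ}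
    (hρ : ∀ T, 0 ≤ T → IntervalIntegrable ρ volume 0 T) (hρ0 : ∀ t, 0 ≤ t → 0 ≤ ρ t)
    (hdec : ∀ t, 0 ≤ t → stateGrad V (X t) ⬝ᵥ p.velocity X u t - p.gam * V (X t) ≤ D - ρ t) :
    IntegrableOn (fun t => Real.exp (-p.gam * t) * ρ t) (Ioi 0) ∧
      ∫ t in Ioi (0 : ℝ), Real.exp (-p.gam * t) * ρ t ≤ V x₀ + B + D / p.gam := by
  have hρi : ∀ T, 0 ≤ T → IntervalIntegrable (fun t => Real.exp (-p.gam * t) * ρ t) volume 0 T :=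
    fun T hT => (hρ T hT).continuousOn_mul (by fun_prop)
  have key : ∀ T, 0 ≤ T → ∫ t in (0 : ℝ)..T, Real.exp (-p.gam * t) * ρ t ≤
      V x₀ + B + D / p.gam := fun T hT => by
    have e1 := h.1.integral_discount h.abs_le le_rfl hT Icc_subset_Ici_self hV 0
    have hle : ∫ t in (0 : ℝ)..T, Real.exp (-p.gam * (t - 0)) *
          (stateGrad V (X t) ⬝ᵥ p.velocity X u t - p.gam * V (X t)) ≤
        ∫ t in (0 : ℝ)..T, (D * Real.exp (-p.gam * t) - Real.exp (-p.gam * t) * ρ t) := by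
      refine intervalIntegral.integral_mono_on hT ?_ ?_ fun t ht => ?_
      · exact h.1.intervalIntegrable_discount h.abs_le le_rfl hT Icc_subset_Ici_self hV 0
      · exact ((by fun_prop : Continuous fun t : ℝ => D * Real.exp (-p.gam * t)).intervalIntegrable
          _ _).sub (hρi T hT)
      · rw [sub_zero]
        have := mul_le_mul_of_nonneg_left (hdec t ht.1) (Real.exp_pos (-p.gam * t)).le
        linarith
    rw [e1, intervalIntegral.integral_sub ((by fun_prop :
      Continuous fun t : ℝ => D * Real.exp (-p.gam * t)).intervalIntegrable _ _) (hρi T hT),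
      intervalIntegral.integral_const_mul] at hle
    -- The slack `D` contributes at most `D / gam` after discounting; the terminal term is at least
    -- `-B` because the discount factor is at most `1`.
    have h2 := mul_le_mul_of_nonneg_left (integral_exp_neg_mul_le hgam hT) hD
    have h3 : -B ≤ Real.exp (-p.gam * (T - 0)) * V (X T) := by
      have he : Real.exp (-p.gam * (T - 0)) ≤ 1 := Real.exp_le_one_iff.2 (by nlinarith)
      have := mul_le_mul_of_nonneg_left (hVB (X T)) (Real.exp_pos (-p.gam * (T - 0))).le
      nlinarith
    have h4 : X 0 = x₀ := h.2.1
    simp only [sub_zero, mul_zero, Real.exp_zero, one_mul, h4] at hle h3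
    rw [mul_one_div] at h2
    linarith
  have hint : IntegrableOn (fun t => Real.exp (-p.gam * t) * ρ t) (Ioi 0) := by
    refine integrableOn_Ioi_of_intervalIntegral_norm_bounded (V x₀ + B + D / p.gam) 0
      (b := id) (l := atTop) (fun T => ?_) tendsto_id ?_
    · rcases le_total 0 T with hT | hT
      · exact (intervalIntegrable_iff_integrableOn_Ioc_of_le hT).1 (hρi T hT)
      · simp [Ioc_eq_empty_of_le hT]
    · filter_upwards [eventually_ge_atTop 0] with T hT
      refine le_trans (le_of_eq ?_) (key T hT)
      refine intervalIntegral.integral_congr fun t ht => ?_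
      rw [id, uIcc_of_le hT] at ht
      exact Real.norm_of_nonneg (mul_nonneg (Real.exp_pos _).le (hρ0 t ht.1))
  refine ⟨hint, le_of_tendsto (intervalIntegral_tendsto_integral_Ioi 0 hint tendsto_id) ?_⟩
  filter_upwards [eventually_ge_atTop 0] with T hT using key T hT

end TrackingProblem

end

/-! ### Linear functionals that are `o(e^{gam t / 2})` on finite-cost trajectories. -/

noncomputable section

namespace TrackingProblem

variable {n m L : ℕ} (p : TrackingProblem n m)

/-- Pairing of a complex covector with a real state. -/
def pairing : ((Fin n ⊕ Fin n) → ℂ) →ₗ[ℂ] (AugState n →L[ℝ] ℂ) where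
  toFun q := ∑ k, q k • Complex.ofRealCLM.comp (ContinuousLinearMap.proj k)
  map_add' q r := ContinuousLinearMap.ext fun x => by
    simp only [_root_.add_apply, _root_.sum_apply, _root_.smul_apply, Pi.add_apply, smul_eq_mul,
      add_mul, Finset.sum_add_distrib]
  map_smul' c q := ContinuousLinearMap.ext fun x => by
    simp only [_root_.sum_apply, _root_.smul_apply, Pi.smul_apply, smul_eq_mul, mul_assoc,
      Finset.mul_sum, RingHom.id_apply]

theorem pairing_apply (q : (Fin n ⊕ Fin n) → ℂ) (x : AugState n) :
    pairing q x = ∑ k, q k * (x k : ℂ) := by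
  simp [pairing]

/-- `pairing` as a real continuous linear map. -/
def pairingCLM : ((Fin n ⊕ Fin n) → ℂ) →L[ℝ] (AugState n →L[ℝ] ℂ) :=
  (pairing.restrictScalars ℝ).toContinuousLinearMap

@[simp] theorem pairingCLM_apply (q : (Fin n ⊕ Fin n) → ℂ) :
    pairingCLM q = pairing q := rfl

/-- The adjoint drift on complex covectors. -/
def coDrift : ((Fin n ⊕ Fin n) → ℂ) →ₗ[ℂ] ((Fin n ⊕ Fin n) → ℂ) :=
  ((p.F.map (algebraMap ℝ ℂ))ᵀ).mulVecLin

/-- `coDrift` as a real continuous linear map. -/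
def coDriftCLM : ((Fin n ⊕ Fin n) → ℂ) →L[ℝ] ((Fin n ⊕ Fin n) → ℂ) :=
  (p.coDrift.restrictScalars ℝ).toContinuousLinearMap

@[simp] theorem coDriftCLM_apply (q : (Fin n ⊕ Fin n) → ℂ) : p.coDriftCLM q = p.coDrift q := rfl

theorem pairing_coDrift (q : (Fin n ⊕ Fin n) → ℂ) (x : AugState n) :
    pairing (p.coDrift q) x = pairing q (p.F *ᵥ x) := by
  simp only [pairing_apply, coDrift, mulVecLin_apply, mulVec, dotProduct, transpose_apply,
    map_apply, Complex.coe_algebraMap, Complex.ofReal_sum, Complex.ofReal_mul, Finset.sum_mul,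
    Finset.mul_sum]
  rw [Finset.sum_comm]
  exact Finset.sum_congr rfl fun j _ => Finset.sum_congr rfl fun k _ => by ring

/-- The flow of the adjoint drift. -/
def coFlow (s : ℝ) : ((Fin n ⊕ Fin n) → ℂ) →L[ℝ] ((Fin n ⊕ Fin n) → ℂ) :=
  NormedSpace.exp (s • p.coDriftCLM)

theorem contDiff_coFlow : ContDiff ℝ 1 p.coFlow :=
  contDiff_exp_smul (𝔸 := ((Fin n ⊕ Fin n) → ℂ) →L[ℝ] ((Fin n ⊕ Fin n) → ℂ)) p.coDriftCLM

theorem hasDerivAt_coFlow (s : ℝ) : HasDerivAt p.coFlow (p.coDriftCLM * p.coFlow s) s :=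
  hasDerivAt_exp_smul_const' (𝔸 := ((Fin n ⊕ Fin n) → ℂ) →L[ℝ] ((Fin n ⊕ Fin n) → ℂ))
    p.coDriftCLM s

@[simp] theorem coFlow_zero_apply (q : (Fin n ⊕ Fin n) → ℂ) : p.coFlow 0 q = q := by
  have : (0 : ℝ) • p.coDriftCLM = 0 := zero_smul ℝ p.coDriftCLM
  rw [coFlow, this, NormedSpace.exp_zero]; rfl

variable {p}

theorem exists_norm_pairing_input_le (q : (Fin n ⊕ Fin n) → ℂ) :
    ∃ C, 0 ≤ C ∧ ∀ u : Fin m → ℝ, (∀ a, |u a| ≤ p.lam) → ‖pairing q (p.G *ᵥ u)‖ ≤ C := by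
  obtain ⟨C, hC⟩ := p.isCompact_inputSet.exists_bound_of_continuousOn
    ((pairing q).continuous.comp (continuous_mulVec p.G)).continuousOn
  exact ⟨max C 0, le_max_right _ _, fun u hu => (hC u hu).trans (le_max_left _ _)⟩

/-- Up to a bounded error, the covector `q` at time `t + s` is the propagated covector at time
`t`. -/
theorem exists_norm_pairing_flow_sub_le (q : (Fin n ⊕ Fin n) → ℂ) (h : ℝ) :
    ∃ C, ∀ x₀ X u, p.IsControlled x₀ X u → ∀ t, 0 ≤ t → ∀ s ∈ Icc 0 h,
      ‖pairing q (X (t + s)) - pairing (p.coFlow s q) (X t)‖ ≤ C := by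
  have he := p.contDiff_coFlow
  obtain ⟨C₁, hC₁⟩ := (isCompact_Icc (a := (0 : ℝ)) (b := h)).exists_bound_of_continuousOn
    (f := fun s => pairingCLM (p.coFlow s q))
    (pairingCLM.continuous.comp (he.continuous.clm_apply continuous_const)).continuousOn
  obtain ⟨C₂, hC₂⟩ := p.isCompact_inputSet.exists_bound_of_continuousOn
    (continuous_mulVec p.G).continuousOn
  refine ⟨C₁ * C₂ * h, fun x₀ X u hX t ht s hs => ?_⟩
  have hts : t ≤ t + s := by linarith [hs.1]
  obtain ⟨C, hC, hm, hXe⟩ := hX.1.restart hX.abs_le ht hts Icc_subset_Ici_self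
  -- Transporting `q` backwards by the adjoint flow cancels the drift, so the derivative of this
  -- pairing along `X` involves only the bounded input.
  have hφ : ContDiff ℝ 1 fun r => pairingCLM (p.coFlow (t + s - r) q) :=
    pairingCLM.contDiff.comp ((he.comp (by fun_prop)).clm_apply contDiff_const)
  have hφ' : ∀ r, HasDerivAt (fun r => pairingCLM (p.coFlow (t + s - r) q))
      (-pairingCLM (p.coDriftCLM (p.coFlow (t + s - r) q))) r := fun r => by
    have h1 := (p.hasDerivAt_coFlow (t + s - r)).scomp r ((hasDerivAt_id r).const_sub (t + s))
    have h2 := h1.clm_apply (hasDerivAt_const r q)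
    have h3 := pairingCLM.hasFDerivAt.comp_hasDerivAt r h2
    refine h3.congr_deriv ?_
    simp
  have key := integral_deriv_clm_apply_trajectory hts hXe hC hm hφ hφ'
  have hfin : pairing q (X (t + s)) - pairing (p.coFlow s q) (X t) =
      ∫ r in t..t + s, pairing (p.coFlow (t + s - r) q) (p.G *ᵥ u r) := by
    have h1 : t + s - (t + s) = 0 := by ring
    have h2 : t + s - t = s := by ring
    simp only [h1, h2, coFlow_zero_apply, pairingCLM_apply] at key
    rw [← key]
    refine intervalIntegral.integral_congr fun r _ => ?_
    simp only [velocity, map_add, _root_.neg_apply, coDriftCLM_apply, pairing_coDrift]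
    ring
  rw [hfin]
  have hC₁0 : 0 ≤ C₁ := (norm_nonneg _).trans (hC₁ s hs)
  have hC₂0 : 0 ≤ C₂ := (norm_nonneg _).trans (hC₂ _ (hX.abs_le t ht))
  refine (intervalIntegral.norm_integral_le_of_norm_le_const (C := C₁ * C₂) fun r hr => ?_).trans ?_
  · rw [uIoc_of_le hts] at hr
    refine (ContinuousLinearMap.le_opNorm _ _).trans (mul_le_mul
      (hC₁ (t + s - r) ⟨by linarith [hr.2], by linarith [hr.1, hs.2]⟩)
      (hC₂ _ (hX.abs_le r (mem_Ici.2 (by linarith [hr.1])))) (norm_nonneg _) hC₁0)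
  · rw [add_sub_cancel_left, abs_of_nonneg hs.1]
    exact mul_le_mul_of_nonneg_left hs.2 (mul_nonneg hC₁0 hC₂0)

variable (p) in
/-- The covectors that are `o(e^{gam t / 2})` along every trajectory of finite state cost. -/
def subcritical : Submodule ℂ ((Fin n ⊕ Fin n) → ℂ) where
  carrier := {q | ∀ x₀ X u, p.IsControlled x₀ X u → p.HasFiniteStateCost X →
    Tendsto (fun t => Real.exp (-(p.gam / 2) * t) * ‖pairing q (X t)‖) atTop (𝓝 0)}
  zero_mem' := fun x₀ X u _ _ => by simp
  add_mem' := fun {q r} hq hr x₀ X u hX hf => by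
    refine squeeze_zero (fun t => by positivity) (fun t => ?_)
      (by simpa only [add_zero] using (hq x₀ X u hX hf).add (hr x₀ X u hX hf))
    rw [← mul_add, map_add]
    exact mul_le_mul_of_nonneg_left (norm_add_le (pairing q (X t)) (pairing r (X t)))
      (Real.exp_pos _).le
  smul_mem' := fun c q hq x₀ X u hX hf => by
    have := (hq x₀ X u hX hf).const_mul ‖c‖
    rw [mul_zero] at this
    refine this.congr fun t => ?_
    rw [map_smul, _root_.smul_apply, norm_smul]
    ring

theorem tendsto_exp_neg_mul_const {g : ℝ} (hg : 0 < g) (C : ℝ) :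
    Tendsto (fun t : ℝ => Real.exp (-g * t) * C) atTop (𝓝 0) := by
  have h : Tendsto (fun t : ℝ => Real.exp (-g * t)) atTop (𝓝 0) :=
    Real.tendsto_exp_atBot.comp (tendsto_id.const_mul_atTop_of_neg (by linarith))
  simpa using h.mul_const C

/-- A subspace of a finite-dimensional space is closed, and the difference quotients of `c` lie in
it. -/
theorem mem_subcritical_of_hasDerivWithinAt {c : ℝ → (Fin n ⊕ Fin n) → ℂ}
    {d : (Fin n ⊕ Fin n) → ℂ} (hc : ∀ s, 0 ≤ s → c s ∈ p.subcritical)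
    (hd : HasDerivWithinAt c d (Ici 0) 0) : d ∈ p.subcritical := by
  have hcl : IsClosed (p.subcritical : Set ((Fin n ⊕ Fin n) → ℂ)) :=
    p.subcritical.closed_of_finiteDimensional
  have hs := (hasDerivWithinAt_iff_tendsto_slope' (s := Ioi 0) (by simp)).1
    (hd.mono Ioi_subset_Ici_self)
  refine hcl.mem_of_tendsto hs ?_
  filter_upwards [self_mem_nhdsWithin] with s hs
  rw [slope_def_module]
  have := p.subcritical.sub_mem (hc s (le_of_lt hs)) (hc 0 le_rfl)
  rw [← Complex.coe_smul]
  exact p.subcritical.smul_mem _ this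

/-- Propagating `q` by the adjoint flow amounts to reading it `s` time units later, up to a bounded
error: the shift costs the factor `e^{gam s / 2}` and the discount kills the error. -/
theorem exp_smul_mem_subcritical (hgam : 0 < p.gam) {q : (Fin n ⊕ Fin n) → ℂ}
    (hq : q ∈ p.subcritical) {s : ℝ} (hs : 0 ≤ s) :
    p.coFlow s q ∈ p.subcritical := by
  intro x₀ X u hX hf
  obtain ⟨C, hC⟩ := exists_norm_pairing_flow_sub_le (p := p) q s
  have h1 := ((hq x₀ X u hX hf).comp (tendsto_atTop_add_const_right atTop s tendsto_id)).const_mul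
    (Real.exp (p.gam / 2 * s))
  have h2 := h1.add (tendsto_exp_neg_mul_const (half_pos hgam) C)
  rw [mul_zero, add_zero] at h2
  refine squeeze_zero' (Eventually.of_forall fun t => by positivity) ?_ h2
  filter_upwards [eventually_ge_atTop 0] with t ht
  have h3 := hC x₀ X u hX t ht s ⟨hs, le_rfl⟩
  have h4 : ‖pairing (p.coFlow s q) (X t)‖ ≤
      ‖pairing q (X (t + s))‖ + C := by
    rw [norm_sub_rev] at h3
    have := norm_le_norm_add_norm_sub' (pairing (p.coFlow s q) (X t))
      (pairing q (X (t + s)))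
    linarith
  have h5 : Real.exp (p.gam / 2 * s) * Real.exp (-(p.gam / 2) * (t + s)) =
      Real.exp (-(p.gam / 2) * t) := by
    rw [← Real.exp_add]; ring_nf
  simp only [Function.comp, id]
  rw [← mul_assoc, h5, ← mul_add]
  exact mul_le_mul_of_nonneg_left h4 (Real.exp_pos _).le

/-- The adjoint drift is the derivative at `0` of the adjoint flow, which preserves the subspace. -/
theorem coDrift_mem_subcritical (hgam : 0 < p.gam) {q : (Fin n ⊕ Fin n) → ℂ}
    (hq : q ∈ p.subcritical) : p.coDrift q ∈ p.subcritical := by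
  refine mem_subcritical_of_hasDerivWithinAt
    (c := fun s => p.coFlow s q)
    (fun s hs => exp_smul_mem_subcritical hgam hq hs) ?_
  have h1 := (p.hasDerivAt_coFlow 0).clm_apply (hasDerivAt_const (0 : ℝ) q)
  refine (h1.congr_deriv ?_).hasDerivWithinAt
  rw [map_zero, add_zero, mul_apply_eq_comp, coFlow_zero_apply, coDriftCLM_apply]

/-- A covector whose square is dominated by the state cost is subcritical. -/
theorem mem_subcritical_of_sq_le (hgam : 0 < p.gam) {q : (Fin n ⊕ Fin n) → ℂ}
    (hq : ∀ x, ‖pairing q x‖ ^ 2 ≤ p.stateCost x) : q ∈ p.subcritical := by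
  have hec : Continuous fun s : ℝ => p.coFlow s q :=
    p.contDiff_coFlow.continuous.clm_apply continuous_const
  -- Finite cost controls the output only in mean square, not pointwise in time. So the averages of
  -- the adjoint flow over `[0, h]` are shown to be subcritical, and `q` is recovered as their
  -- derivative at `h = 0`.
  refine mem_subcritical_of_hasDerivWithinAt
    (c := fun h => ∫ s in (0 : ℝ)..h, p.coFlow s q) (fun h hh => ?_) ?_
  swap
  · have := (hec.integral_hasStrictDerivAt 0 0).hasDerivAt.hasDerivWithinAt (s := Ici 0)
    rwa [coFlow_zero_apply] at this
  intro x₀ X u hX hf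
  obtain ⟨C, hC⟩ := exists_norm_pairing_flow_sub_le (p := p) q h
  set w : ℝ → ℝ := fun t => Real.exp (-p.gam * t) * p.stateCost (X t) with hw
  set I : ℝ → ℝ := fun t => ∫ r in t..t + h, w r with hI
  have hXc : ContinuousOn X (Ici 0) := hX.1.continuousOn
  have hwc : ContinuousOn w (Ici 0) :=
    (Continuous.continuousOn (by fun_prop)).mul (p.continuous_stateCost.comp_continuousOn hXc)
  have hwi : ∀ t, 0 ≤ t → IntervalIntegrable w volume 0 t := fun t ht =>
    ContinuousOn.intervalIntegrable (hwc.mono (by rw [uIcc_of_le ht]; exact Icc_subset_Ici_self))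
  have hIlim : Tendsto I atTop (𝓝 0) := by
    have l1 := intervalIntegral_tendsto_integral_Ioi 0 hf tendsto_id
    have l2 := (l1.comp (tendsto_atTop_add_const_right atTop h tendsto_id)).sub l1
    rw [sub_self] at l2
    refine l2.congr' ?_
    filter_upwards [eventually_ge_atTop 0] with t ht
    simp only [Function.comp, id]
    exact intervalIntegral.integral_interval_sub_left (hwi _ (add_nonneg ht hh)) (hwi t ht)
  -- Adding `e^{-t}` keeps the quantity positive, so that its square root can be a denominator
  -- below.
  have hJ : Tendsto (fun t => I t + Real.exp (-1 * t) * 1) atTop (𝓝 0) := by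
    simpa using hIlim.add (tendsto_exp_neg_mul_const one_pos 1)
  have hlim : Tendsto (fun t => Real.exp (p.gam / 2 * h) * ((h + 1) *
      √(I t + Real.exp (-1 * t) * 1)) + Real.exp (-(p.gam / 2) * t) * (C * h)) atTop (𝓝 0) := by
    have := (((Real.continuous_sqrt.tendsto 0).comp hJ).const_mul (h + 1)).const_mul
      (Real.exp (p.gam / 2 * h))
    have := this.add (tendsto_exp_neg_mul_const (half_pos hgam) (C * h))
    simpa using this
  refine squeeze_zero' (Eventually.of_forall fun t => by positivity) ?_ hlim
  filter_upwards [eventually_ge_atTop 0] with t ht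
  have hIt : 0 ≤ I t := intervalIntegral.integral_nonneg (by linarith) fun r _ =>
    mul_nonneg (Real.exp_pos _).le ((sq_nonneg _).trans (hq (X r)))
  set J := I t + Real.exp (-1 * t) * 1 with hJd
  have hJpos : 0 < J := by positivity
  have hsub : MapsTo (fun s => t + s) (uIcc 0 h) (Ici 0) := fun s hs => by
    rw [uIcc_of_le hh] at hs; exact mem_Ici.2 (add_nonneg ht hs.1)
  have hfc : ContinuousOn (fun s => ‖pairing q (X (t + s))‖) (uIcc 0 h) :=
    ((pairing q).continuous.comp_continuousOn
      (hXc.comp (by fun_prop : Continuous fun s => t + s).continuousOn hsub)).norm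
  have h1 : ‖pairing (∫ s in (0 : ℝ)..h, p.coFlow s q) (X t)‖ ≤
      (∫ s in (0 : ℝ)..h, ‖pairing q (X (t + s))‖) + C * h := by
    let ev : ((Fin n ⊕ Fin n) → ℂ) →L[ℝ] ℂ :=
      (ContinuousLinearMap.apply ℝ ℂ (X t)).comp pairingCLM
    have e1 : pairing (∫ s in (0 : ℝ)..h, p.coFlow s q) (X t) =
        ∫ s in (0 : ℝ)..h, pairing (p.coFlow s q) (X t) :=
      (ev.intervalIntegral_comp_comm (hec.intervalIntegrable 0 h)).symm
    have e2 : (∫ s in (0 : ℝ)..h, ‖pairing q (X (t + s))‖) + C * h =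
        ∫ s in (0 : ℝ)..h, (‖pairing q (X (t + s))‖ + C) := by
      rw [intervalIntegral.integral_add hfc.intervalIntegrable (by simp)]
      simp [mul_comm]
    rw [e1, e2]
    refine intervalIntegral.norm_integral_le_of_norm_le hh (Eventually.of_forall fun s hs => ?_)
      (hfc.intervalIntegrable.add (by simp))
    have h3 := hC x₀ X u hX t ht s ⟨hs.1.le, hs.2⟩
    rw [norm_sub_rev] at h3
    have := norm_le_norm_add_norm_sub' (pairing (p.coFlow s q) (X t))
      (pairing q (X (t + s)))
    linarith
  have h2 : Real.exp (-(p.gam / 2) * t) * ∫ s in (0 : ℝ)..h, ‖pairing q (X (t + s))‖ ≤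
      Real.exp (p.gam / 2 * h) * ((h + 1) * √J) := by
    -- A substitute for Cauchy–Schwarz: `y ≤ √J + y² / √J`. Integration over `[0, h]` gives `h √J +
    -- I / √J ≤ (h + 1) √J`.
    have hpt : ∀ s ∈ Icc 0 h, Real.exp (-(p.gam / 2) * t) * ‖pairing q (X (t + s))‖ ≤
        Real.exp (p.gam / 2 * h) * (√J + w (t + s) / √J) := fun s hs => by
      set y := Real.exp (-(p.gam / 2) * (t + s)) * ‖pairing q (X (t + s))‖ with hy
      have hy0 : 0 ≤ y := by positivity
      have hyw : y ^ 2 ≤ w (t + s) := by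
        rw [hy, mul_pow, ← Real.exp_nat_mul]
        have : ((2 : ℕ) : ℝ) * (-(p.gam / 2) * (t + s)) = -p.gam * (t + s) := by
          push_cast; ring
        rw [this]
        exact mul_le_mul_of_nonneg_left (hq _) (Real.exp_pos _).le
      have hJs : 0 < √J := Real.sqrt_pos.2 hJpos
      have hyJ : y ≤ √J + w (t + s) / √J := by
        rw [← sub_le_iff_le_add', le_div_iff₀ hJs]
        nlinarith [sq_nonneg (y - √J)]
      have hE : Real.exp (-(p.gam / 2) * t) ≤
          Real.exp (p.gam / 2 * h) * Real.exp (-(p.gam / 2) * (t + s)) := by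
        rw [← Real.exp_add]
        exact Real.exp_le_exp.2 (by nlinarith [hs.2])
      calc _ ≤ Real.exp (p.gam / 2 * h) * Real.exp (-(p.gam / 2) * (t + s)) *
            ‖pairing q (X (t + s))‖ := mul_le_mul_of_nonneg_right hE (norm_nonneg _)
        _ = Real.exp (p.gam / 2 * h) * y := by rw [hy]; ring
        _ ≤ _ := mul_le_mul_of_nonneg_left hyJ (Real.exp_pos _).le
    have hwI : IntervalIntegrable (fun s => w (t + s)) volume 0 h :=
      (hwc.comp (by fun_prop : Continuous fun s => t + s).continuousOn hsub).intervalIntegrable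
    have hmono := intervalIntegral.integral_mono_on hh
      (hfc.intervalIntegrable.const_mul (Real.exp (-(p.gam / 2) * t)))
      (((by simp : IntervalIntegrable (fun _ => √J) volume 0 h).add
        (hwI.div_const (√J))).const_mul (Real.exp (p.gam / 2 * h))) hpt
    rw [intervalIntegral.integral_const_mul, intervalIntegral.integral_const_mul,
      intervalIntegral.integral_add (by simp) (hwI.div_const _), intervalIntegral.integral_div,
      intervalIntegral.integral_comp_add_left w t, add_zero] at hmono
    refine hmono.trans (mul_le_mul_of_nonneg_left ?_ (Real.exp_pos _).le)
    have hJs : 0 < √J := Real.sqrt_pos.2 hJpos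
    have hIJ : (∫ r in t..t + h, w r) / √J ≤ √J := by
      rw [div_le_iff₀ hJs, Real.mul_self_sqrt hJpos.le]
      change I t ≤ J
      rw [hJd]
      have := Real.exp_pos (-1 * t)
      linarith
    simp only [intervalIntegral.integral_const, sub_zero, smul_eq_mul]
    linarith
  calc _ ≤ Real.exp (-(p.gam / 2) * t) *
        ((∫ s in (0 : ℝ)..h, ‖pairing q (X (t + s))‖) + C * h) :=
        mul_le_mul_of_nonneg_left h1 (Real.exp_pos _).le
    _ ≤ _ := by rw [mul_add]; linarith

end TrackingProblem

end

/-! ### Growth strictly below `gam / 2`, transversality and verification. -/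

noncomputable section

theorem integral_exp_const_mul {k : ℝ} (hk : k ≠ 0) (s t : ℝ) :
    ∫ r in s..t, Real.exp (k * r) = (Real.exp (k * t) - Real.exp (k * s)) / k := by
  have h : ∀ r ∈ uIcc s t, HasDerivAt (fun r => Real.exp (k * r) / k) (Real.exp (k * r)) r :=
    fun r _ => by
      have := (((hasDerivAt_id r).const_mul k).exp).div_const k
      refine this.congr_deriv ?_
      simp only [id]
      field_simp
  rw [intervalIntegral.integral_eq_sub_of_hasDerivAt h
    (Continuous.intervalIntegrable (by fun_prop) _ _)]
  ring

namespace TrackingProblem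

variable {n m L : ℕ} {p : TrackingProblem n m}

variable (p) in
/-- A nonnegative function on the state space that is `o(e^{gam t / 2})` along every trajectory of
finite state cost. -/
def IsSubcriticalBound (N : AugState n → ℝ) : Prop :=
  (∀ x, 0 ≤ N x) ∧ ∀ x₀ X u, p.IsControlled x₀ X u → p.HasFiniteStateCost X →
    Tendsto (fun t => Real.exp (-(p.gam / 2) * t) * N (X t)) atTop (𝓝 0)

theorem IsSubcriticalBound.add {N N' : AugState n → ℝ} (h : p.IsSubcriticalBound N)
    (h' : p.IsSubcriticalBound N') : p.IsSubcriticalBound fun x => N x + N' x :=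
  ⟨fun x => add_nonneg (h.1 x) (h'.1 x), fun x₀ X u hX hf => by
    simpa only [mul_add, add_zero] using (h.2 x₀ X u hX hf).add (h'.2 x₀ X u hX hf)⟩

theorem IsSubcriticalBound.const (hgam : 0 < p.gam) {C : ℝ} (hC : 0 ≤ C) :
    p.IsSubcriticalBound fun _ => C :=
  ⟨fun _ => hC, fun _ _ _ _ _ => tendsto_exp_neg_mul_const (half_pos hgam) C⟩

theorem IsSubcriticalBound.div_const {N : AugState n → ℝ} (h : p.IsSubcriticalBound N) {c : ℝ}
    (hc : 0 ≤ c) : p.IsSubcriticalBound fun x => N x / c :=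
  ⟨fun x => div_nonneg (h.1 x) hc, fun x₀ X u hX hf => by
    simpa only [mul_div_assoc, zero_div] using (h.2 x₀ X u hX hf).div_const c⟩

theorem isSubcriticalBound_norm_pairing {q : (Fin n ⊕ Fin n) → ℂ} (hq : q ∈ p.subcritical) :
    p.IsSubcriticalBound fun x => ‖pairing q x‖ :=
  ⟨fun _ => norm_nonneg _, hq⟩

/-- Variation of constants for one covector. -/
theorem norm_exp_mul_pairing_sub_le {q : (Fin n ⊕ Fin n) → ℂ} {μ : ℂ} {b D : ℝ}
    (hb : b ≠ μ.re) {x₀ : AugState n} {X : ℝ → AugState n} {u : ℝ → Fin m → ℝ}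
    (hX : p.IsControlled x₀ X u)
    (hD : ∀ t, 0 ≤ t → ‖pairing (p.coDrift q - μ • q) (X t) + pairing q (p.G *ᵥ u t)‖ ≤
      D * Real.exp (b * t)) {s t : ℝ} (hs : 0 ≤ s) (hst : s ≤ t) :
    ‖Complex.exp (-μ * t) * pairing q (X t) - Complex.exp (-μ * s) * pairing q (X s)‖ ≤
      D * ((Real.exp ((b - μ.re) * t) - Real.exp ((b - μ.re) * s)) / (b - μ.re)) := by
  obtain ⟨C, hC, hm, hXe⟩ := hX.1.restart hX.abs_le hs hst Icc_subset_Ici_self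
  have hexp : ∀ r : ℝ, HasDerivAt (fun r : ℝ => Complex.exp (-μ * r))
      (-μ * Complex.exp (-μ * r)) r := fun r => by
    have := ((hasDerivAt_id r).ofReal_comp.const_mul (-μ)).cexp
    simpa [mul_comm] using this
  have hexpc : ContDiff ℝ 1 fun r : ℝ => Complex.exp (-μ * r) :=
    Complex.contDiff_exp.comp (contDiff_const.mul Complex.ofRealCLM.contDiff)
  have hφ : ContDiff ℝ 1 fun r : ℝ => Complex.exp (-μ * r) • pairing (n := n) q :=
    hexpc.smul contDiff_const
  have hφ' : ∀ r : ℝ, HasDerivAt (fun r : ℝ => Complex.exp (-μ * r) • pairing (n := n) q)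
      ((-μ * Complex.exp (-μ * r)) • pairing (n := n) q) r := fun r =>
    (hexp r).smul_const (pairing (n := n) q)
  have key := integral_deriv_clm_apply_trajectory hst hXe hC hm hφ hφ'
  simp only [_root_.smul_apply, smul_eq_mul] at key
  rw [← key, ← integral_exp_const_mul (sub_ne_zero.2 hb), ← intervalIntegral.integral_const_mul]
  refine intervalIntegral.norm_integral_le_of_norm_le hst (Eventually.of_forall fun r hr => ?_)
    (Continuous.intervalIntegrable (by fun_prop) _ _)
  have hr0 : 0 ≤ r := hs.trans hr.1.le
  have e1 : -μ * Complex.exp (-μ * r) * pairing q (X r) +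
      Complex.exp (-μ * r) * pairing q (p.velocity X u r) = Complex.exp (-μ * r) *
        (pairing (p.coDrift q - μ • q) (X r) + pairing q (p.G *ᵥ u r)) := by
    simp only [velocity, map_add, map_sub, map_smul, _root_.sub_apply, _root_.smul_apply,
      pairing_coDrift, smul_eq_mul]
    ring
  rw [e1, norm_mul, Complex.norm_exp]
  have e2 : (-μ * (r : ℂ)).re = -μ.re * r := by simp
  have e3 : D * Real.exp ((b - μ.re) * r) = Real.exp (-μ.re * r) * (D * Real.exp (b * r)) := by
    rw [mul_left_comm, ← Real.exp_add]; ring_nf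
  rw [e2, e3]
  exact mul_le_mul_of_nonneg_left (hD r hr0) (Real.exp_pos _).le

/-- Along trajectories of finite state cost, a subcritical covector grows at a rate strictly below
`gam / 2`, with a constant that is a subcritical function of the initial state. -/
theorem exists_growth_bound_of_aeval_prod (hgam : 0 < p.gam) (s : Multiset ℂ) :
    ∀ q ∈ p.subcritical,
      Polynomial.aeval p.coDrift (s.map fun μ => Polynomial.X - Polynomial.C μ).prod q = 0 →
      ∃ N β, p.IsSubcriticalBound N ∧ 0 < β ∧ β < p.gam / 2 ∧
        ∀ x₀ X u, p.IsControlled x₀ X u → p.HasFiniteStateCost X → ∀ t, 0 ≤ t →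
          ‖pairing q (X t)‖ ≤ N x₀ * Real.exp (β * t) := by
  induction s using Multiset.induction_on with
  | empty =>
    intro q _ h0
    have hq : q = 0 := by simpa using h0
    refine ⟨fun _ => 0, p.gam / 4, IsSubcriticalBound.const hgam le_rfl, by linarith, by linarith,
      fun x₀ X u _ _ t _ => by simp [hq]⟩
  | cons μ s ih =>
    intro q hq h0
    -- One linear factor is removed: `q'` is annihilated by the remaining product, so its growth
    -- bound is known, and `q` solves a scalar equation with rate `μ` forced by `q'` and the input.
    set q' := p.coDrift q - μ • q with hq'
    have hq'mem : q' ∈ p.subcritical :=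
      p.subcritical.sub_mem (coDrift_mem_subcritical hgam hq) (p.subcritical.smul_mem μ hq)
    have h0' : Polynomial.aeval p.coDrift (s.map fun μ => Polynomial.X - Polynomial.C μ).prod q' =
        0 := by
      rw [Multiset.map_cons, Multiset.prod_cons, mul_comm, map_mul] at h0
      have : Polynomial.aeval p.coDrift (Polynomial.X - Polynomial.C μ) q = q' := by
        simp [hq', Module.algebraMap_end_apply]
      rw [← this]
      exact h0
    obtain ⟨N', β, hN', hβ0, hβ, hgrow⟩ := ih q' hq'mem h0'
    obtain ⟨C, hC0, hC⟩ := exists_norm_pairing_input_le (p := p) q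
    have hforce : ∀ x₀ X u, p.IsControlled x₀ X u → p.HasFiniteStateCost X → ∀ b, β ≤ b →
        ∀ t, 0 ≤ t → ‖pairing q' (X t) + pairing q (p.G *ᵥ u t)‖ ≤
          (N' x₀ + C) * Real.exp (b * t) := fun x₀ X u hX hf b hb t ht => by
      have hE : Real.exp (β * t) ≤ Real.exp (b * t) :=
        Real.exp_le_exp.2 (mul_le_mul_of_nonneg_right hb ht)
      have hE1 : 1 ≤ Real.exp (b * t) := Real.one_le_exp (mul_nonneg (hβ0.le.trans hb) ht)
      refine (norm_add_le _ _).trans ?_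
      rw [add_mul]
      refine add_le_add ((hgrow x₀ X u hX hf t ht).trans
        (mul_le_mul_of_nonneg_left hE (hN'.1 _))) ((hC _ (hX.abs_le t ht)).trans ?_)
      nlinarith
    have hnorm : ∀ (t : ℝ) (z : ℂ), ‖Complex.exp (-μ * t) * z‖ = Real.exp (-μ.re * t) * ‖z‖ :=
      fun t z => by
        rw [norm_mul, Complex.norm_exp]
        simp
    rcases lt_or_ge μ.re (p.gam / 2) with hlt | hge
    -- Slow mode: integrate forward from time `0`. Taking `b` strictly above both `β` and `μ.re`
    -- avoids resonance and still leaves `b < gam / 2`.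
    · obtain ⟨b, hb1, hb2⟩ := exists_between (max_lt hβ hlt)
      have hbβ : β ≤ b := (le_max_left _ _).trans hb1.le
      have hbμ : 0 < b - μ.re := sub_pos.2 ((le_max_right _ _).trans_lt hb1)
      refine ⟨fun x => ‖pairing q x‖ + (N' x + C) / (b - μ.re), b,
        (isSubcriticalBound_norm_pairing hq).add
          ((hN'.add (IsSubcriticalBound.const hgam hC0)).div_const hbμ.le),
        hβ0.trans_le hbβ, hb2, fun x₀ X u hX hf t ht => ?_⟩
      have hD := norm_exp_mul_pairing_sub_le (sub_ne_zero.1 hbμ.ne') hX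
        (hforce x₀ X u hX hf b hbβ) le_rfl ht
      have hX0 : X 0 = x₀ := hX.2.1
      simp only [Complex.ofReal_zero, mul_zero, Complex.exp_zero, one_mul, Real.exp_zero, hX0]
        at hD
      have h1 := norm_le_norm_add_norm_sub' (Complex.exp (-μ * t) * pairing q (X t))
        (pairing q x₀)
      rw [hnorm] at h1
      have hND : 0 ≤ N' x₀ + C := add_nonneg (hN'.1 _) hC0
      have h2 : (N' x₀ + C) * ((Real.exp ((b - μ.re) * t) - 1) / (b - μ.re)) ≤
          (N' x₀ + C) / (b - μ.re) * Real.exp ((b - μ.re) * t) := by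
        rw [div_mul_eq_mul_div, mul_div_assoc]
        exact mul_le_mul_of_nonneg_left (div_le_div_of_nonneg_right (by linarith) hbμ.le) hND
      have h3 : ‖pairing q x₀‖ ≤ ‖pairing q x₀‖ * Real.exp ((b - μ.re) * t) :=
        le_mul_of_one_le_right (norm_nonneg _) (Real.one_le_exp (mul_nonneg hbμ.le ht))
      have h4 : Real.exp (-μ.re * t) * ‖pairing q (X t)‖ ≤
          (‖pairing q x₀‖ + (N' x₀ + C) / (b - μ.re)) * Real.exp ((b - μ.re) * t) := by
        rw [add_mul]; linarith
      have h5 := mul_le_mul_of_nonneg_left h4 (Real.exp_pos (μ.re * t)).le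
      rw [← mul_assoc, ← Real.exp_add, mul_left_comm, ← Real.exp_add] at h5
      have e1 : μ.re * t + -μ.re * t = 0 := by ring
      have e2 : μ.re * t + (b - μ.re) * t = b * t := by ring
      rwa [e1, e2, Real.exp_zero, one_mul] at h5
    -- Fast mode: integrate backward from infinity. Subcriticality makes the boundary term at `T`
    -- vanish, so only the forcing remains and the rate `β` is kept.
    · have hμβ : 0 < μ.re - β := by linarith
      refine ⟨fun x => (N' x + C) / (μ.re - β), β,
        (hN'.add (IsSubcriticalBound.const hgam hC0)).div_const hμβ.le, hβ0, hβ,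
        fun x₀ X u hX hf t ht => ?_⟩
      have hND : 0 ≤ N' x₀ + C := add_nonneg (hN'.1 _) hC0
      have hne : β ≠ μ.re := by linarith
      have hbd : ∀ᶠ T in atTop, Real.exp (-μ.re * t) * ‖pairing q (X t)‖ ≤
          Real.exp (-(p.gam / 2) * T) * ‖pairing q (X T)‖ +
            (N' x₀ + C) / (μ.re - β) * Real.exp ((β - μ.re) * t) := by
        filter_upwards [eventually_ge_atTop t] with T hT
        have hT0 : 0 ≤ T := ht.trans hT
        have hD := norm_exp_mul_pairing_sub_le hne hX
          (hforce x₀ X u hX hf β le_rfl) ht hT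
        have h1 := norm_le_norm_add_norm_sub (Complex.exp (-μ * T) * pairing q (X T))
          (Complex.exp (-μ * t) * pairing q (X t))
        rw [hnorm, hnorm] at h1
        have h2 : (N' x₀ + C) * ((Real.exp ((β - μ.re) * T) - Real.exp ((β - μ.re) * t)) /
            (β - μ.re)) ≤ (N' x₀ + C) / (μ.re - β) * Real.exp ((β - μ.re) * t) := by
          rw [div_mul_eq_mul_div, mul_div_assoc, ← neg_div_neg_eq, neg_sub, neg_sub]
          refine mul_le_mul_of_nonneg_left (div_le_div_of_nonneg_right ?_ hμβ.le) hND
          linarith [Real.exp_pos ((β - μ.re) * T)]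
        have h3 : Real.exp (-μ.re * T) * ‖pairing q (X T)‖ ≤
            Real.exp (-(p.gam / 2) * T) * ‖pairing q (X T)‖ :=
          mul_le_mul_of_nonneg_right (Real.exp_le_exp.2 (by nlinarith)) (norm_nonneg _)
        linarith
      have hlim := ge_of_tendsto ((hq x₀ X u hX hf).add_const
        ((N' x₀ + C) / (μ.re - β) * Real.exp ((β - μ.re) * t))) hbd
      rw [zero_add] at hlim
      have h5 := mul_le_mul_of_nonneg_left hlim (Real.exp_pos (μ.re * t)).le
      rw [← mul_assoc, ← Real.exp_add, mul_left_comm, ← Real.exp_add] at h5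
      have e1 : μ.re * t + -μ.re * t = 0 := by ring
      have e2 : μ.re * t + (β - μ.re) * t = β * t := by ring
      rwa [e1, e2, Real.exp_zero, one_mul] at h5

/-- Cayley–Hamilton: the characteristic polynomial splits over `ℂ` and annihilates every covector.
-/
theorem exists_growth_bound (hgam : 0 < p.gam) {q : (Fin n ⊕ Fin n) → ℂ}
    (hq : q ∈ p.subcritical) :
    ∃ N β, p.IsSubcriticalBound N ∧ 0 < β ∧ β < p.gam / 2 ∧
      ∀ x₀ X u, p.IsControlled x₀ X u → p.HasFiniteStateCost X → ∀ t, 0 ≤ t →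
        ‖pairing q (X t)‖ ≤ N x₀ * Real.exp (β * t) := by
  refine exists_growth_bound_of_aeval_prod hgam p.coDrift.charpoly.roots q hq ?_
  rw [← (IsAlgClosed.splits p.coDrift.charpoly).eq_prod_roots_of_monic
    (LinearMap.charpoly_monic _), LinearMap.aeval_self_charpoly]
  rfl

/-- The rows of `sqrtM`, as complex covectors. -/
def outputRow (S : Matrix (Fin n) (Fin n) ℝ) (j : Fin n) : (Fin n ⊕ Fin n) → ℂ :=
  Sum.elim (fun k => (S j k : ℂ)) 0

theorem norm_pairing_outputRow_sq (S : Matrix (Fin n) (Fin n) ℝ) (j : Fin n) (x : AugState n) :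
    ‖pairing (outputRow S j) x‖ ^ 2 = (∑ k, S j k * x (Sum.inl k)) ^ 2 := by
  have : pairing (outputRow S j) x = ((∑ k, S j k * x (Sum.inl k) : ℝ) : ℂ) := by
    rw [pairing_apply, Fintype.sum_sum_type]
    simp [outputRow]
  rw [this, Complex.norm_real, Real.norm_eq_abs, sq_abs]

/-- The discounted value of an admissible policy vanishes at infinity along every trajectory of
finite state cost. -/
theorem IsPolicyValue.tendsto_discount (hlam : 0 < p.lam) (hgam : 0 < p.gam)
    {S : Matrix (Fin n) (Fin n) ℝ} (hS : S.PosSemidef) (hSM : S * S = p.M)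
    {μ : AugState n → Fin m → ℝ} (hb : ∀ x a, |μ x a| ≤ p.lam) {Λ : Matrix (Fin m) (Fin m) ℝ}
    {V : AugState n → ℝ} (hV : p.IsPolicyValue Λ μ V) {x₀ : AugState n} {X : ℝ → AugState n}
    {u : ℝ → Fin m → ℝ} (hX : p.IsControlled x₀ X u) (hf : p.HasFiniteStateCost X) :
    Tendsto (fun t => Real.exp (-p.gam * t) * V (X t)) atTop (𝓝 0) := by
  have hrow : ∀ j, outputRow S j ∈ p.subcritical := fun j => by
    refine mem_subcritical_of_sq_le hgam fun x => ?_
    rw [norm_pairing_outputRow_sq, p.stateCost_eq hS hSM]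
    exact Finset.single_le_sum (f := fun j => (∑ k, S j k * x (Sum.inl k)) ^ 2)
      (fun j _ => sq_nonneg _) (Finset.mem_univ j)
  choose N β hN hβ0 hβ hgrow using fun j => exists_growth_bound hgam (hrow j)
  obtain ⟨C, hC0, hC⟩ := p.exists_barrier_bound hlam Λ
  -- Apply the growth bounds to the closed loop started at `x`: each output contributes `∫ e^{-gam
  -- t} (N_j e^{β_j t})² = N_j² / (gam - 2 β_j)`, finite exactly because `β_j < gam / 2`, and the
  -- bounded barrier contributes `C / gam`.
  have hbound : ∀ x, |V x| ≤ (∑ j, N j x ^ 2 / (p.gam - 2 * β j)) + C / p.gam := fun x => by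
    obtain ⟨Y, hY⟩ := (hV x).1
    have hYc := hY.isControlled hb
    have hYf := hV.hasFiniteStateCost hlam hgam hb hY
    obtain ⟨hi, he⟩ := (hV x).2 Y hY
    have hk : ∀ j, -(p.gam - 2 * β j) < 0 := fun j => by have := hβ j; linarith
    have hint : ∀ j ∈ Finset.univ, Integrable (fun t => N j x ^ 2 *
        Real.exp (-(p.gam - 2 * β j) * t)) (volume.restrict (Ioi 0)) := fun j _ =>
      (integrableOn_exp_mul_Ioi (hk j) 0).const_mul _
    have hint2 : IntegrableOn (fun t => C * Real.exp (-p.gam * t)) (Ioi 0) :=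
      (integrableOn_exp_mul_Ioi (a := -p.gam) (by linarith) 0).const_mul _
    have hle : ‖∫ t in Ioi (0 : ℝ), Real.exp (-p.gam * t) * p.reward Λ (Y t) (μ (Y t))‖ ≤
        ∫ t in Ioi (0 : ℝ), ((∑ j, N j x ^ 2 * Real.exp (-(p.gam - 2 * β j) * t)) +
          C * Real.exp (-p.gam * t)) := by
      refine norm_integral_le_of_norm_le ((integrable_finsetSum _ hint).add hint2) ?_
      filter_upwards [ae_restrict_mem measurableSet_Ioi] with t ht
      have ht0 : 0 ≤ t := le_of_lt ht
      have h1 : |p.reward Λ (Y t) (μ (Y t))| ≤ (∑ j, (N j x * Real.exp (β j * t)) ^ 2) + C := by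
        refine (abs_add_le _ _).trans (add_le_add ?_ (hC _ (hb _)))
        rw [p.stateCost_eq hS hSM, abs_of_nonneg (Finset.sum_nonneg fun j _ => sq_nonneg _)]
        refine Finset.sum_le_sum fun j _ => ?_
        rw [← norm_pairing_outputRow_sq]
        exact pow_le_pow_left₀ (norm_nonneg _) (hgrow j x Y _ hYc hYf t ht0) 2
      rw [norm_mul, Real.norm_eq_abs, Real.abs_exp, Real.norm_eq_abs]
      refine (mul_le_mul_of_nonneg_left h1 (Real.exp_pos _).le).trans (le_of_eq ?_)
      rw [mul_add, Finset.mul_sum, mul_comm C]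
      congr 1
      refine Finset.sum_congr rfl fun j _ => ?_
      rw [mul_pow, ← Real.exp_nat_mul, mul_left_comm, ← Real.exp_add]
      congr 2
      push_cast; ring
    rw [he, integral_add (integrable_finsetSum _ hint) hint2, integral_finsetSum _ hint] at hle
    refine hle.trans (le_of_eq ?_)
    congr 1
    · refine Finset.sum_congr rfl fun j _ => ?_
      rw [integral_const_mul, integral_exp_mul_Ioi (hk j), mul_zero, Real.exp_zero, neg_div_neg_eq,
        mul_one_div]
    · rw [integral_const_mul, integral_exp_mul_Ioi (by linarith), mul_zero, Real.exp_zero,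
        neg_div_neg_eq, mul_one_div]
  -- The bound is now read at `x = X t` on the competing trajectory, where `e^{-gam t} N_j²` is the
  -- square of a quantity tending to `0`.
  have hlim : Tendsto (fun t => (∑ j, (Real.exp (-(p.gam / 2) * t) * N j (X t)) ^ 2 /
      (p.gam - 2 * β j)) + Real.exp (-p.gam * t) * (C / p.gam)) atTop (𝓝 0) := by
    have h1 := tendsto_finsetSum Finset.univ fun j _ =>
      (((hN j).2 x₀ X u hX hf).pow 2).div_const (p.gam - 2 * β j)
    have h2 := h1.add (tendsto_exp_neg_mul_const hgam (C / p.gam))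
    simpa using h2
  refine squeeze_zero_norm (fun t => ?_) hlim
  rw [norm_mul, Real.norm_eq_abs, Real.abs_exp, Real.norm_eq_abs]
  refine (mul_le_mul_of_nonneg_left (hbound (X t)) (Real.exp_pos _).le).trans (le_of_eq ?_)
  rw [mul_add, Finset.mul_sum]
  congr 1
  refine Finset.sum_congr rfl fun j _ => ?_
  rw [mul_pow, ← Real.exp_nat_mul, mul_div_assoc]
  congr 2
  push_cast; ring

/-- Verification: a function with nonnegative Hamiltonian that vanishes at infinity is a lower
bound for the cost. -/
theorem IsControlled.le_cost {Λ : Matrix (Fin m) (Fin m) ℝ} {x₀ : AugState n}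
    {X : ℝ → AugState n} {u : ℝ → Fin m → ℝ} (h : p.IsControlled x₀ X u) {V : AugState n → ℝ}
    (hV : ContDiff ℝ 1 V) (hH : ∀ t, 0 ≤ t → 0 ≤ p.hamiltonian Λ V (X t) (u t))
    (hlim : Tendsto (fun t => Real.exp (-p.gam * t) * V (X t)) atTop (𝓝 0)) {c : ℝ}
    (hc : p.HasCost Λ X u c) : V x₀ ≤ c := by
  obtain ⟨hi, rfl⟩ := hc
  have l1 := (intervalIntegral_tendsto_integral_Ioi 0 hi tendsto_id).add hlim
  rw [add_zero] at l1
  refine ge_of_tendsto l1 ?_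
  filter_upwards [eventually_ge_atTop 0] with T hT
  have e1 := h.1.integral_discount h.abs_le le_rfl hT Icc_subset_Ici_self hV 0
  have i1 := h.1.intervalIntegrable_discount h.abs_le le_rfl hT Icc_subset_Ici_self hV 0
  have i2 : IntervalIntegrable (fun t => Real.exp (-p.gam * t) * p.reward Λ (X t) (u t))
      volume 0 T := by
    rw [intervalIntegrable_iff_integrableOn_Ioc_of_le hT]
    exact hi.mono_set Ioc_subset_Ioi_self
  have hnn : 0 ≤ ∫ t in (0 : ℝ)..T, (Real.exp (-p.gam * (t - 0)) *
      (stateGrad V (X t) ⬝ᵥ p.velocity X u t - p.gam * V (X t)) +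
        Real.exp (-p.gam * t) * p.reward Λ (X t) (u t)) := by
    refine intervalIntegral.integral_nonneg hT fun t ht => ?_
    rw [sub_zero, ← mul_add]
    refine mul_nonneg (Real.exp_pos _).le ?_
    have := hH t ht.1
    rw [hamiltonian] at this
    simp only [velocity]
    linarith
  rw [intervalIntegral.integral_add i1 i2, e1] at hnn
  have h4 : X 0 = x₀ := h.2.1
  simp only [sub_zero, mul_zero, Real.exp_zero, one_mul, h4] at hnn
  simp only [id]
  linarith

end TrackingProblem

end

/-! ### The identities satisfied by the recorded data. -/

noncomputable section

namespace TrackingProblem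

variable {n m L : ℕ} {p : TrackingProblem n m}

/-- Full column rank makes the normal matrix `Δᵀ Δ` invertible, so a consistent system returns its
exact solution. -/
theorem leastSquares_eq {N : ℕ} {Δ : Matrix (Fin N) (ThetaIdx n m L) ℝ} (hΔ : FullRank Δ)
    {Ξ : Fin N → ℝ} {θ : ThetaIdx n m L → ℝ} (h : Δ *ᵥ θ = Ξ) : leastSquares Δ Ξ = θ := by
  have hr : (Δᵀ * Δ).rank = Fintype.card (ThetaIdx n m L) := by
    rw [rank_transpose_mul_self]; exact hΔ
  have hu : IsUnit (Δᵀ * Δ) := by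
    rw [← mulVec_surjective_iff_isUnit]
    have : LinearMap.range (Δᵀ * Δ).mulVecLin = ⊤ :=
      Submodule.eq_top_of_finrank_eq (by
        rw [← Matrix.rank, hr, Module.finrank_fintype_fun_eq_card])
    exact LinearMap.range_eq_top.1 this
  rw [leastSquares, ← h, mulVec_mulVec, Matrix.mul_assoc,
    nonsing_inv_mul _ ((isUnit_iff_isUnit_det _).1 hu), one_mulVec]

namespace Experiment

variable (D : p.Experiment)

theorem time_mono {j k : ℕ} (hjk : j ≤ k) (hk : k ≤ D.N) : D.time j ≤ D.time k := by
  induction k, hjk using Nat.le_induction with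
  | base => exact le_rfl
  | succ k _ ih => exact (ih (by omega)).trans (D.time_lt k (by omega)).le

theorem Icc_subset (k : Fin D.N) :
    Icc (D.time k) (D.time (k + 1)) ⊆ Icc (D.time 0) (D.time D.N) :=
  Icc_subset_Icc (D.time_mono (Nat.zero_le _) k.2.le) (D.time_mono k.2 le_rfl)

theorem abs_le_lam : ∀ t ∈ Icc (D.time 0) (D.time D.N), ∀ a, |D.u t a| ≤ p.lam :=
  fun t ht a => (D.abs_lt t ht a).le

theorem intervalIntegrable_of_bounded {g : ℝ → ℝ} {C : ℝ}
    (hm : AEMeasurable g (volume.restrict (Icc (D.time 0) (D.time D.N))))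
    (hC : ∀ t ∈ Icc (D.time 0) (D.time D.N), |g t| ≤ C) (k : Fin D.N) :
    IntervalIntegrable g volume (D.time k) (D.time (k + 1)) := by
  rw [intervalIntegrable_iff_integrableOn_Ioc_of_le (D.time_lt k k.2).le]
  exact (integrableOn_Icc_of_bounded hC hm.aestronglyMeasurable).mono_set
    (Ioc_subset_Icc_self.trans (D.Icc_subset k))

theorem intervalIntegrable_of_continuous {g : AugState n → ℝ} (hg : Continuous g) (k : Fin D.N) :
    IntervalIntegrable (fun t => g (D.X t)) volume (D.time k) (D.time (k + 1)) := by
  refine ContinuousOn.intervalIntegrable ?_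
  rw [uIcc_of_le (D.time_lt k k.2).le]
  exact hg.comp_continuousOn (D.isSolution.continuousOn.mono (D.Icc_subset k))

theorem intervalIntegrable_input (a : Fin m) (k : Fin D.N) :
    IntervalIntegrable (fun t => D.u t a) volume (D.time k) (D.time (k + 1)) :=
  D.intervalIntegrable_of_bounded ((measurable_pi_apply a).comp_aemeasurable
    D.isSolution.aemeasurable) (fun t ht => D.abs_le_lam t ht a) k

theorem intervalIntegrable_input_mul {g : AugState n → ℝ} (hg : Continuous g) (a : Fin m)
    (k : Fin D.N) :
    IntervalIntegrable (fun t => D.u t a * g (D.X t)) volume (D.time k) (D.time (k + 1)) := by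
  refine (D.intervalIntegrable_input a k).mul_continuousOn ?_
  rw [uIcc_of_le (D.time_lt k k.2).le]
  exact hg.comp_continuousOn (D.isSolution.continuousOn.mono (D.Icc_subset k))

theorem intervalIntegrable_barrier (hlam : 0 < p.lam) (Λ : Matrix (Fin m) (Fin m) ℝ)
    (k : Fin D.N) :
    IntervalIntegrable (fun t => p.barrier Λ (D.u t)) volume (D.time k) (D.time (k + 1)) := by
  obtain ⟨C, -, hC⟩ := p.exists_barrier_bound hlam Λ
  exact D.intervalIntegrable_of_bounded (aemeasurable_barrier hlam Λ measurableSet_Icc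
    D.isSolution.aemeasurable D.abs_le_lam) (fun t ht => hC _ (D.abs_le_lam t ht)) k

/-- A diagonal entry is itself a barrier, for the weight with a single `1` on the diagonal, hence
bounded. Off-diagonal entries meet only zeros of `R`. -/
theorem intervalIntegrable_nuIntegrand (hlam : 0 < p.lam) (a : Fin m) (k : Fin D.N) :
    IntervalIntegrable (fun t => p.nuIntegrand (D.u t) (a, a)) volume
      (D.time k) (D.time (k + 1)) := by
  have hdiag : (Matrix.diagonal (Pi.single a 1) : Matrix (Fin m) (Fin m) ℝ).IsDiag :=
    isDiag_diagonal _
  refine (D.intervalIntegrable_barrier hlam (Matrix.diagonal (Pi.single a 1)) k).congr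
    fun t ht => ?_
  rw [uIoc_of_le (D.time_lt k k.2).le] at ht
  have hu := D.abs_lt t (D.Icc_subset k (Ioc_subset_Icc_self ht))
  rw [← p.sum_nuIntegrand_mul hlam hdiag hu]
  simp [Pi.single_apply]

theorem discInt_sum_mul {ι : Type*} (s : Finset ι) (k : Fin D.N) {f : ι → ℝ → ℝ} (c : ι → ℝ)
    (hf : ∀ i ∈ s, IntervalIntegrable (f i) volume (D.time k) (D.time (k + 1))) :
    ∑ i ∈ s, D.discInt k (f i) * c i = D.discInt k fun t => ∑ i ∈ s, f i t * c i := by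
  unfold discInt
  simp only [Finset.mul_sum, ← mul_assoc]
  rw [intervalIntegral.integral_finsetSum]
  · simp only [intervalIntegral.integral_mul_const]
  · exact fun i hi => ((hf i hi).continuousOn_mul (by fun_prop)).mul_const _

theorem discInt_add (k : Fin D.N) {f g : ℝ → ℝ}
    (hf : IntervalIntegrable f volume (D.time k) (D.time (k + 1)))
    (hg : IntervalIntegrable g volume (D.time k) (D.time (k + 1))) :
    D.discInt k f + D.discInt k g = D.discInt k fun t => f t + g t := by
  unfold discInt
  rw [← intervalIntegral.integral_add (hf.continuousOn_mul (by fun_prop))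
    (hg.continuousOn_mul (by fun_prop))]
  simp only [mul_add]

theorem discInt_sub (k : Fin D.N) {f g : ℝ → ℝ}
    (hf : IntervalIntegrable f volume (D.time k) (D.time (k + 1)))
    (hg : IntervalIntegrable g volume (D.time k) (D.time (k + 1))) :
    D.discInt k f - D.discInt k g = D.discInt k fun t => f t - g t := by
  unfold discInt
  rw [← intervalIntegral.integral_sub (hf.continuousOn_mul (by fun_prop))
    (hg.continuousOn_mul (by fun_prop))]
  simp only [mul_sub]

theorem discInt_congr (k : Fin D.N) {f g : ℝ → ℝ}
    (h : ∀ t ∈ Icc (D.time 0) (D.time D.N), f t = g t) : D.discInt k f = D.discInt k g := by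
  unfold discInt
  refine intervalIntegral.integral_congr fun t ht => ?_
  rw [uIcc_of_le (D.time_lt k k.2).le] at ht
  simp only [h t (D.Icc_subset k ht)]

/-- The temporal-difference data. -/
theorem psi_mulVec {Φ : AugState n → Fin L → ℝ} (hΦ : ContDiff ℝ 2 Φ) (W : Fin L → ℝ)
    (k : Fin D.N) :
    (D.psi Φ *ᵥ W) k = D.discInt k fun t =>
      stateGrad (fun y => W ⬝ᵥ Φ y) (D.X t) ⬝ᵥ p.velocity D.X D.u t -
        p.gam * (W ⬝ᵥ Φ (D.X t)) := by
  have hV := (contDiff_dotProduct hΦ W).of_le (m := 1) (by norm_num)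
  have h := D.isSolution.integral_discount D.abs_le_lam (D.time_mono (Nat.zero_le _) k.2.le)
    (D.time_lt k k.2).le (Icc_subset_Icc_right (D.time_mono k.2 le_rfl)) hV (D.time k)
  unfold discInt
  rw [h]
  simp only [psi, mulVec, dotProduct, of_apply, sub_self, mul_zero, Real.exp_zero, one_mul,
    Finset.mul_sum, ← Finset.sum_sub_distrib]
  exact Finset.sum_congr rfl fun l _ => by ring

theorem intervalIntegrable_td {Φ : AugState n → Fin L → ℝ} (hΦ : ContDiff ℝ 2 Φ) (W : Fin L → ℝ)
    (k : Fin D.N) :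
    IntervalIntegrable (fun t => stateGrad (fun y => W ⬝ᵥ Φ y) (D.X t) ⬝ᵥ p.velocity D.X D.u t -
      p.gam * (W ⬝ᵥ Φ (D.X t))) volume (D.time k) (D.time (k + 1)) := by
  have hV := (contDiff_dotProduct hΦ W).of_le (m := 1) (by norm_num)
  have h := D.isSolution.intervalIntegrable_discount D.abs_le_lam
    (D.time_mono (Nat.zero_le _) k.2.le)
    (D.time_lt k k.2).le (Icc_subset_Icc_right (D.time_mono k.2 le_rfl)) hV (D.time k)
  have h2 := h.continuousOn_mul (g := fun t => Real.exp (p.gam * (t - D.time k))) (by fun_prop)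
  refine h2.congr fun t _ => ?_
  rw [← mul_assoc, ← Real.exp_add]
  have : p.gam * (t - D.time k) + -p.gam * (t - D.time k) = 0 := by ring
  rw [this, Real.exp_zero, one_mul]

theorem sum_kronVec_mul {Φ : AugState n → Fin L → ℝ} (hΦ : ContDiff ℝ 2 Φ) (W : Fin L → ℝ)
    (x : AugState n) (v : Fin m → ℝ) :
    ∑ q : Fin m × GradIdx n L, kronVec v (vecGrad Φ x) q * (W q.2.1 * p.G q.2.2 q.1) =
      stateGrad (fun y => W ⬝ᵥ Φ y) x ⬝ᵥ (p.G *ᵥ v) := by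
  have hk := stateGrad_dotProduct hΦ W x
  simp only [dotProduct] at hk
  simp only [dotProduct, mulVec, hk, kronVec, Finset.sum_mul_sum]
  rw [Fintype.sum_prod_type_right, Fintype.sum_prod_type_right]
  refine Finset.sum_congr rfl fun i _ => ?_
  refine Finset.sum_congr rfl fun l _ => ?_
  exact Finset.sum_congr rfl fun a _ => by ring

theorem continuous_vecGrad {Φ : AugState n → Fin L → ℝ} (hΦ : ContDiff ℝ 2 Φ) (j : GradIdx n L) :
    Continuous fun x => vecGrad Φ x j :=
  (continuous_apply j).comp (contDiff_vecGrad hΦ).continuous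

theorem intervalIntegrable_grad_input {Φ : AugState n → Fin L → ℝ} (hΦ : ContDiff ℝ 2 Φ)
    {μ : AugState n → Fin m → ℝ} (hμ : Continuous μ) (q : Fin m × GradIdx n L) (k : Fin D.N) :
    IntervalIntegrable (fun t => kronVec (D.u t) (vecGrad Φ (D.X t)) q) volume
        (D.time k) (D.time (k + 1)) ∧
      IntervalIntegrable (fun t => kronVec (μ (D.X t)) (vecGrad Φ (D.X t)) q) volume
        (D.time k) (D.time (k + 1)) :=
  ⟨D.intervalIntegrable_input_mul (continuous_vecGrad hΦ q.2) q.1 k,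
    D.intervalIntegrable_of_continuous (g := fun x => μ x q.1 * vecGrad Φ x q.2)
      (((continuous_apply q.1).comp hμ).mul (continuous_vecGrad hΦ q.2)) k⟩

theorem mu_sub_phi_eq_eta {Φ : AugState n → Fin L → ℝ} (hΦ : ContDiff ℝ 2 Φ)
    {μ : AugState n → Fin m → ℝ} (hμ : Continuous μ) : D.mu Φ - D.phi Φ μ = D.eta Φ μ := by
  ext k q
  obtain ⟨h1, h2⟩ := D.intervalIntegrable_grad_input hΦ hμ q k
  simp only [Matrix.sub_apply, mu, phi, eta, of_apply]
  rw [D.discInt_sub k h1 h2]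
  refine D.discInt_congr k fun t _ => ?_
  simp only [kronVec, Pi.sub_apply]; ring

theorem eta_mulVec {Φ : AugState n → Fin L → ℝ} (hΦ : ContDiff ℝ 2 Φ)
    {μ : AugState n → Fin m → ℝ} (hμ : Continuous μ) (W : Fin L → ℝ) (k : Fin D.N) :
    (D.eta Φ μ *ᵥ fun q => W q.2.1 * p.G q.2.2 q.1) k = D.discInt k fun t =>
      stateGrad (fun y => W ⬝ᵥ Φ y) (D.X t) ⬝ᵥ (p.G *ᵥ (D.u t - μ (D.X t))) := by
  simp only [← sum_kronVec_mul hΦ]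
  simp only [mulVec, dotProduct, eta, of_apply]
  rw [D.discInt_sum_mul Finset.univ k (fun q : Fin m × GradIdx n L => W q.2.1 * p.G q.2.2 q.1)]
  intro q _
  obtain ⟨h1, h2⟩ := D.intervalIntegrable_grad_input hΦ hμ q k
  refine (h1.sub h2).congr fun t _ => ?_
  simp only [kronVec, Pi.sub_apply]; ring

theorem intervalIntegrable_grad_dotProduct {Φ : AugState n → Fin L → ℝ} (hΦ : ContDiff ℝ 2 Φ)
    {μ : AugState n → Fin m → ℝ} (hμ : Continuous μ) (W : Fin L → ℝ) (k : Fin D.N) :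
    IntervalIntegrable (fun t => stateGrad (fun y => W ⬝ᵥ Φ y) (D.X t) ⬝ᵥ
      (p.G *ᵥ (D.u t - μ (D.X t)))) volume (D.time k) (D.time (k + 1)) := by
  simp only [← sum_kronVec_mul hΦ]
  have := IntervalIntegrable.sum (μ := volume) (a := D.time k) (b := D.time (k + 1)) Finset.univ
    (f := fun (q : Fin m × GradIdx n L) t =>
      kronVec (D.u t - μ (D.X t)) (vecGrad Φ (D.X t)) q * (W q.2.1 * p.G q.2.2 q.1)) fun q _ => by
    obtain ⟨h1, h2⟩ := D.intervalIntegrable_grad_input hΦ hμ q k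
    refine ((h1.sub h2).mul_const (W q.2.1 * p.G q.2.2 q.1)).congr fun t _ => ?_
    simp only [kronVec, Pi.sub_apply]; ring
  exact this.congr fun t _ => by simp

theorem sum_mul_of_isDiag {R : Matrix (Fin m) (Fin m) ℝ} (hR : R.IsDiag)
    (f : Fin m × Fin m → ℝ) : ∑ q, f q * R q.2 q.1 = ∑ a, f (a, a) * R a a := by
  rw [Fintype.sum_prod_type]
  refine Finset.sum_congr rfl fun a _ => Finset.sum_eq_single a (fun b _ hb => ?_) (by simp)
  simp [hR hb]

theorem nu_mulVec (hlam : 0 < p.lam) {R : Matrix (Fin m) (Fin m) ℝ} (hR : R.IsDiag)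
    (k : Fin D.N) :
    (D.nu *ᵥ fun q => R q.2 q.1) k = D.discInt k fun t => p.barrier R (D.u t) := by
  simp only [mulVec, dotProduct, nu, of_apply]
  rw [sum_mul_of_isDiag hR fun q => D.discInt k fun t => p.nuIntegrand (D.u t) q,
    D.discInt_sum_mul Finset.univ k (fun a => R a a)
      fun a _ => D.intervalIntegrable_nuIntegrand hlam a k]
  exact D.discInt_congr k fun t ht => p.sum_nuIntegrand_mul hlam hR (D.abs_lt t ht)

theorem nuTarget_mulVec (hlam : 0 < p.lam) {R : Matrix (Fin m) (Fin m) ℝ} (hR : R.IsDiag)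
    {μ : AugState n → Fin m → ℝ} (hμ : Continuous μ) (hb : ∀ x a, |μ x a| < p.lam)
    (k : Fin D.N) :
    (D.nuTarget μ *ᵥ fun q => R q.2 q.1) k =
      D.discInt k fun t => p.barrier R (μ (D.X t)) := by
  simp only [mulVec, dotProduct, nuTarget, of_apply]
  rw [sum_mul_of_isDiag hR fun q => D.discInt k fun t => p.nuIntegrand (μ (D.X t)) q,
    D.discInt_sum_mul Finset.univ k (fun a => R a a)]
  · exact D.discInt_congr k fun t _ => p.sum_nuIntegrand_mul hlam hR (hb _)
  · intro a _
    have hdiag : (Matrix.diagonal (Pi.single a 1) : Matrix (Fin m) (Fin m) ℝ).IsDiag :=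
      isDiag_diagonal _
    refine (D.intervalIntegrable_of_continuous (g := fun x => p.barrier
      (Matrix.diagonal (Pi.single a 1)) (μ x)) ((p.continuousOn_barrier hlam _).comp_continuous hμ
        fun x a => (hb x a).le) k).congr fun t _ => ?_
    rw [← p.sum_nuIntegrand_mul hlam hdiag (hb _)]
    simp [Pi.single_apply]

theorem intervalIntegrable_barrier_policy (hlam : 0 < p.lam) (Λ : Matrix (Fin m) (Fin m) ℝ)
    {μ : AugState n → Fin m → ℝ} (hμ : Continuous μ) (hb : ∀ x a, |μ x a| < p.lam)
    (k : Fin D.N) :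
    IntervalIntegrable (fun t => p.barrier Λ (μ (D.X t))) volume (D.time k) (D.time (k + 1)) :=
  D.intervalIntegrable_of_continuous (g := fun x => p.barrier Λ (μ x))
    ((p.continuousOn_barrier hlam _).comp_continuous hμ fun x a => (hb x a).le) k

variable {Φ : AugState n → Fin L → ℝ} {μ : AugState n → Fin m → ℝ} {W : Fin L → ℝ}

/-- The `η̃` block replaces the recorded input by the target policy in the temporal difference. No
Lyapunov equation is assumed: the right side depends on `W` only through the function `Wᵀ Φ`, which
is also used to prove injectivity. -/
theorem regressorTime_mulVec_apply (hlam : 0 < p.lam) (hRd : p.R.IsDiag) (hΦ : ContDiff ℝ 2 Φ)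
    (hμ : Continuous μ) (hb : ∀ x a, |μ x a| < p.lam) (W : Fin L → ℝ) (k : Fin D.N) :
    (D.regressorTime Φ μ *ᵥ p.exactTheta W) k = D.discInt k fun t =>
      -(stateGrad (fun y => W ⬝ᵥ Φ y) (D.X t) ⬝ᵥ (p.F *ᵥ D.X t + p.G *ᵥ μ (D.X t)) -
        p.gam * (W ⬝ᵥ Φ (D.X t))) + (p.barrier p.R (D.u t) - p.barrier p.R (μ (D.X t))) := by
  have i1 := D.intervalIntegrable_td hΦ W k
  have i2 := D.intervalIntegrable_grad_dotProduct hΦ hμ W k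
  have i3 := D.intervalIntegrable_barrier hlam p.R k
  have i4 := D.intervalIntegrable_barrier_policy hlam p.R hμ hb k
  rw [regressorTime, exactTheta, fromCols_mulVec_sumElim, fromCols_mulVec_sumElim, neg_mulVec,
    sub_mulVec]
  simp only [Pi.add_apply, Pi.neg_apply, Pi.sub_apply]
  rw [D.psi_mulVec hΦ, D.eta_mulVec hΦ hμ, D.nu_mulVec hlam hRd,
    D.nuTarget_mulVec hlam hRd hμ hb, D.discInt_sub k i3 i4, D.discInt_add k i2 (i3.sub i4),
    neg_add_eq_sub, D.discInt_sub k (i2.add (i3.sub i4)) i1]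
  refine D.discInt_congr k fun t _ => ?_
  simp only [velocity, mulVec_sub, dotProduct_add, dotProduct_sub]
  ring

theorem regressorOff_mulVec_apply (hlam : 0 < p.lam) (hRd : p.R.IsDiag) (hΦ : ContDiff ℝ 2 Φ)
    (hμ : Continuous μ) (W : Fin L → ℝ) (k : Fin D.N) :
    (D.regressorOff Φ μ *ᵥ p.exactTheta W) k = D.discInt k fun t =>
      -(stateGrad (fun y => W ⬝ᵥ Φ y) (D.X t) ⬝ᵥ (p.F *ᵥ D.X t + p.G *ᵥ μ (D.X t)) -
        p.gam * (W ⬝ᵥ Φ (D.X t))) + p.barrier p.R (D.u t) := by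
  have i1 := D.intervalIntegrable_td hΦ W k
  have i2 := D.intervalIntegrable_grad_dotProduct hΦ hμ W k
  have i3 := D.intervalIntegrable_barrier hlam p.R k
  rw [regressorOff, exactTheta, fromCols_mulVec_sumElim, fromCols_mulVec_sumElim, neg_mulVec,
    D.mu_sub_phi_eq_eta hΦ hμ]
  simp only [Pi.add_apply, Pi.neg_apply]
  rw [D.psi_mulVec hΦ, D.eta_mulVec hΦ hμ, D.nu_mulVec hlam hRd,
    D.discInt_add k i2 i3, neg_add_eq_sub, D.discInt_sub k (i2.add i3) i1]
  refine D.discInt_congr k fun t _ => ?_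
  simp only [velocity, mulVec_sub, dotProduct_add, dotProduct_sub]
  ring

theorem regressorTime_mulVec (hlam : 0 < p.lam) (hRd : p.R.IsDiag) (hΦ : ContDiff ℝ 2 Φ)
    (hμ : Continuous μ) (hb : ∀ x a, |μ x a| < p.lam)
    (hH : ∀ x, p.hamiltonian p.R (fun y => W ⬝ᵥ Φ y) x (μ x) = 0) :
    D.regressorTime Φ μ *ᵥ p.exactTheta W = D.xi := by
  ext k
  rw [D.regressorTime_mulVec_apply hlam hRd hΦ hμ hb, xi]
  refine D.discInt_congr k fun t _ => ?_
  have := hH (D.X t)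
  simp only [hamiltonian, reward] at this ⊢
  linarith

/-- The Lyapunov equation with weight `Λ` produces the target barrier measured by `ω̃`, while the
reward was recorded with the true `R`. So the `Λ_uu` block of the solution is `R`, whatever `Λ` is.
-/
theorem regressorOff_mulVec (hlam : 0 < p.lam) (hRd : p.R.IsDiag) (hΦ : ContDiff ℝ 2 Φ)
    (hμ : Continuous μ) (hb : ∀ x a, |μ x a| < p.lam) {Λ : Matrix (Fin m) (Fin m) ℝ}
    (hH : ∀ x, p.hamiltonian Λ (fun y => W ⬝ᵥ Φ y) x (μ x) = 0) :
    D.regressorOff Φ μ *ᵥ p.exactTheta W = D.xi + D.omega Λ μ := by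
  ext k
  have i : IntervalIntegrable (fun t => p.reward p.R (D.X t) (D.u t)) volume
      (D.time k) (D.time (k + 1)) :=
    (D.intervalIntegrable_of_continuous p.continuous_stateCost k).add
      (D.intervalIntegrable_barrier hlam p.R k)
  rw [D.regressorOff_mulVec_apply hlam hRd hΦ hμ, Pi.add_apply, xi, omega,
    D.discInt_add k i (D.intervalIntegrable_barrier_policy hlam Λ hμ hb k)]
  refine D.discInt_congr k fun t _ => ?_
  have := hH (D.X t)
  simp only [hamiltonian, reward] at this ⊢
  linarith

end Experiment

end TrackingProblem

end

/-! ### Exactness of one step, policy improvement and convergence. -/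

noncomputable section

namespace TrackingProblem

variable {n m L : ℕ} {p : TrackingProblem n m} {Φ : AugState n → Fin L → ℝ}

/-! ### One step of the algorithms -/

/-- Least squares recovers `exactTheta W` from its image, and that image is determined by the
function `Wᵀ Φ` alone. -/
theorem injective_of_mulVec_exactTheta {N : ℕ} {Δ : Matrix (Fin N) (ThetaIdx n m L) ℝ}
    (hΔ : FullRank Δ) (h : ∀ W W' : Fin L → ℝ, ((fun y => W ⬝ᵥ Φ y) = fun y => W' ⬝ᵥ Φ y) →
      Δ *ᵥ p.exactTheta W = Δ *ᵥ p.exactTheta W') :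
    Function.Injective fun (W : Fin L → ℝ) x => W ⬝ᵥ Φ x := by
  intro W W' hW
  have h1 := leastSquares_eq hΔ (h W W' hW)
  rw [leastSquares_eq hΔ rfl] at h1
  rw [← p.thetaW_exactTheta W, ← p.thetaW_exactTheta W', h1]

theorem injective_of_fullRank_regressorOff (hlam : 0 < p.lam) (hRd : p.R.IsDiag)
    (hΦ : ContDiff ℝ 2 Φ) {D : p.Experiment} {μ : AugState n → Fin m → ℝ} (hμ : Continuous μ)
    (hD : FullRank (D.regressorOff Φ μ)) :
    Function.Injective fun (W : Fin L → ℝ) x => W ⬝ᵥ Φ x := by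
  refine injective_of_mulVec_exactTheta (p := p) hD fun W W' h => ?_
  ext k
  rw [D.regressorOff_mulVec_apply hlam hRd hΦ hμ, D.regressorOff_mulVec_apply hlam hRd hΦ hμ]
  simp only [fun x => congrFun h x]

theorem injective_of_fullRank_regressorTime (hlam : 0 < p.lam) (hRd : p.R.IsDiag)
    (hΦ : ContDiff ℝ 2 Φ) {D : p.Experiment} {μ : AugState n → Fin m → ℝ} (hμ : Continuous μ)
    (hb : ∀ x a, |μ x a| < p.lam) (hD : FullRank (D.regressorTime Φ μ)) :
    Function.Injective fun (W : Fin L → ℝ) x => W ⬝ᵥ Φ x := by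
  refine injective_of_mulVec_exactTheta (p := p) hD fun W W' h => ?_
  ext k
  rw [D.regressorTime_mulVec_apply hlam hRd hΦ hμ hb,
    D.regressorTime_mulVec_apply hlam hRd hΦ hμ hb]
  simp only [fun x => congrFun h x]

theorem IsPolicyValue.hamiltonian_policy_eq_zero (hlam : 0 < p.lam) (hΦ : ContDiff ℝ 2 Φ)
    {K : Matrix (Fin m) (GradIdx n L) ℝ} {Λ : Matrix (Fin m) (Fin m) ℝ} {W : Fin L → ℝ}
    (hV : p.IsPolicyValue Λ (p.policy Φ K) fun y => W ⬝ᵥ Φ y) (x : AugState n) :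
    p.hamiltonian Λ (fun y => W ⬝ᵥ Φ y) x (p.policy Φ K x) = 0 :=
  hV.hamiltonian_eq_zero hlam (p.contDiff_policy K hΦ) (fun x a => (p.abs_policy_lt K hlam x a).le)
    ((contDiff_dotProduct hΦ W).of_le (by norm_num)) x

theorem offTheta_eq (hlam : 0 < p.lam) (hRd : p.R.IsDiag) (hΦ : ContDiff ℝ 2 Φ)
    {D : p.Experiment} {K : Matrix (Fin m) (GradIdx n L) ℝ} {Λ : Matrix (Fin m) (Fin m) ℝ}
    (hD : FullRank (D.regressorOff Φ (p.policy Φ K))) {W : Fin L → ℝ}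
    (hV : p.IsPolicyValue Λ (p.policy Φ K) fun y => W ⬝ᵥ Φ y) :
    p.offTheta Φ D K Λ = p.exactTheta W :=
  leastSquares_eq hD (D.regressorOff_mulVec hlam hRd hΦ (p.contDiff_policy K hΦ).continuous
    (p.abs_policy_lt K hlam) (hV.hamiltonian_policy_eq_zero hlam hΦ))

theorem timeTheta_eq (hlam : 0 < p.lam) (hRd : p.R.IsDiag) (hΦ : ContDiff ℝ 2 Φ)
    {D : p.Experiment} {K : Matrix (Fin m) (GradIdx n L) ℝ}
    (hD : FullRank (D.regressorTime Φ (p.policy Φ K))) {W : Fin L → ℝ}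
    (hV : p.IsPolicyValue p.R (p.policy Φ K) fun y => W ⬝ᵥ Φ y) :
    p.timeTheta Φ D K = p.exactTheta W :=
  leastSquares_eq hD (D.regressorTime_mulVec hlam hRd hΦ (p.contDiff_policy K hΦ).continuous
    (p.abs_policy_lt K hlam) (hV.hamiltonian_policy_eq_zero hlam hΦ))

/-! ### Policy improvement -/

theorem IsPolicyValue.neg_div_le (hM : p.M.PosSemidef) (hgam : 0 < p.gam)
    {μ : AugState n → Fin m → ℝ} {Λ : Matrix (Fin m) (Fin m) ℝ} {V : AugState n → ℝ}
    (hV : p.IsPolicyValue Λ μ V) {C : ℝ} (hC : ∀ x, -C ≤ p.barrier Λ (μ x)) (x : AugState n) :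
    -(C / p.gam) ≤ V x := by
  obtain ⟨X, hX⟩ := (hV x).1
  obtain ⟨hi, hc⟩ := (hV x).2 X hX
  have hexp := integral_exp_mul_Ioi (a := -p.gam) (by linarith) 0
  have hint := integrableOn_exp_mul_Ioi (a := -p.gam) (by linarith) 0
  calc -(C / p.gam) = ∫ t in Ioi (0 : ℝ), Real.exp (-p.gam * t) * (-C) := by
        rw [integral_mul_const, hexp]; simp; field_simp
    _ ≤ ∫ t in Ioi (0 : ℝ), Real.exp (-p.gam * t) * p.reward Λ (X t) (μ (X t)) := by
        refine integral_mono (hint.mul_const _) hi fun t => ?_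
        refine mul_le_mul_of_nonneg_left ?_ (Real.exp_pos _).le
        have := p.stateCost_nonneg hM (X t)
        have := hC (X t)
        simp only [reward]; linarith
    _ = V x := hc

theorem IsPolicyValue.nonneg (hM : p.M.PosSemidef) (hRd : p.R.IsDiag) (hR : p.R.PosDef)
    (hlam : 0 < p.lam) (hgam : 0 < p.gam) {μ : AugState n → Fin m → ℝ}
    (hb : ∀ x a, |μ x a| ≤ p.lam) {V : AugState n → ℝ} (hV : p.IsPolicyValue p.R μ V)
    (x : AugState n) : 0 ≤ V x := by
  have := hV.neg_div_le hM hgam (C := 0)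
    (fun x => by rw [neg_zero]; exact p.barrier_nonneg hlam hRd hR (hb x)) x
  simpa using this

theorem IsClosedLoop.intervalIntegrable_comp {μ : AugState n → Fin m → ℝ} {x₀ : AugState n}
    {X : ℝ → AugState n} (hX : p.IsClosedLoop μ x₀ X) {g : AugState n → ℝ} (hg : Continuous g)
    {T : ℝ} (hT : 0 ≤ T) : IntervalIntegrable (fun t => g (X t)) volume 0 T := by
  refine ContinuousOn.intervalIntegrable ?_
  rw [uIcc_of_le hT]
  exact hg.comp_continuousOn (hX.1.continuousOn.mono Icc_subset_Ici_self)

/-- `V` serves as a Lyapunov function for its greedy policy. Since `V` is evaluated with `Λ` but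
improved with `R`, three bounded barriers remain: one for `Λ` and two for `R`, whence `D = C + 2 *
C'`. For general `Λ` the value may be negative, but not below `-C / gam`. -/
theorem IsPolicyValue.hasFiniteStateCost_greedy (hM : p.M.PosSemidef) (hRd : p.R.IsDiag)
    (hR : p.R.PosDef) (hlam : 0 < p.lam) (hgam : 0 < p.gam) {μ : AugState n → Fin m → ℝ}
    (hμ : ContDiff ℝ 1 μ) (hb : ∀ x a, |μ x a| ≤ p.lam) {Λ : Matrix (Fin m) (Fin m) ℝ}
    {V : AugState n → ℝ} (hV : p.IsPolicyValue Λ μ V) (hVd : ContDiff ℝ 1 V) {x₀ : AugState n}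
    {X : ℝ → AugState n} (hX : p.IsClosedLoop (p.greedy V) x₀ X) : p.HasFiniteStateCost X := by
  obtain ⟨C, hC0, hC⟩ := p.exists_barrier_bound hlam Λ
  obtain ⟨C', hC0', hC'⟩ := p.exists_barrier_bound hlam p.R
  have hg := fun x a => (p.abs_greedy_lt hlam V x a).le
  refine ((hX.isControlled hg).integrableOn_of_decrease hgam hVd (B := C / p.gam)
    (D := C + 2 * C') (by positivity) (by positivity)
    (hV.neg_div_le hM hgam fun x => (abs_le.1 (hC _ (hb x))).1)
    (ρ := fun t => p.stateCost (X t))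
    (fun T hT => hX.intervalIntegrable_comp p.continuous_stateCost hT)
    (fun t _ => p.stateCost_nonneg hM _) fun t _ => ?_).1
  have h1 := p.hamiltonian_greedy_le hlam hRd hR V (X t) (hb (X t))
  have h2 := hV.hamiltonian_eq_zero hlam hμ hb hVd (X t)
  have h3 := abs_le.1 (hC _ (hb (X t)))
  have h4 := abs_le.1 (hC' _ (hb (X t)))
  have h5 := abs_le.1 (hC' _ (hg (X t)))
  simp only [hamiltonian, reward, velocity] at *
  linarith

/-- A nonnegative supersolution of the policy evaluation equation bounds the cost. -/
theorem IsClosedLoop.exists_hasCost_le (hM : p.M.PosSemidef) (hRd : p.R.IsDiag)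
    (hR : p.R.PosDef) (hlam : 0 < p.lam) (hgam : 0 < p.gam) {μ : AugState n → Fin m → ℝ}
    (hμ : Continuous μ) (hb : ∀ x a, |μ x a| ≤ p.lam) {V : AugState n → ℝ}
    (hVd : ContDiff ℝ 1 V) (hV0 : ∀ x, 0 ≤ V x) (hH : ∀ x, p.hamiltonian p.R V x (μ x) ≤ 0)
    {x₀ : AugState n} {X : ℝ → AugState n} (hX : p.IsClosedLoop μ x₀ X) :
    ∃ c ≤ V x₀, p.HasCost p.R X (fun t => μ (X t)) c := by
  have h := (hX.isControlled hb).integrableOn_of_decrease hgam hVd (B := 0) (D := 0) le_rfl le_rfl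
    (by simpa using hV0) (ρ := fun t => p.reward p.R (X t) (μ (X t)))
    (fun T hT => hX.intervalIntegrable_comp (p.continuous_reward hlam hμ hb p.R) hT)
    (fun t _ => add_nonneg (p.stateCost_nonneg hM _) (p.barrier_nonneg hlam hRd hR (hb _)))
    fun t _ => by
      have := hH (X t)
      simp only [hamiltonian, velocity] at *
      linarith
  exact ⟨_, by simpa using h.2, h.1, rfl⟩

/-- The Hamiltonian of `V` vanishes at `μ` and is smaller at the greedy input, so `V` is a
nonnegative supersolution for the greedy policy. -/
theorem IsPolicyValue.greedy_le (hM : p.M.PosSemidef) (hRd : p.R.IsDiag)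
    (hR : p.R.PosDef) (hlam : 0 < p.lam) (hgam : 0 < p.gam) {μ : AugState n → Fin m → ℝ}
    (hμ : ContDiff ℝ 1 μ) (hb : ∀ x a, |μ x a| ≤ p.lam) {V V' : AugState n → ℝ}
    (hV : p.IsPolicyValue p.R μ V) (hVd : ContDiff ℝ 1 V) (hg : Continuous (p.greedy V))
    (hV' : p.IsPolicyValue p.R (p.greedy V) V') (x : AugState n) : V' x ≤ V x := by
  obtain ⟨X, hX⟩ := (hV' x).1
  obtain ⟨c, hc, hXc⟩ := hX.exists_hasCost_le hM hRd hR hlam hgam hg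
    (fun x a => (p.abs_greedy_lt hlam V x a).le) hVd (hV.nonneg hM hRd hR hlam hgam hb)
    fun x => (p.hamiltonian_greedy_le hlam hRd hR V x (hb x)).trans
      (hV.hamiltonian_eq_zero hlam hμ hb hVd x).le
  rwa [← ((hV' x).2 X hX).2, hXc.2]

/-! ### Convergence -/

/-- An injective linear map from a finite-dimensional space is a closed embedding, even into
functions with the topology of pointwise convergence. -/
theorem exists_tendsto_of_tendsto_dotProduct
    (hinj : Function.Injective fun (W : Fin L → ℝ) x => W ⬝ᵥ Φ x) {W : ℕ → Fin L → ℝ}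
    {f : AugState n → ℝ} (h : ∀ x, Tendsto (fun i => W i ⬝ᵥ Φ x) atTop (𝓝 (f x))) :
    ∃ Wstar, Tendsto W atTop (𝓝 Wstar) := by
  let T : (Fin L → ℝ) →ₗ[ℝ] (AugState n → ℝ) :=
    { toFun := fun W x => W ⬝ᵥ Φ x
      map_add' := fun W W' => funext fun x => add_dotProduct _ _ _
      map_smul' := fun c W => funext fun x => smul_dotProduct _ _ _ }
  have hT : IsClosedEmbedding T :=
    LinearMap.isClosedEmbedding_of_injective (LinearMap.ker_eq_bot.2 hinj)
  have hlim : Tendsto (fun i => T (W i)) atTop (𝓝 f) := tendsto_pi_nhds.2 h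
  obtain ⟨Wstar, hW⟩ := hT.isClosed_range.mem_of_tendsto hlim
    (Eventually.of_forall fun i => mem_range_self (W i))
  exact ⟨Wstar, hT.tendsto_nhds_iff.2 (hW ▸ hlim)⟩

theorem continuous_stateGrad_weight (hΦ : ContDiff ℝ 2 Φ) (x : AugState n) :
    Continuous fun W : Fin L → ℝ => stateGrad (fun y => W ⬝ᵥ Φ y) x := by
  refine continuous_pi fun k => ?_
  simp only [stateGrad_dotProduct hΦ]
  fun_prop

theorem continuous_greedy_weight (hΦ : ContDiff ℝ 2 Φ) (x : AugState n) :
    Continuous fun W : Fin L → ℝ => p.greedy (fun y => W ⬝ᵥ Φ y) x := by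
  refine continuous_pi fun a => ?_
  have h := (continuous_apply a).comp ((continuous_mulVec (p.lam • p.R)⁻¹).comp
    ((continuous_mulVec p.Gᵀ).comp (continuous_stateGrad_weight hΦ x)))
  exact continuous_const.mul ((Real.contDiff_tanh' (k := 0)).continuous.comp (continuous_const.mul h))

theorem tendsto_hamiltonian (hlam : 0 < p.lam) (hΦ : ContDiff ℝ 2 Φ)
    {Λ : Matrix (Fin m) (Fin m) ℝ} {W : ℕ → Fin L → ℝ} {Wstar : Fin L → ℝ}
    (hW : Tendsto W atTop (𝓝 Wstar)) {u : ℕ → Fin m → ℝ} {ustar : Fin m → ℝ}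
    (hu : Tendsto u atTop (𝓝 ustar)) (hb : ∀ i a, |u i a| ≤ p.lam)
    (hbs : ∀ a, |ustar a| ≤ p.lam) (x : AugState n) :
    Tendsto (fun i => p.hamiltonian Λ (fun y => W i ⬝ᵥ Φ y) x (u i)) atTop
      (𝓝 (p.hamiltonian Λ (fun y => Wstar ⬝ᵥ Φ y) x ustar)) := by
  have h1 : Tendsto (fun i => p.barrier Λ (u i)) atTop (𝓝 (p.barrier Λ ustar)) :=
    (p.continuousOn_barrier hlam Λ ustar hbs).tendsto.comp
      (tendsto_nhdsWithin_iff.2 ⟨hu, Eventually.of_forall hb⟩)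
  have h2 : Tendsto (fun i => W i ⬝ᵥ Φ x) atTop (𝓝 (Wstar ⬝ᵥ Φ x)) :=
    ((continuous_id.dotProduct continuous_const).tendsto Wstar).comp hW
  have h3 := ((continuous_stateGrad_weight hΦ x).tendsto Wstar).comp hW
  have h4 : Tendsto (fun i => p.F *ᵥ x + p.G *ᵥ u i) atTop (𝓝 (p.F *ᵥ x + p.G *ᵥ ustar)) :=
    tendsto_const_nhds.add (((continuous_mulVec p.G).tendsto ustar).comp hu)
  have h5 : Tendsto (fun i => stateGrad (fun y => W i ⬝ᵥ Φ y) x ⬝ᵥ (p.F *ᵥ x + p.G *ᵥ u i)) atTop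
      (𝓝 (stateGrad (fun y => Wstar ⬝ᵥ Φ y) x ⬝ᵥ (p.F *ᵥ x + p.G *ᵥ ustar))) :=
    tendsto_finsetSum _ fun k _ => (tendsto_pi_nhds.1 h3 k).mul (tendsto_pi_nhds.1 h4 k)
  simp only [hamiltonian, reward]
  exact ((h1.const_add _).sub (h2.const_mul _)).add h5

theorem contDiff_greedy_dotProduct (hRd : p.R.IsDiag) (hR : p.R.PosDef) (hlam : 0 < p.lam)
    (hΦ : ContDiff ℝ 2 Φ) (W : Fin L → ℝ) : ContDiff ℝ 1 (p.greedy fun y => W ⬝ᵥ Φ y) := by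
  rw [← p.policy_nextGain_exactTheta hlam hRd hR hΦ]
  exact p.contDiff_policy _ hΦ

theorem IsOptimalWeight.eq (hinj : Function.Injective fun (W : Fin L → ℝ) x => W ⬝ᵥ Φ x)
    {W W' : Fin L → ℝ} (h : p.IsOptimalWeight Φ W) (h' : p.IsOptimalWeight Φ W') : W = W' :=
  hinj (funext fun x => (h.1 x).unique (h'.1 x))

/-- A nonnegative solution of the Hamilton-Jacobi-Bellman equation which is bounded by the value
function of an admissible policy is the optimal value function. -/
theorem isOptimalWeight_of_hamiltonian_eq_zero (hM : p.M.PosSemidef) (hRd : p.R.IsDiag)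
    (hR : p.R.PosDef) (hlam : 0 < p.lam) (hgam : 0 < p.gam)
    {S : Matrix (Fin n) (Fin n) ℝ} (hS : S.PosSemidef) (hSM : S * S = p.M)
    (hΦ : ContDiff ℝ 2 Φ) {μ : AugState n → Fin m → ℝ} (hb : ∀ x a, |μ x a| ≤ p.lam)
    {V : AugState n → ℝ} (hV : p.IsPolicyValue p.R μ V) {W : Fin L → ℝ}
    (hW0 : ∀ x, 0 ≤ W ⬝ᵥ Φ x) (hWV : ∀ x, W ⬝ᵥ Φ x ≤ V x)
    (hH : ∀ x, p.hamiltonian p.R (fun y => W ⬝ᵥ Φ y) x (p.greedy (fun y => W ⬝ᵥ Φ y) x) = 0) :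
    p.IsOptimalWeight Φ W := by
  have hWd : ContDiff ℝ 1 fun y => W ⬝ᵥ Φ y := (contDiff_dotProduct hΦ W).of_le (by norm_num)
  have hlower : ∀ x₀ X u c, p.IsControlled x₀ X u → p.HasCost p.R X u c → W ⬝ᵥ Φ x₀ ≤ c := by
    intro x₀ X u c hX hc
    have hfin := (hX.integrableOn_reward_iff hlam hgam p.R).1 hc.1
    -- Transversality for `Wᵀ Φ` follows by squeezing it between `0` and the admissible value `V`.
    have hlim := hV.tendsto_discount hlam hgam hS hSM hb hX hfin
    refine hX.le_cost hWd (fun t ht => ?_) (squeeze_zero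
      (fun t => mul_nonneg (Real.exp_pos _).le (hW0 _))
      (fun t => mul_le_mul_of_nonneg_left (hWV _) (Real.exp_pos _).le) hlim) hc
    rw [← hH (X t)]
    exact p.hamiltonian_greedy_le hlam hRd hR _ _ (hX.abs_le t ht)
  refine ⟨fun x₀ => ⟨?_, fun c ⟨X, u, hX, hc⟩ => hlower x₀ X u c hX hc⟩, hH⟩
  have hg := contDiff_greedy_dotProduct hRd hR hlam hΦ W
  have hgb := fun x a => (p.abs_greedy_lt hlam (fun y => W ⬝ᵥ Φ y) x a).le
  obtain ⟨X, hX⟩ := exists_isClosedLoop hg hgb x₀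
  obtain ⟨c, hc, hXc⟩ := hX.exists_hasCost_le hM hRd hR hlam hgam hg.continuous hgb hWd hW0
    fun x => (hH x).le
  -- The greedy closed loop costs at most `W ⬝ᵥ Φ x₀` as a supersolution bound and at least that by
  -- verification, so the minimum is attained.
  have : W ⬝ᵥ Φ x₀ = c := (hlower x₀ X _ c (hX.isControlled hgb) hXc).antisymm hc
  exact ⟨X, _, hX.isControlled hgb, this ▸ hXc⟩

/-- Policy iteration over the span of the basis functions converges to the optimal weight. -/
theorem exists_isOptimalWeight_of_policyIteration (hM : p.M.PosSemidef) (hRd : p.R.IsDiag)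
    (hR : p.R.PosDef) (hlam : 0 < p.lam) (hgam : 0 < p.gam)
    {S : Matrix (Fin n) (Fin n) ℝ} (hS : S.PosSemidef) (hSM : S * S = p.M)
    (hΦ : ContDiff ℝ 2 Φ) (hinj : Function.Injective fun (W : Fin L → ℝ) x => W ⬝ᵥ Φ x)
    {μ : ℕ → AugState n → Fin m → ℝ} (hμ : ∀ i, ContDiff ℝ 1 (μ i))
    (hb : ∀ i x a, |μ i x a| ≤ p.lam) {W : ℕ → Fin L → ℝ}
    (hV : ∀ i, p.IsPolicyValue p.R (μ i) fun y => W i ⬝ᵥ Φ y)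
    (hstep : ∀ i, μ (i + 1) = p.greedy fun y => W i ⬝ᵥ Φ y) :
    ∃ Wstar : Fin L → ℝ, p.IsOptimalWeight Φ Wstar ∧
      (∀ W, p.IsOptimalWeight Φ W → W = Wstar) ∧ Tendsto W atTop (𝓝 Wstar) := by
  have hWd : ∀ W : Fin L → ℝ, ContDiff ℝ 1 fun y => W ⬝ᵥ Φ y :=
    fun W => (contDiff_dotProduct hΦ W).of_le (by norm_num)
  have h0 : ∀ i x, 0 ≤ W i ⬝ᵥ Φ x := fun i => (hV i).nonneg hM hRd hR hlam hgam (hb i)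
  have hanti : ∀ x, Antitone fun i => W i ⬝ᵥ Φ x := fun x => antitone_nat_of_succ_le fun i =>
    (hV i).greedy_le hM hRd hR hlam hgam (hμ i) (hb i) (hWd _) (hstep i ▸ (hμ (i + 1)).continuous)
      (hstep i ▸ hV (i + 1)) x
  obtain ⟨Wstar, hW⟩ := exists_tendsto_of_tendsto_dotProduct hinj fun x =>
    tendsto_atTop_ciInf (hanti x) ⟨0, by rintro _ ⟨i, rfl⟩; exact h0 i x⟩
  have hWx : ∀ x, Tendsto (fun i => W i ⬝ᵥ Φ x) atTop (𝓝 (Wstar ⬝ᵥ Φ x)) := fun x =>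
    ((continuous_id.dotProduct continuous_const).tendsto Wstar).comp hW
  have hopt : p.IsOptimalWeight Φ Wstar := by
    refine isOptimalWeight_of_hamiltonian_eq_zero hM hRd hR hlam hgam hS hSM hΦ (hb 0) (hV 0)
      (fun x => ge_of_tendsto' (hWx x) fun i => h0 i x)
      (fun x => le_of_tendsto' (hWx x) fun i => hanti x (Nat.zero_le i)) fun x => ?_
    -- The Lyapunov equation at index `i + 1` pairs `V_{i+1}` with the greedy policy of `V_i`; both
    -- converge, to `V*` and to its greedy policy.
    refine tendsto_nhds_unique (tendsto_hamiltonian (Λ := p.R) hlam hΦ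
      (hW.comp (tendsto_add_atTop_nat 1))
      (((continuous_greedy_weight hΦ x).tendsto Wstar).comp hW)
      (fun i a => (p.abs_greedy_lt hlam _ x a).le) (fun a => (p.abs_greedy_lt hlam _ x a).le) x)
      (tendsto_const_nhds.congr fun i => ?_)
    have := (hV (i + 1)).hamiltonian_eq_zero hlam (hμ _) (hb _) (hWd _) x
    rw [hstep i] at this
    exact this.symm
  exact ⟨Wstar, hopt, fun W' hW' => hW'.eq hinj hopt, hW⟩

/-! ### The two algorithms -/

theorem offPolicy_isPolicyValue (hM : p.M.PosSemidef) (hRd : p.R.IsDiag)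
    (hR : p.R.PosDef) (hlam : 0 < p.lam) (hgam : 0 < p.gam) (hΦ : ContDiff ℝ 2 Φ)
    {K₀ : Matrix (Fin m) (GradIdx n L) ℝ} (hadm : p.IsAdmissible (p.policy Φ K₀))
    {E : ℕ → p.Experiment} {Λ₀ : Matrix (Fin m) (Fin m) ℝ}
    (hE : ∀ i, FullRank ((E i).regressorOff Φ (p.offPolicy Φ E K₀ Λ₀ i)))
    (hspan : ∀ i V, p.IsPolicyValue (p.offWeight Φ E K₀ Λ₀ i) (p.offPolicy Φ E K₀ Λ₀ i) V →
      ∃ W : Fin L → ℝ, ∀ x, V x = W ⬝ᵥ Φ x) (i : ℕ) :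
    (p.IsPolicyValue (p.offWeight Φ E K₀ Λ₀ i) (p.offPolicy Φ E K₀ Λ₀ i) fun y =>
        p.offW Φ E K₀ Λ₀ i ⬝ᵥ Φ y) ∧
      p.offPolicy Φ E K₀ Λ₀ (i + 1) = p.greedy (fun y => p.offW Φ E K₀ Λ₀ i ⬝ᵥ Φ y) ∧
      p.offWeight Φ E K₀ Λ₀ (i + 1) = p.R := by
  have hb : ∀ i x a, |p.offPolicy Φ E K₀ Λ₀ i x a| ≤ p.lam :=
    fun i x a => (p.abs_policy_lt _ hlam x a).le
  -- The invariant carried along the induction is finiteness of the state cost, which does not refer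
  -- to the weight. It yields a value function, the span assumption supplies `W`, and exactness of
  -- the regression gives the rest.
  have step : ∀ i, (∀ x₀ X, p.IsClosedLoop (p.offPolicy Φ E K₀ Λ₀ i) x₀ X →
      p.HasFiniteStateCost X) →
      (p.IsPolicyValue (p.offWeight Φ E K₀ Λ₀ i) (p.offPolicy Φ E K₀ Λ₀ i) fun y =>
        p.offW Φ E K₀ Λ₀ i ⬝ᵥ Φ y) ∧
      p.offPolicy Φ E K₀ Λ₀ (i + 1) = p.greedy (fun y => p.offW Φ E K₀ Λ₀ i ⬝ᵥ Φ y) ∧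
      p.offWeight Φ E K₀ Λ₀ (i + 1) = p.R := by
    intro i hfin
    obtain ⟨V, hV⟩ := exists_isPolicyValue hlam hgam (p.contDiff_policy _ hΦ) (hb i)
      (p.offWeight Φ E K₀ Λ₀ i) hfin
    obtain ⟨W, hW⟩ := hspan i V hV
    obtain rfl : V = fun y => W ⬝ᵥ Φ y := funext hW
    have hΘ := offTheta_eq hlam hRd hΦ (hE i) hV
    have hWi : p.offW Φ E K₀ Λ₀ i = W := (congrArg thetaW hΘ).trans (p.thetaW_exactTheta W)
    rw [hWi]
    exact ⟨hV, (congrArg (fun Θ => p.policy Φ (nextGain Θ)) hΘ).trans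
      (p.policy_nextGain_exactTheta hlam hRd hR hΦ W),
      (congrArg thetaUU hΘ).trans (p.thetaUU_exactTheta W)⟩
  refine step i ?_
  induction i with
  | zero =>
    obtain ⟨-, -, V, hV⟩ := hadm
    exact fun x₀ X hX => hV.hasFiniteStateCost hlam hgam (hb 0) hX
  | succ i ih =>
    intro x₀ X hX
    obtain ⟨hV, hg, -⟩ := step i ih
    rw [hg] at hX
    exact hV.hasFiniteStateCost_greedy hM hRd hR hlam hgam (p.contDiff_policy _ hΦ) (hb i)
      ((contDiff_dotProduct hΦ _).of_le (by norm_num)) hX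

theorem timePolicy_isPolicyValue (hM : p.M.PosSemidef) (hRd : p.R.IsDiag)
    (hR : p.R.PosDef) (hlam : 0 < p.lam) (hgam : 0 < p.gam) (hΦ : ContDiff ℝ 2 Φ)
    {K₀ : Matrix (Fin m) (GradIdx n L) ℝ} (hadm : p.IsAdmissible (p.policy Φ K₀))
    {E : ℕ → p.Experiment}
    (hE : ∀ i, FullRank ((E i).regressorTime Φ (p.timePolicy Φ E K₀ i)))
    (hspan : ∀ i V, p.IsPolicyValue p.R (p.timePolicy Φ E K₀ i) V →
      ∃ W : Fin L → ℝ, ∀ x, V x = W ⬝ᵥ Φ x) (i : ℕ) :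
    (p.IsPolicyValue p.R (p.timePolicy Φ E K₀ i) fun y => p.timeW Φ E K₀ i ⬝ᵥ Φ y) ∧
      p.timePolicy Φ E K₀ (i + 1) = p.greedy (fun y => p.timeW Φ E K₀ i ⬝ᵥ Φ y) := by
  have hb : ∀ i x a, |p.timePolicy Φ E K₀ i x a| ≤ p.lam :=
    fun i x a => (p.abs_policy_lt _ hlam x a).le
  have step : ∀ i, (∀ x₀ X, p.IsClosedLoop (p.timePolicy Φ E K₀ i) x₀ X →
      p.HasFiniteStateCost X) →
      (p.IsPolicyValue p.R (p.timePolicy Φ E K₀ i) fun y => p.timeW Φ E K₀ i ⬝ᵥ Φ y) ∧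
      p.timePolicy Φ E K₀ (i + 1) = p.greedy (fun y => p.timeW Φ E K₀ i ⬝ᵥ Φ y) := by
    intro i hfin
    obtain ⟨V, hV⟩ := exists_isPolicyValue hlam hgam (p.contDiff_policy _ hΦ) (hb i) p.R hfin
    obtain ⟨W, hW⟩ := hspan i V hV
    obtain rfl : V = fun y => W ⬝ᵥ Φ y := funext hW
    have hΘ := timeTheta_eq hlam hRd hΦ (hE i) hV
    have hWi : p.timeW Φ E K₀ i = W := (congrArg thetaW hΘ).trans (p.thetaW_exactTheta W)
    rw [hWi]
    exact ⟨hV, (congrArg (fun Θ => p.policy Φ (nextGain Θ)) hΘ).trans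
      (p.policy_nextGain_exactTheta hlam hRd hR hΦ W)⟩
  refine step i ?_
  induction i with
  | zero =>
    obtain ⟨-, -, V, hV⟩ := hadm
    exact fun x₀ X hX => hV.hasFiniteStateCost hlam hgam (hb 0) hX
  | succ i ih =>
    intro x₀ X hX
    obtain ⟨hV, hg⟩ := step i ih
    rw [hg] at hX
    exact hV.hasFiniteStateCost_greedy hM hRd hR hlam hgam (p.contDiff_policy _ hΦ) (hb i)
      ((contDiff_dotProduct hΦ _).of_le (by norm_num)) hX

end TrackingProblem

end

theorem theorem3 {n m L : ℕ} (p : TrackingProblem n m)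
    (hM : p.M.PosSemidef) (hRd : p.R.IsDiag) (hR : p.R.PosDef)
    (hlam : 0 < p.lam) (hgam : 0 < p.gam)
    (sqrtM : Matrix (Fin n) (Fin n) ℝ) (hsqrt : sqrtM.PosSemidef) (hsqrtM : sqrtM * sqrtM = p.M)
    (hobs : IsObservable p.A sqrtM) (hstab : IsStabilizable p.A p.B)
    (Φ : AugState n → Fin L → ℝ) (hΦ : ContDiff ℝ 2 Φ)
    (K₀ : Matrix (Fin m) (GradIdx n L) ℝ) (hadm : p.IsAdmissible (p.policy Φ K₀)) :
    -- the off-policy algorithm, with an arbitrary initial value `Λ₀` of `Λ_uu`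
    (∀ (E : ℕ → p.Experiment) (Λ₀ : Matrix (Fin m) (Fin m) ℝ),
      (∀ i, TrackingProblem.FullRank ((E i).regressorOff Φ (p.offPolicy Φ E K₀ Λ₀ i))) →
      (∀ i V, p.IsPolicyValue (p.offWeight Φ E K₀ Λ₀ i) (p.offPolicy Φ E K₀ Λ₀ i) V →
        ∃ W : Fin L → ℝ, ∀ x, V x = W ⬝ᵥ Φ x) →
      (∀ i x, p.hamiltonian (p.offWeight Φ E K₀ Λ₀ i) (fun y => p.offW Φ E K₀ Λ₀ i ⬝ᵥ Φ y) x
          (p.offPolicy Φ E K₀ Λ₀ i x) = 0 ∧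
        p.offPolicy Φ E K₀ Λ₀ (i + 1) x = p.greedy (fun y => p.offW Φ E K₀ Λ₀ i ⬝ᵥ Φ y) x ∧
        p.offWeight Φ E K₀ Λ₀ (i + 1) = p.R) ∧
      ∃ Wstar : Fin L → ℝ, p.IsOptimalWeight Φ Wstar ∧
        (∀ W, p.IsOptimalWeight Φ W → W = Wstar) ∧
        Tendsto (p.offW Φ E K₀ Λ₀) atTop (𝓝 Wstar)) ∧
    -- the time-iterative algorithm
    (∀ E : ℕ → p.Experiment,
      (∀ i, TrackingProblem.FullRank ((E i).regressorTime Φ (p.timePolicy Φ E K₀ i))) →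
      (∀ i V, p.IsPolicyValue p.R (p.timePolicy Φ E K₀ i) V →
        ∃ W : Fin L → ℝ, ∀ x, V x = W ⬝ᵥ Φ x) →
      (∀ i x, p.hamiltonian p.R (fun y => p.timeW Φ E K₀ i ⬝ᵥ Φ y) x
          (p.timePolicy Φ E K₀ i x) = 0 ∧
        p.timePolicy Φ E K₀ (i + 1) x = p.greedy (fun y => p.timeW Φ E K₀ i ⬝ᵥ Φ y) x) ∧
      ∃ Wstar : Fin L → ℝ, p.IsOptimalWeight Φ Wstar ∧
        (∀ W, p.IsOptimalWeight Φ W → W = Wstar) ∧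
        Tendsto (p.timeW Φ E K₀) atTop (𝓝 Wstar)) := by
  have hb : ∀ K : Matrix (Fin m) (GradIdx n L) ℝ, ∀ x a, |p.policy Φ K x a| ≤ p.lam :=
    fun K x a => (p.abs_policy_lt K hlam x a).le
  refine ⟨fun E Λ₀ hE hspan => ?_, fun E hE hspan => ?_⟩
  · have h := TrackingProblem.offPolicy_isPolicyValue hM hRd hR hlam hgam hΦ hadm hE hspan
    refine ⟨fun i x => ⟨(h i).1.hamiltonian_policy_eq_zero hlam hΦ x, congrFun (h i).2.1 x,
      (h i).2.2⟩, ?_⟩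
    have hinj := TrackingProblem.injective_of_fullRank_regressorOff hlam hRd hΦ
      (p.contDiff_policy _ hΦ).continuous (hE 0)
    -- Iteration `0` is evaluated with `Λ₀`, so monotonicity may fail there; from iteration `1` on
    -- the weight is `R`, and convergence is applied to the shifted sequence.
    obtain ⟨Wstar, hopt, huniq, hlim⟩ := TrackingProblem.exists_isOptimalWeight_of_policyIteration hM hRd hR hlam
      hgam hsqrt hsqrtM hΦ hinj (μ := fun i => p.offPolicy Φ E K₀ Λ₀ (i + 1))
      (W := fun i => p.offW Φ E K₀ Λ₀ (i + 1)) (fun i => p.contDiff_policy _ hΦ) (fun i => hb _)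
      (fun i => (h i).2.2 ▸ (h (i + 1)).1) (fun i => (h (i + 1)).2.1)
    exact ⟨Wstar, hopt, huniq, (tendsto_add_atTop_iff_nat 1).1 hlim⟩
  · have h := TrackingProblem.timePolicy_isPolicyValue hM hRd hR hlam hgam hΦ hadm hE hspan
    refine ⟨fun i x => ⟨(h i).1.hamiltonian_policy_eq_zero hlam hΦ x, congrFun (h i).2 x⟩, ?_⟩
    have hinj := TrackingProblem.injective_of_fullRank_regressorTime hlam hRd hΦ
      (p.contDiff_policy _ hΦ).continuous (p.abs_policy_lt _ hlam) (hE 0)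
    exact TrackingProblem.exists_isOptimalWeight_of_policyIteration hM hRd hR hlam hgam hsqrt hsqrtM hΦ hinj
      (fun i => p.contDiff_policy _ hΦ) (fun i => hb _) (fun i => (h i).1) (fun i => (h i).2)
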